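/- Let $\Phi$ be the root system of a complex semisimple group $G$ with maximal torus $T$, with positive roots $\Phi^+$ and simple roots $\Delta$; let $X^\vee$ be the co-character group of $T$, $\mathcal A=X^\vee\otimes\mathbb R$, and let $\rho$ be half the sum of the positive roots. For $\beta\in\Phi$, $m\in\mathbb Z$ let $H_{\beta,m}=\{x:\langle x,\beta\rangle=m\}$, $H^{\pm}_{\beta,m}$ the closed half-spaces $\langle x,\beta\rangle\ge m$, resp. $\le m$, and $s_{\beta,m}$ the reflection at $H_{\beta,m}$. The reflections $s_{\beta,m}$ generate the affine Weyl group $W^{\mathfrak a}$, and the hyperplanes $H_{\beta,m}$ ("walls") cut $\mathcal A$ into (closed) faces. Two faces have the same type if they are $W^{\mathfrak a}$-conjugate. A wall $H$ separates $E$ from a face $F$ if $E$ lies in one of its closed half-spaces and the open face of $F$ lies in the opposite open half-space; $H$ separates $F$ from $-\infty$ if it separates some sector equivalent to the anti-dominant chamber from $F$. A (combinatorial) gallery is a sequence of faces $\gamma=(\Gamma'_0\subset\Gamma_0\supset\Gamma'_1\subset\Gamma_1\supset\cdots\supset\Gamma'_p\subset\Gamma_p\supset\Gamma'_{p+1})$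 such that $\Gamma'_0,\Gamma'_{p+1}$ (source and target) are vertices, the large faces $\Gamma_j$ all have the same dimension, and the small faces $\Gamma'_j$, $1\le j\le p$, have relative codimension one. Let $\mathcal H_j(\gamma)$ be the set of walls containing $\Gamma'_j$ but not $\Gamma_j$, $0\le j\le p$. Let $\lambda\in X^\vee$ be dominant and fix a minimal gallery $\gamma_\lambda$ from $0$ to $\lambda$: its large faces have the dimension of $\bigcap_{\langle\lambda,\alpha\rangle=0}H_{\alpha,0}$, and the set of walls separating $0$ and $\lambda$ is the disjoint union of the $\mathcal H_j(\gamma_\lambda)$. Let $\Gamma(\gamma_\lambda)$ be the set of galleries with source $0$ whose faces have, place by place, the same types as those of $\gamma_\lambda$. A gallery $\delta=(\Sigma'_0\subset\Sigma_0\supset\cdots)\in\Gamma(\gamma_\lambda)$ is positively folded if for every $1\le j\le p$ there is a face $\Omega\supset\Sigma'_j$ such that $(\Sigma_{j-1}\supset\Sigma'_j\subset\Omega)$ is minimal (the walls separating $\Sigma_{j-1}$ and $\Omega$ are exactly the walls containing $\Sigma'_j$ but not $\Omega$) and a sequence $\Omega=E_0,E_1,\dots,E_r=\Sigma_j$ ($r\ge0$)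 in which $E_i$ is the image of $E_{i-1}$ under the reflection at a wall that contains $\Sigma'_j$ and separates $E_i$ from $-\infty$. Let $\Gamma^+(\gamma_\lambda)$ be the set of positively folded galleries in $\Gamma(\gamma_\lambda)$. The dimension $\dim\delta$ is the number of pairs $(H,j)$, $0\le j\le p$, such that $H\in\mathcal H_j(\delta)$ separates $\Sigma_j$ from $-\infty$. A gallery $\delta\in\Gamma^+(\gamma_\lambda)$ with target $\nu$ is an LS-gallery if $\dim\delta=\langle\lambda+\nu,\rho\rangle$. For a simple root $\alpha$ and a gallery $\gamma$ with target $\nu$ let $m$ be the minimal integer such that some small face of $\gamma$ is contained in $H_{\alpha,m}$. The gallery $e_\alpha\gamma$ is defined if $m\le-1$: let $k$ be minimal with $\Gamma'_k\subset H_{\alpha,m}$ and $j\le k$ maximal with $\Gamma'_j\subset H_{\alpha,m+1}$; keep the faces $\Gamma'_i,\Gamma_i$ with $i<j$, apply $s_{\alpha,m+1}$ to those with $j\le i<k$, and translate those with $i\ge k$ by $\alpha^\vee$. The gallery $f_\alpha\gamma$ is defined if $\langle\nu,\alpha\rangle-m\ge1$: let $j$ be maximal with $\Gamma'_j\subset H_{\alpha,m}$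 and $k\ge j$ minimal with $\Gamma'_k\subset H_{\alpha,m+1}$; keep the faces with $i<j$, apply $s_{\alpha,m}$ to those with $j\le i<k$, and translate those with $i\ge k$ by $-\alpha^\vee$. For a gallery $\delta$ with source $0$ and target $\nu$, let $\delta^*$ be the translate of $\delta$ by $-\nu$, with the order of the faces reversed. Let $w_0$ be the longest element of the Weyl group and $\lambda^*=-w_0(\lambda)$; LS-galleries of type $\lambda^*$ are formed with respect to the gallery $w_0(\gamma_\lambda^*)$ from $0$ to $\lambda^*$. Then: (i) Let $\delta\in\Gamma^+(\gamma_\lambda)$ have target $\nu$. Then $\dim\delta=\langle\lambda+\nu,\rho\rangle$ if and only if there are simple roots $\alpha_{i_1},\dots,\alpha_{i_t}$ ($t\ge0$) such that $e_{\alpha_{i_1}}\cdots e_{\alpha_{i_t}}\delta$ is defined and equal to $\gamma_\lambda$. For any given sequence of simple roots, this last condition is equivalent to: $f_{\alpha_{i_t}}\cdots f_{\alpha_{i_1}}\gamma_\lambda$ is defined and equal to $\delta$. In particular, the set of LS-galleries in $\Gamma^+(\gamma_\lambda)$ is exactly the set of galleries generated from $\gamma_\lambda$ by the operators $f_\alpha$,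 $\alpha\in\Delta$. (ii) A gallery $\delta\in\Gamma(\gamma_\lambda)$ is an LS-gallery of type $\lambda$ if and only if $\delta^*$ is an LS-gallery of type $\lambda^*$. -/

import Mathlib

namespace LSGallery

noncomputable section

/-- A sequence of subsets `Γ'₀ ⊂ Γ₀ ⊃ Γ'₁ ⊂ Γ₁ ⊃ ⋯ ⊃ Γ'ₚ ⊂ Γₚ ⊃ Γ'ₚ₊₁` (as raw data): the "large"
entries are the `Γⱼ`, `0 ≤ j ≤ p`, the "small" ones are the `Γ'ⱼ`, `0 ≤ j ≤ p + 1`. -/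
@[ext]
structure Gallery (N : Type*) (p : ℕ) where
  small : Fin (p + 2) → Set N
  large : Fin (p + 1) → Set N

/-- Apply one and the same map to all entries. -/
def Gallery.map {N : Type*} {p : ℕ} (φ : N → N) (γ : Gallery N p) : Gallery N p where
  small i := φ '' γ.small i
  large i := φ '' γ.large i

/-- Apply a map depending on the position to all entries; `Γ'ⱼ` and `Γⱼ` have position `j`. -/
def Gallery.mapAt {N : Type*} {p : ℕ} (φ : ℕ → N → N) (γ : Gallery N p) : Gallery N p where
  small i := φ i '' γ.small i
  large i := φ i '' γ.large i

/-- The same entries in reverse order. -/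
def Gallery.reverse {N : Type*} {p : ℕ} (γ : Gallery N p) : Gallery N p where
  small i := γ.small i.rev
  large i := γ.large i.rev

/-- The gallery `δ*` of a gallery `δ` with target `ν`: translate by `-ν`, then reverse. -/
def Gallery.dual {N : Type*} [AddCommGroup N] {p : ℕ} (δ : Gallery N p) (ν : N) : Gallery N p :=
  (δ.map (fun x => x - ν)).reverse

section

variable {ι M N : Type*} [AddCommGroup M] [Module ℝ M] [AddCommGroup N] [Module ℝ N]
variable (P : RootPairing ι ℝ M N) (b : P.Base)

/-! ### The affine Coxeter complex

`N` is the real vector space `𝒜 = X^∨ ⊗ ℝ` and `P.root' i : N → ℝ` is the root with index `i`, viewed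
as a linear form on it. A wall is given by a positive root and an integer. -/

/-- `L` can serve as the group of co-characters `X^∨` of a semisimple group with root system `P`:
it contains the coroots, and all roots take integral values on it. -/
structure IsCocharacterGroup (L : AddSubgroup N) : Prop where
  coroot_mem : ∀ i, P.coroot i ∈ L
  integral : ∀ x ∈ L, ∀ i, ∃ n : ℤ, P.root' i x = n

/-- The hyperplane `H_{β,m}`. -/
def wall (i : ι) (m : ℤ) : Set N := {x | P.root' i x = m}

/-- The closed half-space `H_{β,m}^+`. -/
def upper (i : ι) (m : ℤ) : Set N := {x | (m : ℝ) ≤ P.root' i x}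

/-- The closed half-space `H_{β,m}^-`. -/
def lower (i : ι) (m : ℤ) : Set N := {x | P.root' i x ≤ m}

/-- The affine reflection `s_{β,m}`. -/
def affReflFun (i : ι) (m : ℤ) (x : N) : N := x - (P.root' i x - m) • P.coroot i

theorem affReflFun_involutive (i : ι) (m : ℤ) : Function.Involutive (affReflFun P i m) := by
  intro x
  have h : P.root' i (P.coroot i) = 2 := P.root_coroot_two i
  simp only [affReflFun, map_sub, map_smul, h, smul_eq_mul]
  module

/-- The affine reflection `s_{β,m}` as a bijection. -/
def affRefl (i : ι) (m : ℤ) : Equiv.Perm N := (affReflFun_involutive P i m).toPerm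

/-- The affine Weyl group, generated by all `s_{β,m}`. -/
def affineWeylGroup : Subgroup (Equiv.Perm N) :=
  Subgroup.closure (Set.range fun q : ι × ℤ => affRefl P q.1 q.2)

/-- The Weyl group acting on `N`, generated by all `s_{β,0}`. -/
def finiteWeylGroup : Subgroup (Equiv.Perm N) :=
  Subgroup.closure (Set.range fun i : ι => affRefl P i 0)

/-- The closed face whose open face contains `x`: the open face consists of the points lying on the
same walls and in the same open half-spaces as `x`, and the closed face is its closure, obtained by
making the strict inequalities weak. -/
def faceOf (x : N) : Set N :=
  {y | ∀ (i : ι) (m : ℤ), (x ∈ upper P i m → y ∈ upper P i m) ∧ (x ∈ lower P i m → y ∈ lower P i m)}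

/-- (Closed) faces. For such sets, `F` is a face of `C` if and only if `F ⊆ C`. -/
def IsFace (F : Set N) : Prop := ∃ x, F = faceOf P x

/-- The dimension of the affine span. -/
def faceDim (F : Set N) : ℕ := Module.finrank ℝ (vectorSpan ℝ F)

/-- Two faces have the same type if they are conjugate under the affine Weyl group. (Every face is
conjugate to a unique face `F'` of the fundamental alcove, and `F'` in turn is determined by the set
of the simple affine reflections fixing it.) -/
def SameType (E F : Set N) : Prop := ∃ w ∈ affineWeylGroup P, F = w '' E

/-- The wall `H_{β,m}` separates `E` from the face `F`: the set `E` is contained in one of the closed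
half-spaces and the open face of `F` in the opposite open half-space. -/
def Separates (i : ι) (m : ℤ) (E F : Set N) : Prop :=
  (E ⊆ lower P i m ∧ F ⊆ upper P i m ∧ ¬ F ⊆ wall P i m) ∨
    (E ⊆ upper P i m ∧ F ⊆ lower P i m ∧ ¬ F ⊆ wall P i m)

/-- The dominant chamber. -/
def dominantChamber : Set N := {x | ∀ i, b.IsPos i → 0 ≤ P.root' i x}

/-- `v + (-C)` where `C` is the dominant chamber. For `v` in the coroot lattice these are exactly the
sectors equivalent to `-C`, i.e. the representatives of the anti-dominant chamber at infinity. -/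
def antidominantSector (v : N) : Set N := {x | v - x ∈ dominantChamber P b}

/-- The wall `H_{β,m}` separates the face `F` from the anti-dominant chamber at `-∞`. -/
def SeparatesFromNegInfty (i : ι) (m : ℤ) (F : Set N) : Prop :=
  ∃ v ∈ AddSubgroup.closure (Set.range P.coroot), Separates P i m (antidominantSector P b v) F

/-- Half the sum of the positive roots. -/
def rho : M := (1 / 2 : ℝ) • ∑ᶠ i ∈ {i | b.IsPos i}, P.root i

/-- The element of the Weyl group mapping the dominant chamber to its negative. -/
def IsLongestElement (w : Equiv.Perm N) : Prop :=
  w ∈ finiteWeylGroup P ∧ w '' dominantChamber P b = {x | -x ∈ dominantChamber P b}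

/-- The intersection of the hyperplanes `H_{α,0}` for the roots `α` orthogonal to `lam`. -/
def orthSubspace (lam : N) : Submodule ℝ N :=
  ⨅ i, ⨅ _ : P.root' i lam = 0, LinearMap.ker (P.root' i)

/-! ### Galleries -/

/-- Generalized galleries in the apartment `N` (combinatorial galleries). -/
structure IsGallery {p : ℕ} (γ : Gallery N p) : Prop where
  small_isFace : ∀ i, IsFace P (γ.small i)
  large_isFace : ∀ j, IsFace P (γ.large j)
  left_subset : ∀ j : Fin (p + 1), γ.small j.castSucc ⊆ γ.large j
  right_subset : ∀ j : Fin (p + 1), γ.small j.succ ⊆ γ.large j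
  source_vertex : faceDim (γ.small 0) = 0
  target_vertex : faceDim (γ.small (Fin.last (p + 1))) = 0
  large_dim : ∀ j k, faceDim (γ.large j) = faceDim (γ.large k)
  codim_one : ∀ j : Fin p, faceDim (γ.small j.succ.castSucc) + 1 = faceDim (γ.large j.succ)

/-- The set `ℋⱼ` of the walls containing `Γ'ⱼ` but not `Γⱼ`. -/
def wallsAt {p : ℕ} (γ : Gallery N p) (j : Fin (p + 1)) : Set (ι × ℤ) :=
  {q | b.IsPos q.1 ∧ γ.small j.castSucc ⊆ wall P q.1 q.2 ∧ ¬ γ.large j ⊆ wall P q.1 q.2}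

/-- The set `ℳ(E, F)` of the walls separating `E` and `F`. -/
def separatingWalls (E F : Set N) : Set (ι × ℤ) :=
  {q | b.IsPos q.1 ∧ Separates P q.1 q.2 E F}

/-- Minimal combinatorial galleries joining `0` with `lam`: the large faces have the dimension of
`orthSubspace P lam`, and the set of walls separating `0` and `lam` is the disjoint union of the
`ℋⱼ`. (So each separating wall is crossed exactly once and no other wall is crossed, which means that
the gallery embeds in a minimal gallery of alcoves.) -/
structure IsMinimalGallery {p : ℕ} (lam : N) (γ : Gallery N p) : Prop where
  isGallery : IsGallery P γ
  source : γ.small 0 = {0}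
  target : γ.small (Fin.last (p + 1)) = {lam}
  large_dim : ∀ j, faceDim (γ.large j) = Module.finrank ℝ (orthSubspace P lam)
  walls_disjoint : Pairwise fun j k => Disjoint (wallsAt P b γ j) (wallsAt P b γ k)
  walls_union : ⋃ j, wallsAt P b γ j = separatingWalls P b {0} {lam}

/-- `Γ(γ₀)`: the combinatorial galleries of the same type as `γ₀` starting at the origin. -/
def galleriesOfType {p : ℕ} (γ₀ : Gallery N p) : Set (Gallery N p) :=
  {δ | IsGallery P δ ∧ δ.small 0 = {0} ∧ (∀ i, SameType P (γ₀.small i) (δ.small i)) ∧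
    ∀ j, SameType P (γ₀.large j) (δ.large j)}

/-- `(E ⊃ F' ⊂ F)` is minimal: the walls separating `E` and `F` are exactly the walls containing
`F'` but not `F`. -/
def IsMinimalTriple (E F' F : Set N) : Prop :=
  separatingWalls P b E F = {q | b.IsPos q.1 ∧ F' ⊆ wall P q.1 q.2 ∧ ¬ F ⊆ wall P q.1 q.2}

/-- `E₂` is the image of `E₁` under the reflection at a wall containing `F'`, and this wall separates
the image `E₂` from the anti-dominant chamber at `-∞`. -/
def PositiveReflection (F' E₁ E₂ : Set N) : Prop :=
  ∃ (i : ι) (m : ℤ), b.IsPos i ∧ F' ⊆ wall P i m ∧ E₂ = affRefl P i m '' E₁ ∧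
    SeparatesFromNegInfty P b i m E₂

/-- `(E ⊃ F' ⊂ F)` is positively folded (or not folded) at `F'`: one obtains `F` from the face `Ω`
continuing `E` minimally beyond `F'`, by a (possibly empty) sequence of positive reflections at walls
containing `F'`. The face `Ω` has the type of `F`, since `F` is the image of `Ω` under a product of
reflections. -/
def PositivelyFoldedAt (E F' F : Set N) : Prop :=
  ∃ Ω, IsFace P Ω ∧ F' ⊆ Ω ∧ IsMinimalTriple P b E F' Ω ∧
    Relation.ReflTransGen (PositiveReflection P b F') Ω F

/-- `Γ⁺(γ₀)`: the positively folded galleries in `Γ(γ₀)`. -/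
def positivelyFolded {p : ℕ} (γ₀ : Gallery N p) : Set (Gallery N p) :=
  {δ | δ ∈ galleriesOfType P γ₀ ∧ ∀ j : Fin p,
    PositivelyFoldedAt P b (δ.large j.castSucc) (δ.small j.succ.castSucc) (δ.large j.succ)}

/-- The dimension of a gallery: the number of pairs consisting of a position `j` and a wall
which is load-bearing at `Γⱼ`, i.e. belongs to `ℋⱼ` and separates `Γⱼ` from the anti-dominant
chamber at `-∞`. -/
def galleryDim {p : ℕ} (γ : Gallery N p) : ℕ :=
  Set.ncard {q : (ι × ℤ) × Fin (p + 1) |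
    q.1 ∈ wallsAt P b γ q.2 ∧ SeparatesFromNegInfty P b q.1.1 q.1.2 (γ.large q.2)}

/-- `δ ∈ Γ⁺(γ₀)` is an LS-gallery of type `lam`, i.e. its dimension is `⟨lam + ν, ρ⟩`, where `ν` is the
target of `δ`. -/
def IsLSGallery {p : ℕ} (lam : N) (γ₀ δ : Gallery N p) : Prop :=
  δ ∈ positivelyFolded P b γ₀ ∧ ∃ ν : N, δ.small (Fin.last (p + 1)) = {ν} ∧
    (galleryDim P b δ : ℝ) = P.toLinearMap (rho P b) (lam + ν)

/-! ### Root operators -/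

/-- `m` is the minimal integer such that a small face of `γ` is contained in `H_{α,m}`. -/
def IsMinLevel {p : ℕ} (i : ι) (γ : Gallery N p) (m : ℤ) : Prop :=
  IsLeast {n : ℤ | ∃ k, γ.small k ⊆ wall P i n} m

/-- The graph of the partially defined operator `e_α`: `e_α γ` is defined and equal to `δ`. The entries
with positions `< j` are kept, those with positions `j, …, k - 1` are reflected by `s_{α,m+1}`, and
those with positions `≥ k` are translated by `α^∨`. -/
def RootE {p : ℕ} (i : ι) (γ δ : Gallery N p) : Prop :=
  ∃ (m : ℤ) (j k : Fin (p + 2)), IsMinLevel P i γ m ∧ m ≤ -1 ∧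
    IsLeast {k | γ.small k ⊆ wall P i m} k ∧
    IsGreatest {j | j ≤ k ∧ γ.small j ⊆ wall P i (m + 1)} j ∧
    δ = γ.mapAt fun l x =>
      if l < (j : ℕ) then x else if l < (k : ℕ) then affRefl P i (m + 1) x else x + P.coroot i

/-- The graph of the partially defined operator `f_α`: `f_α γ` is defined and equal to `δ`. The entries
with positions `< j` are kept, those with positions `j, …, k - 1` are reflected by `s_{α,m}`, and
those with positions `≥ k` are translated by `-α^∨`. -/
def RootF {p : ℕ} (i : ι) (γ δ : Gallery N p) : Prop :=
  ∃ (m : ℤ) (j k : Fin (p + 2)), IsMinLevel P i γ m ∧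
    (∃ ν : N, γ.small (Fin.last (p + 1)) = {ν} ∧ 1 ≤ P.root' i ν - m) ∧
    IsGreatest {j | γ.small j ⊆ wall P i m} j ∧
    IsLeast {k | j ≤ k ∧ γ.small k ⊆ wall P i (m + 1)} k ∧
    δ = γ.mapAt fun l x =>
      if l < (j : ℕ) then x else if l < (k : ℕ) then affRefl P i m x else x - P.coroot i

theorem RootE.unique {p : ℕ} {i : ι} {γ δ δ' : Gallery N p}
    (h : RootE P i γ δ) (h' : RootE P i γ δ') : δ = δ' := by
  obtain ⟨m, j, k, hm, -, hk, hj, rfl⟩ := h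
  obtain ⟨m', j', k', hm', -, hk', hj', rfl⟩ := h'
  obtain rfl := hm.unique hm'
  obtain rfl := hk.unique hk'
  obtain rfl := hj.unique hj'
  rfl

theorem RootF.unique {p : ℕ} {i : ι} {γ δ δ' : Gallery N p}
    (h : RootF P i γ δ) (h' : RootF P i γ δ') : δ = δ' := by
  obtain ⟨m, j, k, hm, -, hj, hk, rfl⟩ := h
  obtain ⟨m', j', k', hm', -, hj', hk', rfl⟩ := h'
  obtain rfl := hm.unique hm'
  obtain rfl := hj.unique hj'
  obtain rfl := hk.unique hk'
  rfl

/-- `RootESeq P [α₁, …, αₜ] δ γ` means: `e_{α₁} ⋯ e_{αₜ} δ` is defined and equal to `γ`. -/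
def RootESeq {p : ℕ} : List ι → Gallery N p → Gallery N p → Prop
  | [], δ, γ => δ = γ
  | i :: s, δ, γ => ∃ δ', RootESeq s δ δ' ∧ RootE P i δ' γ

/-- `RootFSeq P [α₁, …, αₜ] γ δ` means: `f_{αₜ} ⋯ f_{α₁} γ` is defined and equal to `δ`. -/
def RootFSeq {p : ℕ} : List ι → Gallery N p → Gallery N p → Prop
  | [], γ, δ => γ = δ
  | i :: s, γ, δ => ∃ γ', RootF P i γ γ' ∧ RootFSeq s γ' δ

end

end

end LSGallery

open LSGallery

set_option linter.unusedSectionVars false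

/-! Everything is expressed through levels. For a root `i`, a face has level `2 m` if it lies in
`H_{i,m}` and `2 m + 1` if its open face lies strictly between `H_{i,m}` and `H_{i,m+1}`. The levels
determine the face, and separation from `-∞`, minimality, dimension and the root operators become
statements about integer sequences (`separatesFromNegInfty_iff`, `isMinimalTriple_iff`,
`galleryDim_eq_sum`, `rootE_iff`, `rootF_iff`).

Both `e_α` and `f_α` are instances of `Gallery.fold`: a stretch between two small faces on walls of
direction `α` is reflected and the rest is translated. A simple reflection permutes the positive
roots other than `α`, so the dimension changes only through the `α`-wall where the stretch begins
(`galleryDim_fold`). Hence `e_α` raises both `dim δ` and `⟨λ + ν, ρ⟩` by one, and its inverse `f_α`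
lowers both by one. Positive foldedness has to be checked only at the two ends of the stretch, where
it follows from a lifting property as for the Bruhat order (`reflTransGen_lowerImage`,
`reflTransGen_upperImage`).

The core is the bound `dim δ ≤ ⟨λ + ν, ρ⟩`, together with a chain of operators `e_α` in case of
equality (`galleryDim_le_aux`), by descending induction on the dimension. If a large face dips
strictly below the minimal `α`-level, folding the dip up keeps the target and raises the dimension.
Without dips, if some minimal level is negative, `e_α` applies. Otherwise the gallery is dominant
and equals `γ_λ` (`eq_of_dominant`), because a closed alcove contains at most one point of each
orbit of the affine Weyl group (`eq_of_forall_not_separated`). Equality in the bound forbids dips,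
so it yields the chain; the same remark shows that the operators preserve LS-galleries.

For (ii), reversal exchanges `e_α` and `f_α` (`RootE.dual`, `RootF.dual`), and `γ_λ^*` is itself an
LS-gallery of type `λ^*`, of dimension `0` (`isLSGallery_dual`). Chains of operators therefore carry
the LS property from one side to the other. -/

namespace LSGallery

noncomputable section

/-! ### Levels of real numbers -/

/-- The position of a real number relative to the integers: `2 n` for `r = n`, and `2 n + 1` for
`n < r < n + 1`. -/
def lev (r : ℝ) : ℤ := ⌊r⌋ + ⌈r⌉

theorem two_mul_le_lev {r : ℝ} {m : ℤ} : 2 * m ≤ lev r ↔ (m : ℝ) ≤ r := by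
  have h1 : ⌈r⌉ ≤ ⌊r⌋ + 1 := Int.ceil_le_floor_add_one r
  have h2 : ⌊r⌋ ≤ ⌈r⌉ := Int.floor_le_ceil r
  rw [← Int.le_floor, lev]
  omega

theorem lev_le_two_mul {r : ℝ} {m : ℤ} : lev r ≤ 2 * m ↔ r ≤ m := by
  have h1 : ⌈r⌉ ≤ ⌊r⌋ + 1 := Int.ceil_le_floor_add_one r
  have h2 : ⌊r⌋ ≤ ⌈r⌉ := Int.floor_le_ceil r
  rw [← Int.ceil_le, lev]
  omega

theorem lev_eq_two_mul {r : ℝ} {m : ℤ} : lev r = 2 * m ↔ r = m := by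
  rw [le_antisymm_iff, lev_le_two_mul, two_mul_le_lev, ← le_antisymm_iff]

theorem lev_neg (r : ℝ) : lev (-r) = -lev r := by
  simp only [lev, Int.floor_neg, Int.ceil_neg]; ring

theorem lev_add_int (r : ℝ) (k : ℤ) : lev (r + k) = lev r + 2 * k := by
  simp only [lev, Int.floor_add_intCast, Int.ceil_add_intCast]; ring

/-- The relation between the level `a` of a face of a closed face and the level `b` of the latter. -/
def Incident (a b : ℤ) : Prop := a = b ∨ (b % 2 = 1 ∧ (a = b - 1 ∨ a = b + 1))

variable {ι M N : Type*} [AddCommGroup M] [Module ℝ M] [AddCommGroup N] [Module ℝ N]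
variable (P : RootPairing ι ℝ M N)

/-! ### Faces -/

theorem mem_faceOf_self (x : N) : x ∈ faceOf P x := fun _ _ => ⟨id, id⟩

theorem isFace_faceOf (x : N) : IsFace P (faceOf P x) := ⟨x, rfl⟩

variable {P} in
theorem faceOf_subset_iff {x y : N} : faceOf P x ⊆ faceOf P y ↔ x ∈ faceOf P y :=
  ⟨fun h => h (mem_faceOf_self P x), fun h _ hz i m =>
    ⟨fun hy => (hz i m).1 ((h i m).1 hy), fun hy => (hz i m).2 ((h i m).2 hy)⟩⟩

variable {P} in
theorem mem_faceOf_iff {x y : N} :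
    y ∈ faceOf P x ↔ ∀ (i : ι) (m : ℤ), (2 * m ≤ lev (P.root' i x) → 2 * m ≤ lev (P.root' i y)) ∧
      (lev (P.root' i x) ≤ 2 * m → lev (P.root' i y) ≤ 2 * m) := by
  simp only [faceOf, upper, lower, two_mul_le_lev, lev_le_two_mul, Set.mem_ofPred_eq]

variable {P} in
theorem mem_faceOf_of_lev_eq {x y : N} (h : ∀ i, lev (P.root' i x) = lev (P.root' i y)) :
    y ∈ faceOf P x :=
  mem_faceOf_iff.2 fun i m => by rw [h i]; exact ⟨id, id⟩

variable {P} in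
theorem incident_of_mem_faceOf {x y : N} (h : y ∈ faceOf P x) (i : ι) :
    Incident (lev (P.root' i y)) (lev (P.root' i x)) := by
  rw [mem_faceOf_iff] at h
  -- These two integers are the floor and the ceiling of the value at `x`, that is, the nearest
  -- walls on either side.
  have h1 := h i (lev (P.root' i x) / 2)
  have h2 := h i ((lev (P.root' i x) + 1) / 2)
  unfold Incident
  omega

variable {P} in
theorem faceOf_eq_faceOf_iff {x y : N} :
    faceOf P x = faceOf P y ↔ ∀ i, lev (P.root' i x) = lev (P.root' i y) := by
  constructor
  · intro h i
    have h1 := incident_of_mem_faceOf (P := P) (h ▸ mem_faceOf_self P x) i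
    have h2 := incident_of_mem_faceOf (P := P) (h.symm ▸ mem_faceOf_self P y) i
    unfold Incident at h1 h2
    omega
  · intro h
    exact (faceOf_subset_iff.2 (mem_faceOf_of_lev_eq fun i => (h i).symm)).antisymm
      (faceOf_subset_iff.2 (mem_faceOf_of_lev_eq h))

open Classical in
/-- The level of a face with respect to a root: `2 m` if the face is contained in `H_{β,m}`, and
`2 m + 1` if the open face lies strictly between `H_{β,m}` and `H_{β,m+1}`. -/
def faceLevel (F : Set N) (i : ι) : ℤ :=
  -- The default `0` is its own negative, so `faceLevel_opp` needs no face hypothesis.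
  if h : IsFace P F then lev (P.root' i h.choose) else 0

variable {P}

theorem faceLevel_faceOf (x : N) (i : ι) : faceLevel P (faceOf P x) i = lev (P.root' i x) := by
  have h : IsFace P (faceOf P x) := isFace_faceOf P x
  rw [faceLevel, dif_pos h]
  exact (faceOf_eq_faceOf_iff.1 h.choose_spec i).symm

theorem IsFace.subset_upper_iff {F : Set N} (hF : IsFace P F) {i : ι} {m : ℤ} :
    F ⊆ upper P i m ↔ 2 * m ≤ faceLevel P F i := by
  obtain ⟨x, rfl⟩ := hF
  rw [faceLevel_faceOf, two_mul_le_lev]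
  exact ⟨fun h => h (mem_faceOf_self P x), fun h y hy => (hy i m).1 h⟩

theorem IsFace.subset_lower_iff {F : Set N} (hF : IsFace P F) {i : ι} {m : ℤ} :
    F ⊆ lower P i m ↔ faceLevel P F i ≤ 2 * m := by
  obtain ⟨x, rfl⟩ := hF
  rw [faceLevel_faceOf, lev_le_two_mul]
  exact ⟨fun h => h (mem_faceOf_self P x), fun h y hy => (hy i m).2 h⟩

theorem wall_eq_inter (i : ι) (m : ℤ) : wall P i m = lower P i m ∩ upper P i m := by
  ext x; exact le_antisymm_iff

theorem IsFace.subset_wall_iff {F : Set N} (hF : IsFace P F) {i : ι} {m : ℤ} :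
    F ⊆ wall P i m ↔ faceLevel P F i = 2 * m := by
  rw [wall_eq_inter, Set.subset_inter_iff, hF.subset_lower_iff, hF.subset_upper_iff,
    ← le_antisymm_iff]

theorem IsFace.incident {E F : Set N} (hE : IsFace P E) (hF : IsFace P F) (h : E ⊆ F) (i : ι) :
    Incident (faceLevel P E i) (faceLevel P F i) := by
  obtain ⟨x, rfl⟩ := hE
  obtain ⟨y, rfl⟩ := hF
  rw [faceLevel_faceOf, faceLevel_faceOf]
  exact incident_of_mem_faceOf (faceOf_subset_iff.1 h) i

theorem IsFace.separates_iff {F : Set N} (hF : IsFace P F) {E : Set N} {i : ι} {m : ℤ} :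
    Separates P i m E F ↔ (E ⊆ lower P i m ∧ 2 * m < faceLevel P F i) ∨
      (E ⊆ upper P i m ∧ faceLevel P F i < 2 * m) := by
  unfold Separates
  rw [hF.subset_upper_iff, hF.subset_lower_iff, hF.subset_wall_iff]
  refine or_congr (and_congr_right fun _ => ?_) (and_congr_right fun _ => ?_) <;> omega

/-! ### Opposite roots -/

/-- The index of the opposite root. -/
def opp (P : RootPairing ι ℝ M N) (i : ι) : ι := P.reflectionPerm i i

@[simp] theorem root_opp (i : ι) : P.root (opp P i) = -P.root i := by
  rw [opp, P.root_reflectionPerm, P.reflection_apply_self]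

@[simp] theorem coroot_opp (i : ι) : P.coroot (opp P i) = -P.coroot i := by
  rw [opp, P.coroot_reflectionPerm, P.coreflection_apply_self]

theorem root'_opp (i : ι) (x : N) : P.root' (opp P i) x = -P.root' i x := by
  rw [RootPairing.root', root_opp, map_neg, LinearMap.neg_apply]

@[simp] theorem opp_opp (i : ι) : opp P (opp P i) = i :=
  P.root.injective (by simp)

theorem faceLevel_opp (F : Set N) (i : ι) : faceLevel P F (opp P i) = -faceLevel P F i := by
  unfold faceLevel
  split_ifs with h
  · rw [root'_opp, lev_neg]
  · simp

theorem isPos_opp {b : P.Base} {i : ι} : b.IsPos (opp P i) ↔ ¬ b.IsPos i :=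
  RootPairing.Base.IsPos.neg_iff_not b i

theorem affRefl_apply (i : ι) (m : ℤ) (x : N) :
    affRefl P i m x = x - (P.root' i x - m) • P.coroot i := rfl

theorem affRefl_affRefl (i : ι) (m : ℤ) (x : N) : affRefl P i m (affRefl P i m x) = x :=
  affReflFun_involutive P i m x

theorem affRefl_opp (i : ι) (m : ℤ) : affRefl P (opp P i) (-m) = affRefl P i m := by
  ext x
  simp only [affRefl_apply, root'_opp, coroot_opp, Int.cast_neg]
  module

theorem root'_affRefl (i j : ι) (m : ℤ) (x : N) :
    P.root' j (affRefl P i m x) = P.root' j x - (P.root' i x - m) * P.pairing j i := by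
  rw [affRefl_apply, map_sub, map_smul, smul_eq_mul, P.root'_coroot_eq_pairing]

theorem root'_reflectionPerm (i j : ι) (x : N) :
    P.root' (P.reflectionPerm i j) x = P.root' j x - P.pairing j i * P.root' i x := by
  rw [RootPairing.root', P.root_reflectionPerm, P.reflection_apply_root, map_sub, map_smul,
    LinearMap.sub_apply, LinearMap.smul_apply, smul_eq_mul]

theorem root'_affRefl_self (i : ι) (m : ℤ) (x : N) :
    P.root' i (affRefl P i m x) = 2 * m - P.root' i x := by
  rw [root'_affRefl, P.pairing_same]; ring

theorem affRefl_eq_self {i : ι} {m : ℤ} {x : N} (h : P.root' i x = m) : affRefl P i m x = x := by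
  rw [affRefl_apply, h, sub_self, zero_smul, sub_zero]

/-! ### Affine automorphisms of the Coxeter complex -/

/-- `w` is an affine bijection with linear part `A`, and it permutes the walls: `σ` and `k` describe
the pullback of roots. -/
structure IsAffineAut (P : RootPairing ι ℝ M N) (w : Equiv.Perm N) (A : N ≃ₗ[ℝ] N)
    (σ : Equiv.Perm ι) (k : ι → ℤ) : Prop where
  map_eq : ∀ x, w x = A x + w 0
  root_eq : ∀ i x, P.root' i (w x) = P.root' (σ i) x + k i
  coroot_eq : ∀ i, A (P.coroot (σ i)) = P.coroot i

/-- `w` is an affine automorphism of the Coxeter complex. -/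
def IsAut (P : RootPairing ι ℝ M N) (w : Equiv.Perm N) : Prop :=
  ∃ A σ k, IsAffineAut P w A σ k

theorem IsAffineAut.one : IsAffineAut P 1 (LinearEquiv.refl ℝ N) 1 0 :=
  ⟨by simp, by simp, by simp⟩

theorem IsAffineAut.mul {w w' : Equiv.Perm N} {A A' : N ≃ₗ[ℝ] N} {σ σ' : Equiv.Perm ι}
    {k k' : ι → ℤ} (h : IsAffineAut P w A σ k) (h' : IsAffineAut P w' A' σ' k') :
    IsAffineAut P (w * w') (A'.trans A) (σ' * σ) (fun i => k i + k' (σ i)) where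
  map_eq x := by
    simp only [Equiv.Perm.mul_apply, LinearEquiv.trans_apply]
    rw [h.map_eq (w' x), h'.map_eq x, h.map_eq (w' 0), map_add, add_assoc]
  root_eq i x := by
    simp only [Equiv.Perm.mul_apply]
    rw [h.root_eq, h'.root_eq]; push_cast; ring
  coroot_eq i := by
    simp only [Equiv.Perm.mul_apply, LinearEquiv.trans_apply]
    rw [h'.coroot_eq, h.coroot_eq]

theorem IsAffineAut.inv {w : Equiv.Perm N} {A : N ≃ₗ[ℝ] N} {σ : Equiv.Perm ι}
    {k : ι → ℤ} (h : IsAffineAut P w A σ k) :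
    IsAffineAut P w⁻¹ A.symm σ⁻¹ (fun i => -k (σ⁻¹ i)) where
  map_eq x := by
    have key : ∀ y, w⁻¹ y = A.symm (y - w 0) := fun y => by
      have := h.map_eq (w⁻¹ y)
      rw [show w (w⁻¹ y) = y from w.apply_symm_apply y] at this
      rw [LinearEquiv.eq_symm_apply, eq_sub_iff_add_eq, ← this]
    rw [key, key 0, map_sub, map_sub, LinearEquiv.map_zero]; abel
  root_eq i x := by
    have := h.root_eq (σ⁻¹ i) (w⁻¹ x)
    rw [show w (w⁻¹ x) = x from w.apply_symm_apply x,
      show σ (σ⁻¹ i) = i from σ.apply_symm_apply i] at this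
    rw [this]; push_cast; ring
  coroot_eq i := by
    have := h.coroot_eq (σ⁻¹ i)
    rw [show σ (σ⁻¹ i) = i from σ.apply_symm_apply i] at this
    rw [← this, LinearEquiv.symm_apply_apply]

theorem IsAffineAut.affRefl [P.IsCrystallographic] (i : ι) (m : ℤ) :
    IsAffineAut P (affRefl P i m) (P.coreflection i) (P.reflectionPerm i)
      (fun j => m * P.pairingIn ℤ j i) where
  map_eq x := by
    simp only [affRefl_apply, P.coreflection_apply, map_zero]
    module
  root_eq j x := by
    rw [root'_affRefl, root'_reflectionPerm]
    push_cast
    rw [show ((P.pairingIn ℤ j i : ℤ) : ℝ) = P.pairing j i from P.algebraMap_pairingIn ℤ j i]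
    ring
  coroot_eq j := by
    rw [← P.coroot_reflectionPerm, P.reflectionPerm_self]

theorem IsAffineAut.addRight (v : N) (k : ι → ℤ) (hk : ∀ i, P.root' i v = k i) :
    IsAffineAut P (Equiv.addRight v) (LinearEquiv.refl ℝ N) 1 k :=
  ⟨by simp, by simp [hk], by simp⟩

theorem IsAut.one : IsAut P 1 := ⟨_, _, _, IsAffineAut.one⟩

theorem IsAut.mul {w w' : Equiv.Perm N} (h : IsAut P w) (h' : IsAut P w') : IsAut P (w * w') := by
  obtain ⟨_, _, _, h⟩ := h
  obtain ⟨_, _, _, h'⟩ := h'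
  exact ⟨_, _, _, h.mul h'⟩

theorem IsAut.inv {w : Equiv.Perm N} (h : IsAut P w) : IsAut P w⁻¹ := by
  obtain ⟨_, _, _, h⟩ := h
  exact ⟨_, _, _, h.inv⟩

theorem IsAut.affRefl [P.IsCrystallographic] (i : ι) (m : ℤ) : IsAut P (affRefl P i m) :=
  ⟨_, _, _, IsAffineAut.affRefl i m⟩

theorem IsAut.of_mem_affineWeylGroup [P.IsCrystallographic] {w : Equiv.Perm N}
    (hw : w ∈ affineWeylGroup P) : IsAut P w := by
  induction hw using Subgroup.closure_induction with
  | mem x hx => obtain ⟨q, rfl⟩ := hx; exact IsAut.affRefl _ _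
  | one => exact IsAut.one
  | mul x y _ _ hx hy => exact hx.mul hy
  | inv x _ hx => exact hx.inv

theorem affRefl_mem (i : ι) (m : ℤ) : affRefl P i m ∈ affineWeylGroup P :=
  Subgroup.subset_closure ⟨(i, m), rfl⟩

/-! ### Action of affine automorphisms on faces, levels and dimensions. -/

section image

variable {w : Equiv.Perm N} {A : N ≃ₗ[ℝ] N} {σ : Equiv.Perm ι} {k : ι → ℤ}

theorem IsAffineAut.mem_faceOf_iff (h : IsAffineAut P w A σ k) {x y : N} :
    w y ∈ faceOf P (w x) ↔ y ∈ faceOf P x := by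
  simp only [LSGallery.mem_faceOf_iff, h.root_eq, lev_add_int]
  constructor
  · intro H i m
    have := H (σ.symm i) (m + k (σ.symm i))
    rw [Equiv.apply_symm_apply] at this
    omega
  · intro H i m
    have := H (σ i) (m - k i)
    omega

theorem IsAffineAut.image_faceOf (h : IsAffineAut P w A σ k) (x : N) :
    w '' faceOf P x = faceOf P (w x) := by
  ext y
  rw [Equiv.image_eq_preimage_symm, Set.mem_preimage, ← h.mem_faceOf_iff, Equiv.apply_symm_apply]

theorem IsAut.image_faceOf (h : IsAut P w) (x : N) : w '' faceOf P x = faceOf P (w x) := by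
  obtain ⟨_, _, _, h⟩ := h
  exact h.image_faceOf x

theorem IsAut.isFace_image (h : IsAut P w) {F : Set N} (hF : IsFace P F) :
    IsFace P (w '' F) := by
  obtain ⟨x, rfl⟩ := hF
  exact ⟨w x, h.image_faceOf x⟩

theorem IsAffineAut.faceLevel_image (h : IsAffineAut P w A σ k) {F : Set N} (hF : IsFace P F)
    (i : ι) : faceLevel P (w '' F) i = faceLevel P F (σ i) + 2 * k i := by
  obtain ⟨x, rfl⟩ := hF
  rw [h.image_faceOf, faceLevel_faceOf, faceLevel_faceOf, h.root_eq, lev_add_int]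

theorem IsAut.faceDim_image (h : IsAut P w) (F : Set N) : faceDim (w '' F) = faceDim F := by
  obtain ⟨A, σ, k, h⟩ := h
  have : vectorSpan ℝ (w '' F) = (vectorSpan ℝ F).map (A : N →ₗ[ℝ] N) := by
    have hw : (w : N → N) = (A.toLinearMap.toAffineMap + AffineMap.const ℝ N (w 0) : N →ᵃ[ℝ] N) := by
      ext x; simpa using h.map_eq x
    rw [hw, ← AffineMap.map_vectorSpan]
    simp
  rw [faceDim, this, faceDim]
  exact LinearEquiv.finrank_map_eq A _

end image

theorem faceLevel_affRefl_image [P.IsCrystallographic] {F : Set N} (hF : IsFace P F) (i j : ι)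
    (m : ℤ) : faceLevel P (affRefl P i m '' F) j =
      faceLevel P F (P.reflectionPerm i j) + 2 * (m * P.pairingIn ℤ j i) :=
  (IsAffineAut.affRefl i m).faceLevel_image hF j

theorem faceLevel_affRefl_image_self [P.IsCrystallographic] {F : Set N} (hF : IsFace P F) (i : ι)
    (m : ℤ) : faceLevel P (affRefl P i m '' F) i = 4 * m - faceLevel P F i := by
  rw [faceLevel_affRefl_image hF, ← opp, faceLevel_opp, P.pairingIn_same]
  ring

theorem affRefl_image_eq_self {F : Set N} {i : ι} {m : ℤ} (h : F ⊆ wall P i m) :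
    affRefl P i m '' F = F := by
  conv_rhs => rw [← Set.image_id F]
  exact Set.image_congr fun x hx => affRefl_eq_self (h hx)

theorem affRefl_image_image (F : Set N) (i : ι) (m : ℤ) :
    affRefl P i m '' (affRefl P i m '' F) = F := by
  rw [Set.image_image]
  simp only [affRefl_affRefl, Set.image_id']

end

noncomputable section

variable {ι M N : Type*} [AddCommGroup M] [Module ℝ M] [AddCommGroup N] [Module ℝ N]
variable {P : RootPairing ι ℝ M N}

/-! ### The closed alcoves are fundamental domains -/

theorem pairingIn_cast [P.IsCrystallographic] (i j : ι) :
    ((P.pairingIn ℤ i j : ℤ) : ℝ) = P.pairing i j := P.algebraMap_pairingIn ℤ i j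

/-- There is a vector on which every root takes its height as value. -/
theorem exists_root'_eq_height [P.IsRootSystem] (b : P.Base) :
    ∃ d : N, ∀ i, P.root' i d = b.height i := by
  let φ : Module.Dual ℝ M := b.toWeightBasis.constr ℝ fun _ => (1 : ℝ)
  refine ⟨P.toLinearMap.flip.toPerfPair.symm φ, fun i => ?_⟩
  have h1 : ∀ m : M, P.toLinearMap m (P.toLinearMap.flip.toPerfPair.symm φ) = φ m := fun m => by
    have : P.toLinearMap.flip.toPerfPair (P.toLinearMap.flip.toPerfPair.symm φ) m = φ m := by
      rw [LinearEquiv.apply_symm_apply]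
    exact this
  have h2 : ∀ j ∈ b.support, φ (P.root j) = 1 := fun j hj => by
    have := b.toWeightBasis.constr_basis ℝ (fun _ => (1 : ℝ)) ⟨j, hj⟩
    rwa [b.toWeightBasis_apply] at this
  obtain ⟨f, -, -, hf⟩ := b.exists_root_eq_sum_int i
  rw [h1, b.height_eq_sum hf, hf, map_sum]
  push_cast
  refine Finset.sum_congr rfl fun j hj => ?_
  rw [map_zsmul, h2 j hj, zsmul_one]

theorem finite_setOf_lt_lt [Finite ι] (f g : ι → ℝ) :
    {q : ι × ℤ | f q.1 < q.2 ∧ q.2 < g q.1}.Finite := by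
  refine (Set.finite_iUnion fun i : ι =>
    (Set.finite_singleton i).prod (Set.finite_Icc ⌊f i⌋ ⌈g i⌉)).subset ?_
  rintro ⟨i, m⟩ ⟨h1, h2⟩
  refine Set.mem_iUnion.2 ⟨i, rfl, ?_, ?_⟩
  · exact Int.cast_le.1 ((Int.floor_le _).trans h1.le)
  · exact Int.cast_le.1 (h2.le.trans (Int.le_ceil _))

/-- A point on no wall. -/
def IsGeneric (P : RootPairing ι ℝ M N) (c : N) : Prop := ∀ (i : ι) (m : ℤ), P.root' i c ≠ m

/-- `H_{β,m}` is a wall of the alcove of `c`, with the roots oriented such that `⟨c, β⟩ < m`: no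
other wall separates `c` from its mirror image. -/
def IsAdjacentWall (P : RootPairing ι ℝ M N) (c : N) (i : ι) (m : ℤ) : Prop :=
  P.root' i c < m ∧ ∀ j (n : ℤ), P.root' j c < n → n < P.root' j (affRefl P i m c) → j = i ∧ n = m

/-- Walk from `c` towards `z` up to the first point `y` on a wall that has `c` below it. Among the
roots of such walls through `y`, take one whose wall is nearest to `c`, measured by the value of the
root: it behaves like a simple root of the local system at `y`, so nothing else separates `c` from
its mirror image. -/
theorem exists_isAdjacentWall [Finite ι] [P.IsCrystallographic] [P.IsReduced] {c z : N}
    (hc : IsGeneric P c) {i₀ : ι} {m₀ : ℤ} (h₁ : P.root' i₀ c < m₀) (h₂ : m₀ < P.root' i₀ z) :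
    ∃ i m, IsAdjacentWall P c i m ∧ m < P.root' i z := by
  -- The walls crossed by the segment from `c` to `z`, compared by the parameter at which they are
  -- crossed; `t` is the smallest one.
  set S : Set (ι × ℤ) := {q | P.root' q.1 c < q.2 ∧ q.2 < P.root' q.1 z} with hS
  have hSfin : S.Finite := finite_setOf_lt_lt (fun i => P.root' i c) (fun i => P.root' i z)
  obtain ⟨q₀, hq₀S, hq₀⟩ := S.exists_min_image
    (fun q => ((q.2 : ℝ) - P.root' q.1 c) / (P.root' q.1 z - P.root' q.1 c)) hSfin ⟨(i₀, m₀), h₁, h₂⟩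
  set t : ℝ := ((q₀.2 : ℝ) - P.root' q₀.1 c) / (P.root' q₀.1 z - P.root' q₀.1 c) with ht
  have hq₀1 : P.root' q₀.1 c < q₀.2 := hq₀S.1
  have hq₀2 : (q₀.2 : ℝ) < P.root' q₀.1 z := hq₀S.2
  have ht0 : 0 < t := div_pos (by linarith) (by linarith)
  have ht1 : t < 1 := by rw [ht, div_lt_one (by linarith)]; linarith
  set y : N := c + t • (z - c) with hy
  have hyv : ∀ j, P.root' j y = P.root' j c + t * (P.root' j z - P.root' j c) := fun j => by
    rw [hy, map_add, map_smul, map_sub, smul_eq_mul]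
  have first : ∀ j (n : ℤ), P.root' j c < n → P.root' j y ≤ n := by
    intro j n hn
    by_contra! h
    have hy' := hyv j
    have hpos : 0 < P.root' j z - P.root' j c := by
      by_contra! hle
      nlinarith
    have hz : (n : ℝ) < P.root' j z := by nlinarith
    have := hq₀ (j, n) ⟨hn, hz⟩
    dsimp only at this
    rw [le_div_iff₀ hpos] at this
    linarith
  set R : Set ι := {i | ∃ m : ℤ, P.root' i y = m ∧ P.root' i c < m} with hR
  have hq₀R : q₀.1 ∈ R := by
    refine ⟨q₀.2, ?_, hq₀1⟩
    rw [hyv, ht, div_mul_cancel₀ _ (by linarith)]; ring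
  obtain ⟨i, ⟨m, him, hicm⟩, hmin⟩ := R.exists_min_image (fun i => P.root' i y - P.root' i c)
    R.toFinite ⟨_, hq₀R⟩
  have hmin' : ∀ l (n : ℤ), P.root' l y = n → P.root' l c < n →
      m - P.root' i c ≤ n - P.root' l c := fun l n h1 h2 => by
    have := hmin l ⟨n, h1, h2⟩
    rwa [him, h1] at this
  refine ⟨i, m, ⟨hicm, fun j n hjn hnj => ?_⟩, ?_⟩
  swap
  · have := hyv i
    nlinarith
  -- a second root vanishing at `y` has at least twice the distance to `c`
  have double : ∀ l (n : ℤ), l ≠ i → P.root' l y = n → P.root' l c < n → 0 < P.pairingIn ℤ l i →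
      2 * (m - P.root' i c) ≤ n - P.root' l c := by
    intro l n hli hly hlc hp
    obtain ⟨r, hr⟩ := P.root_sub_root_mem_of_pairingIn_pos hp hli
    have hrv : ∀ x, P.root' r x = P.root' l x - P.root' i x := fun x => by
      rw [RootPairing.root', hr, map_sub, LinearMap.sub_apply]
    rcases lt_or_gt_of_ne (hc r (n - m)) with h | h
    · have h' := hmin' r (n - m) (by rw [hrv, hly, him]; push_cast; ring) h
      rw [hrv] at h'
      push_cast at h'
      linarith
    · have h' := hmin' (opp P r) (m - n) (by rw [root'_opp, hrv, hly, him]; push_cast; ring)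
        (by rw [root'_opp]; push_cast at h ⊢; linarith)
      rw [root'_opp, hrv] at h'
      push_cast at h'
      linarith
  have hs := root'_affRefl (P := P) i j m c
  have hk : (0 : ℝ) < P.pairing j i := by
    by_contra! hle
    nlinarith
  -- The root `j'` is the negative of the mirror image of `j`, and it has a wall above `c` as well.
  -- At the fixed point `y` the values of `j` and `j'` add up to `m * P.pairing j i`, so the two
  -- upper bounds given by `first` must be equalities.
  set j' := opp P (P.reflectionPerm i j) with hj'
  have hj'v : ∀ x, P.root' j' x = m * P.pairing j i - P.root' j (affRefl P i m x) := fun x => by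
    rw [hj', root'_opp, root'_reflectionPerm, root'_affRefl]; ring
  have hj'c : P.root' j' c < ((m * P.pairingIn ℤ j i - n : ℤ) : ℝ) := by
    rw [hj'v]; push_cast; rw [pairingIn_cast]; linarith
  have hyn : P.root' j y = n := by
    refine le_antisymm (first j n hjn) ?_
    have := first j' _ hj'c
    rw [hj'v, affRefl_eq_self him] at this
    push_cast at this
    rw [pairingIn_cast] at this
    linarith
  by_cases hji : j = i
  · subst hji
    exact ⟨rfl, by exact_mod_cast hyn.symm.trans him⟩
  exfalso
  have hkZ : 0 < P.pairingIn ℤ j i := by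
    rw [← pairingIn_cast] at hk; exact_mod_cast hk
  have d1 := double j n hji hyn hjn hkZ
  have d2 := double j' _ (fun h => hji (by
      have h2 : P.reflectionPerm i j = opp P i := by
        have := congrArg (opp P) (hj'.symm.trans h)
        rwa [opp_opp] at this
      have h3 := congrArg (P.reflectionPerm i) h2
      rwa [P.reflectionPerm_self, opp, P.reflectionPerm_self] at h3))
    (by rw [hj'v, affRefl_eq_self him, hyn]; push_cast; rw [pairingIn_cast]) hj'c (by
      have : (P.pairingIn ℤ j' i : ℝ) = P.pairingIn ℤ j i := by
        rw [pairingIn_cast, pairingIn_cast, hj', ← P.root'_coroot_eq_pairing, root'_opp,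
          root'_reflectionPerm, P.root'_coroot_eq_pairing, P.root'_coroot_eq_pairing, P.pairing_same]
        ring
      have : P.pairingIn ℤ j' i = P.pairingIn ℤ j i := by exact_mod_cast this
      omega)
  rw [hj'v] at d2
  push_cast at d2
  rw [pairingIn_cast, hs] at d2
  -- Put `D = m - P.root' i c` and `k = P.pairing j i`. The distances of `j` and `j'` add up to `k
  -- D`, while `d1` and `d2` bound each below by `2 D`. So `k ≥ 4`, which is impossible in a reduced
  -- crystallographic system.
  have hk3 : P.pairingIn ℤ j i ≤ 3 := by
    have := P.pairingIn_pairingIn_mem_set_of_isCrystal_of_isRed j i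
    simp only [Set.mem_insert_iff, Set.mem_singleton_iff, Prod.mk.injEq] at this
    omega
  have hk3' : P.pairing j i ≤ 3 := by
    rw [← pairingIn_cast]; exact_mod_cast hk3
  nlinarith

theorem IsAffineAut.isGeneric {w : Equiv.Perm N} {A : N ≃ₗ[ℝ] N} {σ : Equiv.Perm ι} {k : ι → ℤ}
    (h : IsAffineAut P w A σ k) {c : N} (hc : IsGeneric P c) : IsGeneric P (w c) := fun i m hm => by
  rw [h.root_eq] at hm
  exact hc (σ i) (m - k i) (by push_cast; linarith)

theorem IsAut.isGeneric {w : Equiv.Perm N} (h : IsAut P w) {c : N} (hc : IsGeneric P c) :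
    IsGeneric P (w c) := by
  obtain ⟨_, _, _, h⟩ := h
  exact h.isGeneric hc

/-- Conjugation of affine reflections; this is what the field `coroot_eq` is for. -/
theorem IsAffineAut.affRefl_mul {w : Equiv.Perm N} {A : N ≃ₗ[ℝ] N} {σ : Equiv.Perm ι} {k : ι → ℤ}
    (h : IsAffineAut P w A σ k) (i : ι) (m : ℤ) :
    LSGallery.affRefl P i m * w = w * LSGallery.affRefl P (σ i) (m - k i) := by
  ext x
  simp only [Equiv.Perm.mul_apply, affRefl_apply]
  rw [h.map_eq (_ - _), map_sub, map_smul, h.coroot_eq, h.root_eq, h.map_eq x]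
  push_cast
  module

/-- The product of the reflections at a list of walls. -/
def wordProd (P : RootPairing ι ℝ M N) (l : List (ι × ℤ)) : Equiv.Perm N :=
  (l.map fun q => affRefl P q.1 q.2).prod

@[simp] theorem wordProd_nil : wordProd P [] = 1 := rfl

@[simp] theorem wordProd_cons (q : ι × ℤ) (l : List (ι × ℤ)) :
    wordProd P (q :: l) = affRefl P q.1 q.2 * wordProd P l := by
  simp [wordProd]

@[simp] theorem wordProd_append (l l' : List (ι × ℤ)) :
    wordProd P (l ++ l') = wordProd P l * wordProd P l' := by
  simp [wordProd]

theorem affRefl_mul_self (i : ι) (m : ℤ) : affRefl P i m * affRefl P i m = 1 := by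
  ext x; exact affRefl_affRefl i m x

theorem affRefl_inv (i : ι) (m : ℤ) : (affRefl P i m)⁻¹ = affRefl P i m :=
  inv_eq_of_mul_eq_one_left (affRefl_mul_self i m)

theorem wordProd_reverse (l : List (ι × ℤ)) : wordProd P l.reverse = (wordProd P l)⁻¹ := by
  induction l with
  | nil => simp
  | cons q l ih => simp [ih, affRefl_inv]

theorem wordProd_mem (l : List (ι × ℤ)) : wordProd P l ∈ affineWeylGroup P := by
  induction l with
  | nil => exact one_mem _
  | cons q l ih => rw [wordProd_cons]; exact mul_mem (affRefl_mem _ _) ih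

/-! ### Generation by the walls of one alcove, and freeness of the action on alcoves. -/

section transitive

variable [P.IsCrystallographic] {c : N}

/-- Exchange condition. The prefixes of the word give a gallery of adjacent alcoves starting at `u
c`. It begins above `H_{i,m}` and ends below, so some step crosses this wall, and the letter of that
step can be traded for a reflection on the left. -/
theorem exists_shorter_word (hc : IsGeneric P c) (l : List (ι × ℤ))
    (hl : ∀ q ∈ l, IsAdjacentWall P c q.1 q.2) {u : Equiv.Perm N} (hu : IsAut P u) {i : ι} {m : ℤ}
    (h₁ : m < P.root' i (u c)) (h₂ : P.root' i (u (wordProd P l c)) < m) :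
    ∃ l' : List (ι × ℤ), (∀ q ∈ l', IsAdjacentWall P c q.1 q.2) ∧ l'.length < l.length ∧
      u * wordProd P l = affRefl P i m * (u * wordProd P l') := by
  induction l generalizing u with
  | nil => exact absurd h₁ (not_lt.2 h₂.le)
  | cons s t ih =>
    have hs := hl s (by simp)
    have ht : ∀ q ∈ t, IsAdjacentWall P c q.1 q.2 := fun q hq => hl q (by simp [hq])
    have hus : IsAut P (u * affRefl P s.1 s.2) := hu.mul (IsAut.affRefl _ _)
    rcases lt_or_gt_of_ne (hus.isGeneric hc i m) with h | h
    · refine ⟨t, ht, by simp, ?_⟩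
      obtain ⟨A, σ, k, hu⟩ := hu
      rw [hu.root_eq] at h₁
      rw [Equiv.Perm.mul_apply, hu.root_eq] at h
      have := hs.2 (opp P (σ i)) (-(m - k i)) (by rw [root'_opp]; push_cast; linarith)
        (by rw [root'_opp]; push_cast; linarith)
      rw [wordProd_cons, ← this.1, ← this.2, affRefl_opp, ← mul_assoc, ← hu.affRefl_mul, mul_assoc]
    · obtain ⟨l', hl', hlen, heq⟩ := ih ht hus h (by simpa using h₂)
      refine ⟨s :: l', ?_, by simpa using hlen, ?_⟩
      · rintro q (_ | ⟨_, hq⟩)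
        exacts [hs, hl' q hq]
      · rw [wordProd_cons, wordProd_cons, ← mul_assoc u, ← mul_assoc u, heq]

/-- After its first letter the gallery of the word is beyond the first wall, and it must come back.
The exchange condition then cancels the first letter against a later one, and the word gets shorter.
-/
theorem wordProd_eq_one (hc : IsGeneric P c) (n : ℕ) (l : List (ι × ℤ)) (hn : l.length = n)
    (hl : ∀ q ∈ l, IsAdjacentWall P c q.1 q.2)
    (h : ∀ i (m : ℤ), P.root' i c < m → ¬ m < P.root' i (wordProd P l c)) : wordProd P l = 1 := by
  induction n using Nat.strong_induction_on generalizing l with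
  | _ n ih =>
    match l with
    | [] => rfl
    | s :: t =>
      have hs := hl s (by simp)
      have ht : ∀ q ∈ t, IsAdjacentWall P c q.1 q.2 := fun q hq => hl q (by simp [hq])
      have h2 : P.root' s.1 (wordProd P (s :: t) c) < s.2 :=
        lt_of_le_of_ne (not_lt.1 (h s.1 s.2 hs.1))
          ((IsAut.of_mem_affineWeylGroup (wordProd_mem _)).isGeneric hc _ _)
      obtain ⟨l', hl', hlen, heq⟩ := exists_shorter_word hc t ht (u := affRefl P s.1 s.2)
        (IsAut.affRefl _ _) (i := s.1) (m := s.2)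
        (by rw [root'_affRefl_self]; linarith [hs.1]) (by simpa using h2)
      rw [← wordProd_cons, ← mul_assoc, affRefl_mul_self, one_mul] at heq
      rw [heq] at h ⊢
      exact ih l'.length (by rw [← hn]; simpa using hlen.trans (Nat.lt_succ_self _)) l' rfl hl' h

variable [Finite ι] [P.IsReduced]

/-- Take a counterexample with wall nearest to `c`. Some adjacent wall `H_{j,n}` separates `c` from
its mirror image, and conjugation by `s_{j,n}` gives a reflection at a strictly nearer wall, which
is then a word. -/
theorem exists_wordProd_eq_affRefl (hc : IsGeneric P c) (i : ι) (m : ℤ) :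
    ∃ l : List (ι × ℤ), (∀ q ∈ l, IsAdjacentWall P c q.1 q.2) ∧ affRefl P i m = wordProd P l := by
  suffices H : ∀ i (m : ℤ), P.root' i c < m → ∃ l : List (ι × ℤ),
      (∀ q ∈ l, IsAdjacentWall P c q.1 q.2) ∧ affRefl P i m = wordProd P l by
    rcases lt_or_gt_of_ne (hc i m) with h | h
    · exact H i m h
    · rw [← affRefl_opp]
      exact H _ _ (by rw [root'_opp]; push_cast; linarith)
  by_contra! H
  obtain ⟨i₁, m₁, h₁, hbad₁⟩ := H
  -- The bound on the distance makes the set finite; the extra `1` keeps the given counterexample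
  -- inside.
  set B : Set (ι × ℤ) := {q | (P.root' q.1 c < q.2 ∧ q.2 < P.root' q.1 c + (m₁ - P.root' i₁ c + 1)) ∧
    ∀ l : List (ι × ℤ), (∀ q ∈ l, IsAdjacentWall P c q.1 q.2) → affRefl P q.1 q.2 ≠ wordProd P l}
  have hB : B.Finite := (finite_setOf_lt_lt (fun i => P.root' i c)
    (fun i => P.root' i c + (m₁ - P.root' i₁ c + 1))).subset fun q hq => hq.1
  obtain ⟨⟨i, m⟩, ⟨⟨him, him'⟩, hbad⟩, hmin⟩ := B.exists_min_image (fun q => q.2 - P.root' q.1 c) hB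
    ⟨(i₁, m₁), ⟨h₁, by dsimp only; linarith⟩, hbad₁⟩
  dsimp only at him him' hbad hmin
  obtain ⟨j, n, hadj, hn⟩ := exists_isAdjacentWall (z := affRefl P i m c) hc him
    (by rw [root'_affRefl_self]; linarith)
  have hne : ¬ (i = j ∧ m = n) := by
    rintro ⟨rfl, rfl⟩
    refine hbad [(i, m)] ?_ (by simp)
    simpa using hadj
  have hji : (0 : ℝ) < P.pairing j i := by
    rw [root'_affRefl] at hn
    by_contra! hle
    have := hadj.1
    nlinarith
  have hij : (0 : ℝ) < P.pairing i j := by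
    rw [← pairingIn_cast] at hji ⊢
    have := (P.zero_lt_pairingIn_iff' (S := ℤ)).1 (by exact_mod_cast hji : 0 < P.pairingIn ℤ j i)
    exact_mod_cast this
  have hv := root'_affRefl (P := P) j i n c
  have hlt : P.root' i (affRefl P j n c) < m := by
    refine lt_of_le_of_ne (not_lt.1 fun h => hne (hadj.2 i m him h))
      ((IsAut.affRefl j n).isGeneric hc i m)
  have hgt : P.root' i c < P.root' i (affRefl P j n c) := by
    have := hadj.1
    nlinarith
  obtain ⟨A, σ, k, haut⟩ := IsAut.affRefl (P := P) j n
  have hconj := haut.affRefl_mul i m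
  have hval := haut.root_eq i c
  by_cases hw : ∃ l : List (ι × ℤ), (∀ q ∈ l, IsAdjacentWall P c q.1 q.2) ∧
      affRefl P (σ i) (m - k i) = wordProd P l
  · obtain ⟨l, hl, hl'⟩ := hw
    refine hbad ((j, n) :: (l ++ [(j, n)])) ?_ ?_
    · intro q hq
      simp only [List.mem_cons, List.mem_append, List.not_mem_nil, or_false] at hq
      rcases hq with rfl | hq | rfl
      exacts [hadj, hl q hq, hadj]
    · rw [wordProd_cons, wordProd_append, ← hl', ← mul_assoc, ← hconj]
      simp [mul_assoc, affRefl_mul_self]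
  · push Not at hw
    have := hmin (σ i, m - k i) ⟨⟨by dsimp only; push_cast; linarith,
      by dsimp only; push_cast; linarith⟩, hw⟩
    dsimp only at this
    push_cast at this
    linarith

theorem exists_wordProd_eq (hc : IsGeneric P c) {w : Equiv.Perm N} (hw : w ∈ affineWeylGroup P) :
    ∃ l : List (ι × ℤ), (∀ q ∈ l, IsAdjacentWall P c q.1 q.2) ∧ w = wordProd P l := by
  induction hw using Subgroup.closure_induction with
  | mem x hx => obtain ⟨q, rfl⟩ := hx; exact exists_wordProd_eq_affRefl hc _ _
  | one => exact ⟨[], by simp, rfl⟩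
  | mul x y _ _ hx hy =>
    obtain ⟨l, hl, rfl⟩ := hx
    obtain ⟨l', hl', rfl⟩ := hy
    exact ⟨l ++ l', fun q hq => (List.mem_append.1 hq).elim (hl q) (hl' q), by simp⟩
  | inv x _ hx =>
    obtain ⟨l, hl, rfl⟩ := hx
    exact ⟨l.reverse, fun q hq => hl q (by simpa using hq), (wordProd_reverse l).symm⟩

theorem eq_one_of_forall_not_separated (hc : IsGeneric P c) {w : Equiv.Perm N}
    (hw : w ∈ affineWeylGroup P)
    (h : ∀ i (m : ℤ), P.root' i c < m → ¬ m < P.root' i (w c)) : w = 1 := by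
  obtain ⟨l, hl, rfl⟩ := exists_wordProd_eq hc hw
  exact wordProd_eq_one hc _ l rfl hl h

end transitive

/-- A small nonzero displacement leaves the integers without jumping over one. -/
theorem eventually_near (v d : ℝ) (hd : d ≠ 0) : ∀ᶠ ε : ℝ in nhdsWithin 0 (Set.Ioi 0),
    ∀ m : ℤ, v + ε * d ≠ m ∧ (v < m → v + ε * d < m) ∧ (m < v → m < v + ε * d) := by
  have hlim : Filter.Tendsto (fun ε : ℝ => v + ε * d) (nhdsWithin 0 (Set.Ioi 0)) (nhds v) := by
    have : Continuous fun ε : ℝ => v + ε * d := by fun_prop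
    simpa using (this.tendsto 0).mono_left nhdsWithin_le_nhds
  have h1 : ((⌈v⌉ : ℤ) : ℝ) - 1 < v := by linarith [Int.ceil_lt_add_one v]
  have h2 : v < (⌊v⌋ : ℤ) + 1 := Int.lt_floor_add_one v
  filter_upwards [hlim.eventually (lt_mem_nhds h1), hlim.eventually (gt_mem_nhds h2),
    self_mem_nhdsWithin] with ε ha hb hε m
  have hne : v + ε * d ≠ v := by
    have : ε * d ≠ 0 := mul_ne_zero (ne_of_gt hε) hd
    simpa using this
  have up : v < m → v + ε * d < m := fun h => by
    have : ⌊v⌋ + 1 ≤ m := Int.add_one_le_iff.2 (Int.floor_lt.2 h)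
    have : ((⌊v⌋ : ℤ) : ℝ) + 1 ≤ m := by exact_mod_cast this
    linarith
  have dn : m < v → m < v + ε * d := fun h => by
    have : m + 1 ≤ ⌈v⌉ := Int.add_one_le_iff.2 (Int.lt_ceil.2 h)
    have : (m : ℝ) + 1 ≤ (⌈v⌉ : ℤ) := by exact_mod_cast this
    linarith
  refine ⟨fun h => ?_, up, dn⟩
  rcases lt_trichotomy v m with h' | h' | h'
  · exact (up h').ne h
  · exact hne (h.trans h'.symm)
  · exact (dn h').ne' h

/-- Finds an alcove whose closure contains both points: start from the midpoint and move slightly in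
the direction on which the roots take their nonzero heights. -/
theorem exists_isGeneric_near [Finite ι] [P.IsRootSystem] (b : P.Base) {x y : N}
    (h : ∀ i (m : ℤ), P.root' i x < m → ¬ m < P.root' i y) :
    ∃ c, IsGeneric P c ∧ (∀ i (m : ℤ), P.root' i c < m → ¬ m < P.root' i x) ∧
      ∀ i (m : ℤ), P.root' i c < m → ¬ m < P.root' i y := by
  obtain ⟨d, hd⟩ := exists_root'_eq_height b
  have hd' : ∀ i, P.root' i d ≠ 0 := fun i => by
    rw [hd]; exact_mod_cast b.height_ne_zero i
  have hev : ∀ᶠ ε : ℝ in nhdsWithin 0 (Set.Ioi 0), ∀ i, ∀ m : ℤ,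
      P.root' i ((1 / 2 : ℝ) • (x + y)) + ε * P.root' i d ≠ m ∧
      (P.root' i ((1 / 2 : ℝ) • (x + y)) < m →
        P.root' i ((1 / 2 : ℝ) • (x + y)) + ε * P.root' i d < m) ∧
      (m < P.root' i ((1 / 2 : ℝ) • (x + y)) →
        m < P.root' i ((1 / 2 : ℝ) • (x + y)) + ε * P.root' i d) :=
    Filter.eventually_all.2 fun i => eventually_near _ _ (hd' i)
  obtain ⟨ε, hε⟩ := hev.exists
  have hval : ∀ i, P.root' i ((1 / 2 : ℝ) • (x + y) + ε • d) =
      P.root' i ((1 / 2 : ℝ) • (x + y)) + ε * P.root' i d := fun i => by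
    rw [map_add, map_smul _ ε, smul_eq_mul]
  have hmid : ∀ i, P.root' i ((1 / 2 : ℝ) • (x + y)) = (P.root' i x + P.root' i y) / 2 := fun i => by
    rw [map_smul, map_add, smul_eq_mul]; ring
  have h' : ∀ i (m : ℤ), P.root' i y < m → ¬ m < P.root' i x := fun i m h1 h2 =>
    h (opp P i) (-m) (by rw [root'_opp]; push_cast; linarith) (by rw [root'_opp]; push_cast; linarith)
  refine ⟨(1 / 2 : ℝ) • (x + y) + ε • d, fun i m => ?_, fun i m h1 h2 => ?_, fun i m h1 h2 => ?_⟩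
  · rw [hval]; exact (hε i m).1
  · rw [hval] at h1
    refine absurd ((hε i m).2.2 ?_) (not_lt.2 h1.le)
    have := not_lt.1 (fun h3 => h' i m h3 h2)
    rw [hmid]; linarith
  · rw [hval] at h1
    refine absurd ((hε i m).2.2 ?_) (not_lt.2 h1.le)
    have := not_lt.1 (fun h3 => h i m h3 h2)
    rw [hmid]; linarith

/-- The number of walls (counted with both orientations) between two generic points. -/
def alcoveDist (P : RootPairing ι ℝ M N) (c z : N) : ℕ :=
  ∑ᶠ i, (⌊P.root' i z⌋ - ⌊P.root' i c⌋).natAbs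

theorem IsAffineAut.alcoveDist_image [Finite ι] {w : Equiv.Perm N} {A : N ≃ₗ[ℝ] N}
    {σ : Equiv.Perm ι} {k : ι → ℤ} (h : IsAffineAut P w A σ k) (c z : N) :
    alcoveDist P (w c) (w z) = alcoveDist P c z := by
  have := Fintype.ofFinite ι
  rw [alcoveDist, alcoveDist, finsum_eq_sum_of_fintype, finsum_eq_sum_of_fintype,
    ← Equiv.sum_comp σ fun i => (⌊P.root' i z⌋ - ⌊P.root' i c⌋).natAbs]
  refine Finset.sum_congr rfl fun i _ => ?_
  rw [h.root_eq, h.root_eq, Int.floor_add_intCast, Int.floor_add_intCast, add_sub_add_right_eq_sub]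

/-- Since only one wall lies between `c` and its mirror image, no other root can have its floor
raised. -/
theorem IsAdjacentWall.floor_cases [P.IsCrystallographic] {c : N} (hc : IsGeneric P c) {i : ι} {m : ℤ}
    (h : IsAdjacentWall P c i m) (j : ι) :
    ⌊P.root' j (affRefl P i m c)⌋ ≤ ⌊P.root' j c⌋ ∨
      (j = i ∧ ⌊P.root' j (affRefl P i m c)⌋ = m ∧ ⌊P.root' j c⌋ < m) := by
  by_contra! H
  obtain ⟨h1, h2⟩ := H
  have hgen := (IsAut.affRefl i m).isGeneric hc
  have key : ∀ n : ℤ, ⌊P.root' j c⌋ < n → n ≤ ⌊P.root' j (affRefl P i m c)⌋ → j = i ∧ n = m :=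
    fun n hn1 hn2 => h.2 j n (Int.floor_lt.1 hn1) (lt_of_le_of_ne (Int.le_floor.1 hn2) (hgen j n).symm)
  have k1 := key _ h1 le_rfl
  have := h2 k1.1 k1.2
  omega

/-- Only the floors of `i` and of its opposite change, and both move towards those of `z`. -/
theorem IsAdjacentWall.alcoveDist_lt [Finite ι] [P.IsCrystallographic] {c z : N} (hc : IsGeneric P c)
    {i : ι} {m : ℤ} (h : IsAdjacentWall P c i m) (hz : m < P.root' i z) :
    alcoveDist P (affRefl P i m c) z < alcoveDist P c z := by
  have := Fintype.ofFinite ι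
  rw [alcoveDist, alcoveDist, finsum_eq_sum_of_fintype, finsum_eq_sum_of_fintype]
  have hzf : m ≤ ⌊P.root' i z⌋ := Int.le_floor.2 hz.le
  have hgen := (IsAut.affRefl i m).isGeneric hc
  have hup : ⌊P.root' i c⌋ < m := Int.floor_lt.2 h.1
  refine Finset.sum_lt_sum (fun j _ => ?_) ⟨i, Finset.mem_univ _, ?_⟩
  · rcases h.floor_cases hc j with h1 | ⟨rfl, h1, h2⟩
    · rcases h.floor_cases hc (opp P j) with h2 | ⟨h3, h2, h4⟩
      · simp only [root'_opp, Int.floor_neg] at h2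
        have e1 : ∀ y, IsGeneric P y → ⌈P.root' j y⌉ = ⌊P.root' j y⌋ + 1 := fun y hy =>
          le_antisymm (Int.ceil_le_floor_add_one _) (Int.add_one_le_iff.2 (Int.lt_ceil.2
            (lt_of_le_of_ne (Int.floor_le _) (hy j _).symm)))
        rw [e1 _ hc, e1 _ hgen] at h2
        have : ⌊P.root' j (affRefl P i m c)⌋ = ⌊P.root' j c⌋ := by omega
        rw [this]
      · have e1 : ∀ y, IsGeneric P y → ⌈P.root' j y⌉ = ⌊P.root' j y⌋ + 1 := fun y hy =>
          le_antisymm (Int.ceil_le_floor_add_one _) (Int.add_one_le_iff.2 (Int.lt_ceil.2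
            (lt_of_le_of_ne (Int.floor_le _) (hy j _).symm)))
        simp only [root'_opp, Int.floor_neg, e1 _ hc, e1 _ hgen] at h2 h4
        have hz' : ⌊P.root' j z⌋ < -m := by
          rw [← h3, root'_opp] at hz
          refine Int.floor_lt.2 ?_
          push_cast; linarith
        omega
    · omega
  · rcases h.floor_cases hc i with h1 | ⟨-, h1, h2⟩
    · have : m ≤ ⌊P.root' i (affRefl P i m c)⌋ := by
        refine Int.le_floor.2 ?_
        rw [root'_affRefl_self]; linarith [h.1]
      omega
    · omega

/-- Every closed alcove contains at most one point of each orbit of the affine Weyl group: if no wall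
strictly separates `x` from `w x` then `w x = x`. -/
theorem eq_of_forall_not_separated [Finite ι] [P.IsRootSystem] [P.IsCrystallographic] [P.IsReduced]
    (b : P.Base) {w : Equiv.Perm N} (hw : w ∈ affineWeylGroup P) {x : N}
    (h : ∀ i (m : ℤ), P.root' i x < m → ¬ m < P.root' i (w x)) : w x = x := by
  obtain ⟨c, hc, hcx, hcy⟩ := exists_isGeneric_near b h
  set y := w x with hy
  -- Among the elements moving `x` to `y`, the induction reduces the distance from the alcove of `c`
  -- to its image until the element is the identity.
  suffices H : ∀ n, ∀ u ∈ affineWeylGroup P, u x = y → alcoveDist P c (u c) = n → y = x from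
    H _ w hw hy.symm rfl
  intro n
  induction n using Nat.strong_induction_on with
  | _ n ih =>
    intro u hu hux hn
    by_cases hsep : ∃ i, ∃ m : ℤ, P.root' i c < m ∧ m < P.root' i (u c)
    · obtain ⟨i₀, m₀, h1, h2⟩ := hsep
      obtain ⟨i, m, hadj, hm⟩ := exists_isAdjacentWall hc h1 h2
      -- The point `y` lies in the closures of the alcoves of `c` and of `u c`, hence on every wall
      -- between them. So the reflection at this wall fixes `y` and can be multiplied to `u`.
      have hym : P.root' i y = m := by
        refine le_antisymm (not_lt.1 (hcy i m hadj.1)) (not_lt.1 fun h3 => ?_)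
        obtain ⟨A, σ, k, haut⟩ := IsAut.of_mem_affineWeylGroup hu
        rw [← hux, haut.root_eq] at h3
        rw [haut.root_eq] at hm
        exact hcx (opp P (σ i)) (-(m - k i)) (by rw [root'_opp]; push_cast; linarith)
          (by rw [root'_opp]; push_cast; linarith)
      refine ih _ ?_ (affRefl P i m * u) (mul_mem (affRefl_mem _ _) hu)
        (by rw [Equiv.Perm.mul_apply, hux, affRefl_eq_self hym]) rfl
      rw [← hn, ← (IsAffineAut.affRefl i m).alcoveDist_image, Equiv.Perm.mul_apply, affRefl_affRefl]
      exact hadj.alcoveDist_lt hc hm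
    · push Not at hsep
      rw [eq_one_of_forall_not_separated hc hu fun i m h1 => not_lt.2 (hsep i m h1)] at hux
      exact hux.symm

end

noncomputable section

/-! ### Sequences of levels along a gallery -/

/-- The levels `a 0, b 0, a 1, b 1, …, b p, a (p + 1)` of the small and large faces of a gallery. -/
def IncidentSeq (p : ℕ) (a b : ℕ → ℤ) : Prop :=
  ∀ l ≤ p, Incident (a l) (b l) ∧ Incident (a (l + 1)) (b l)

theorem Incident.neg {a b : ℤ} (h : Incident a b) : Incident (-a) (-b) := by
  unfold Incident at *; omega

theorem IncidentSeq.neg {p : ℕ} {a b : ℕ → ℤ} (h : IncidentSeq p a b) :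
    IncidentSeq p (fun l => -a l) (fun l => -b l) :=
  fun l hl => ⟨(h l hl).1.neg, (h l hl).2.neg⟩

/-- A discrete intermediate value theorem: a level below `2 n` can become at least `2 n` at an
incident face only by being exactly `2 n`, and this happens at a small face. -/
theorem IncidentSeq.exists_last_ge {p : ℕ} {a b : ℕ → ℤ} (h : IncidentSeq p a b) {n : ℤ} {j l : ℕ}
    (hjl : j ≤ l) (hl : l ≤ p) (ha : 2 * n ≤ a j) (hb : b l < 2 * n) :
    ∃ t, j ≤ t ∧ t ≤ l ∧ a t = 2 * n ∧ (∀ s, t < s → s ≤ l → a s < 2 * n) ∧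
      ∀ s, t ≤ s → s ≤ l → b s < 2 * n := by
  induction l, hjl using Nat.le_induction with
  | base =>
    have := (h j hl).1
    unfold Incident at this
    exact ⟨j, le_rfl, le_rfl, by omega, fun s _ _ => by omega, fun s h1 h2 => by
      rwa [le_antisymm h2 h1]⟩
  | succ l hjl ih =>
    have h1 := (h (l + 1) hl).1
    have h2 := (h l (by omega)).2
    unfold Incident at h1 h2
    by_cases h3 : a (l + 1) = 2 * n
    · exact ⟨l + 1, by omega, le_rfl, h3, fun s _ _ => by omega, fun s h1 h2 => by
        rwa [le_antisymm h2 h1]⟩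
    · obtain ⟨t, ht1, ht2, ht3, ht4, ht5⟩ := ih (by omega) (by omega)
      refine ⟨t, ht1, by omega, ht3, fun s hs1 hs2 => ?_, fun s hs1 hs2 => ?_⟩
      · rcases hs2.eq_or_lt with rfl | hs2
        · omega
        · exact ht4 s hs1 (by omega)
      · rcases hs2.eq_or_lt with rfl | hs2
        · omega
        · exact ht5 s hs1 (by omega)

theorem IncidentSeq.exists_first_ge {p : ℕ} {a b : ℕ → ℤ} (h : IncidentSeq p a b) {n : ℤ} {l k : ℕ}
    (hlk : l < k) (hk : k ≤ p + 1) (hb : b l < 2 * n) (ha : 2 * n ≤ a k) :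
    ∃ t, l < t ∧ t ≤ k ∧ a t = 2 * n ∧ (∀ s, l < s → s < t → a s < 2 * n) ∧
      ∀ s, l ≤ s → s < t → b s < 2 * n := by
  obtain ⟨d, rfl⟩ : ∃ d, k = l + 1 + d := ⟨k - (l + 1), by omega⟩
  clear hlk
  induction d generalizing l with
  | zero =>
    have := (h l (by omega)).2
    unfold Incident at this
    rw [add_zero] at ha hk
    refine ⟨l + 1, by omega, by omega, by omega, fun s _ _ => by omega, fun s h1 h2 => ?_⟩
    rwa [show s = l by omega]
  | succ d ih =>
    have h1 := (h (l + 1) (by omega)).1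
    have h2 := (h l (by omega)).2
    unfold Incident at h1 h2
    by_cases h3 : a (l + 1) = 2 * n
    · refine ⟨l + 1, by omega, by omega, h3, fun s _ _ => by omega, fun s h1 h2 => ?_⟩
      rwa [show s = l by omega]
    · obtain ⟨t, ht1, ht2, ht3, ht4, ht5⟩ := ih (l := l + 1) (by omega)
        (by omega) (by rwa [show l + 1 + 1 + d = l + 1 + (d + 1) by ring])
      refine ⟨t, by omega, by omega, ht3, fun s hs1 hs2 => ?_, fun s hs1 hs2 => ?_⟩
      · rcases (Nat.succ_le_of_lt hs1).eq_or_lt with hs | hs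
        · rw [← hs]; show a (l + 1) < _; omega
        · exact ht4 s hs hs2
      · rcases hs1.eq_or_lt with rfl | hs1
        · exact hb
        · exact ht5 s hs1 hs2

theorem IncidentSeq.exists_last_le {p : ℕ} {a b : ℕ → ℤ} (h : IncidentSeq p a b) {n : ℤ} {j l : ℕ}
    (hjl : j ≤ l) (hl : l ≤ p) (ha : a j ≤ 2 * n) (hb : 2 * n < b l) :
    ∃ t, j ≤ t ∧ t ≤ l ∧ a t = 2 * n ∧ (∀ s, t < s → s ≤ l → 2 * n < a s) ∧
      ∀ s, t ≤ s → s ≤ l → 2 * n < b s := by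
  obtain ⟨t, h1, h2, h3, h4, h5⟩ := h.neg.exists_last_ge (n := -n) hjl hl (by omega) (by omega)
  exact ⟨t, h1, h2, by omega, fun s hs hs' => by have := h4 s hs hs'; omega,
    fun s hs hs' => by have := h5 s hs hs'; omega⟩

variable {ι M N : Type*} [AddCommGroup M] [Module ℝ M] [AddCommGroup N] [Module ℝ N]
variable {P : RootPairing ι ℝ M N} {b : P.Base}

/-! ### Dominance and the anti-dominant chamber at infinity -/

theorem root'_nonneg_of_simple [Finite ι] [P.IsCrystallographic] {x : N}
    (h : ∀ i ∈ b.support, 0 ≤ P.root' i x) {i : ι} (hi : b.IsPos i) : 0 ≤ P.root' i x := by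
  refine hi.induction_on_add (p := fun i => 0 ≤ P.root' i x) h fun i j k hk hi hj => ?_
  have : P.root' k x = P.root' i x + P.root' j x := by
    rw [RootPairing.root', hk, map_add, LinearMap.add_apply]
  linarith [h j hj]

/-- On an anti-dominant sector a positive root is bounded above and unbounded below. So only the
lower half-space can contain a sector, and it contains those with sufficiently low apex. -/
theorem separatesFromNegInfty_iff [P.IsRootSystem] {i : ι} (hi : b.IsPos i) {F : Set N}
    (hF : IsFace P F) {m : ℤ} :
    SeparatesFromNegInfty P b i m F ↔ 2 * m < faceLevel P F i := by
  constructor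
  · rintro ⟨v, -, h⟩
    rw [hF.separates_iff] at h
    rcases h with h | ⟨h, -⟩
    · exact h.2
    exfalso
    obtain ⟨d, hd⟩ := exists_root'_eq_height b
    have hpos : (1 : ℝ) ≤ b.height i := by exact_mod_cast (Int.add_one_le_iff.2 hi : 0 + 1 ≤ b.height i)
    -- A point of the sector so far in the direction `-d` that its value under `i` is below `m`; it
    -- uses that the height of `i` is at least one.
    have hmem : v - (|P.root' i v - m| + 1) • d ∈ antidominantSector P b v := by
      intro j hj
      have : (0 : ℝ) < b.height j := by exact_mod_cast hj
      rw [sub_sub_cancel, map_smul, smul_eq_mul, hd]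
      positivity
    have := h hmem
    simp only [upper, Set.mem_ofPred_eq, map_sub, map_smul, smul_eq_mul, hd] at this
    nlinarith [le_abs_self (P.root' i v - m), abs_nonneg (P.root' i v - m)]
  · intro h
    -- The root `i` takes the value `-2 |m| ≤ m` at this apex.
    refine ⟨(-|m| : ℤ) • P.coroot i, zsmul_mem (AddSubgroup.subset_closure (Set.mem_range_self i)) _, ?_⟩
    rw [hF.separates_iff]
    refine Or.inl ⟨fun x hx => ?_, h⟩
    have := hx i hi
    rw [map_sub, map_zsmul, P.root'_coroot_eq_pairing, P.pairing_same, zsmul_eq_mul] at this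
    have hm : (-|m| * 2 : ℤ) ≤ m := by
      have h1 := neg_abs_le m
      have h2 := abs_nonneg m
      omega
    have hm' : ((-|m| : ℤ) : ℝ) * 2 ≤ m := by exact_mod_cast hm
    show P.root' i x ≤ m
    linarith

/-! ### Minimal triples and positive foldings in terms of levels -/

/-- `(E ⊃ F' ⊂ F)` is minimal, in terms of levels. -/
def LevelMinimal (P : RootPairing ι ℝ M N) (E F' F : Set N) : Prop :=
  ∀ i m, faceLevel P F' i = 2 * m → 2 * m < faceLevel P F i → faceLevel P E i ≤ 2 * m

/-- A wall separating `E` and `F` contains their common face `F'` automatically, so only one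
inclusion has content. `LevelMinimal` runs over all roots, and the opposite roots account for the
other side of each wall. -/
theorem isMinimalTriple_iff {E F' F : Set N} (hE : IsFace P E) (hF' : IsFace P F')
    (hF : IsFace P F) (h₁ : F' ⊆ E) (h₂ : F' ⊆ F) :
    IsMinimalTriple P b E F' F ↔ LevelMinimal P E F' F := by
  have key : ∀ q : ι × ℤ, (q ∈ separatingWalls P b E F ↔ b.IsPos q.1 ∧
      ((faceLevel P E q.1 ≤ 2 * q.2 ∧ 2 * q.2 < faceLevel P F q.1) ∨
      (2 * q.2 ≤ faceLevel P E q.1 ∧ faceLevel P F q.1 < 2 * q.2))) := fun q => by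
    unfold separatingWalls
    rw [Set.mem_ofPred_eq, hF.separates_iff, hE.subset_lower_iff, hE.subset_upper_iff]
  have key' : ∀ q : ι × ℤ, (q ∈ {q : ι × ℤ | b.IsPos q.1 ∧ F' ⊆ wall P q.1 q.2 ∧
      ¬ F ⊆ wall P q.1 q.2} ↔ b.IsPos q.1 ∧ faceLevel P F' q.1 = 2 * q.2 ∧
      faceLevel P F q.1 ≠ 2 * q.2) := fun q => by
    rw [Set.mem_ofPred_eq, hF'.subset_wall_iff, hF.subset_wall_iff]
  unfold IsMinimalTriple
  rw [Set.ext_iff]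
  constructor
  · intro h i m h1 h2
    by_cases hi : b.IsPos i
    · have := (key (i, m)).1 ((h (i, m)).2 ((key' (i, m)).2 ⟨hi, h1, h2.ne'⟩))
      dsimp only at this
      omega
    · have e1 := faceLevel_opp (P := P) F' i
      have e2 := faceLevel_opp (P := P) F i
      have e3 := faceLevel_opp (P := P) E i
      have := (key (opp P i, -m)).1 ((h (opp P i, -m)).2 ((key' (opp P i, -m)).2
        ⟨isPos_opp.2 hi, by dsimp only; omega, by dsimp only; omega⟩))
      dsimp only at this
      omega
  · rintro h ⟨i, m⟩
    rw [key, key']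
    refine and_congr_right fun hi => ?_
    dsimp only
    have i1 := hF'.incident hE h₁ i
    have i2 := hF'.incident hF h₂ i
    unfold Incident at i1 i2
    constructor
    · omega
    · rintro ⟨h1, h2⟩
      rcases lt_or_gt_of_ne h2 with h2 | h2
      · have e1 := faceLevel_opp (P := P) F' i
        have e2 := faceLevel_opp (P := P) F i
        have e3 := faceLevel_opp (P := P) E i
        have := h (opp P i) (-m) (by omega) (by omega)
        omega
      · have := h i m h1 h2
        omega

theorem LevelMinimal.image {E F' F : Set N} (h : LevelMinimal P E F' F) (hE : IsFace P E)
    (hF' : IsFace P F') (hF : IsFace P F) {w : Equiv.Perm N} (hw : IsAut P w) :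
    LevelMinimal P (w '' E) (w '' F') (w '' F) := by
  obtain ⟨A, σ, k, hw⟩ := hw
  intro i m
  rw [hw.faceLevel_image hE, hw.faceLevel_image hF', hw.faceLevel_image hF]
  intro h1 h2
  have := h (σ i) (m - k i) (by omega) (by omega)
  omega

variable [P.IsRootSystem]

theorem positiveReflection_iff [P.IsCrystallographic] {F' E₁ E₂ : Set N} (hE : IsFace P E₁) :
    PositiveReflection P b F' E₁ E₂ ↔ ∃ (i : ι) (m : ℤ), b.IsPos i ∧ F' ⊆ wall P i m ∧
      E₂ = affRefl P i m '' E₁ ∧ faceLevel P E₁ i < 2 * m := by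
  refine exists_congr fun i => exists_congr fun m => and_congr_right fun hi =>
    and_congr_right fun _ => and_congr_right ?_
  rintro rfl
  rw [separatesFromNegInfty_iff hi ((IsAut.affRefl i m).isFace_image hE),
    faceLevel_affRefl_image_self hE]
  omega

theorem PositiveReflection.isFace [P.IsCrystallographic] {F' E₁ E₂ : Set N}
    (h : PositiveReflection P b F' E₁ E₂) (hE : IsFace P E₁) : IsFace P E₂ := by
  obtain ⟨i, m, -, -, rfl, -⟩ := h
  exact (IsAut.affRefl i m).isFace_image hE

theorem isFace_of_reflTransGen [P.IsCrystallographic] {F' E₁ E₂ : Set N}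
    (h : Relation.ReflTransGen (PositiveReflection P b F') E₁ E₂) (hE : IsFace P E₁) :
    IsFace P E₂ := by
  induction h with
  | refl => exact hE
  | tail _ h ih => exact h.isFace ih

theorem IsAffineAut.positiveReflection_image [P.IsCrystallographic] {w : Equiv.Perm N} {A : N ≃ₗ[ℝ] N}
    {σ : Equiv.Perm ι} {k : ι → ℤ} (h : IsAffineAut P w A σ k) {F' E : Set N} (hF' : IsFace P F')
    (hE : IsFace P E) {i : ι} {m : ℤ} (hi : b.IsPos (σ.symm i)) (hw : F' ⊆ wall P i m)
    (hl : faceLevel P E i < 2 * m) :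
    PositiveReflection P b (w '' F') (w '' E) (w '' (LSGallery.affRefl P i m '' E)) := by
  have hA : IsAut P w := ⟨A, σ, k, h⟩
  rw [positiveReflection_iff (hA.isFace_image hE)]
  refine ⟨σ.symm i, m + k (σ.symm i), hi, ?_, ?_, ?_⟩
  · rw [(hA.isFace_image hF').subset_wall_iff, h.faceLevel_image hF', Equiv.apply_symm_apply,
      hF'.subset_wall_iff.1 hw]
    ring
  · have := h.affRefl_mul (σ.symm i) (m + k (σ.symm i))
    rw [Equiv.apply_symm_apply, add_sub_cancel_right] at this
    rw [← Set.image_comp, ← Set.image_comp, ← Equiv.Perm.coe_mul, ← Equiv.Perm.coe_mul, this]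
  · rw [h.faceLevel_image hE, Equiv.apply_symm_apply]
    omega

theorem positivelyFoldedAt_iff {E F' F : Set N} (hE : IsFace P E) (hF' : IsFace P F')
    (h₁ : F' ⊆ E) : PositivelyFoldedAt P b E F' F ↔ ∃ Ω, IsFace P Ω ∧ F' ⊆ Ω ∧
      LevelMinimal P E F' Ω ∧ Relation.ReflTransGen (PositiveReflection P b F') Ω F := by
  refine exists_congr fun Ω => and_congr_right fun hΩ => and_congr_right fun h => ?_
  rw [isMinimalTriple_iff hE hF' hΩ h₁ h]

variable [P.IsCrystallographic]

/-- Only the walls through `F'` occur in the foldings, so it suffices that their positive roots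
remain positive. -/
theorem PositivelyFoldedAt.image {E F' F : Set N} (h : PositivelyFoldedAt P b E F' F)
    (hE : IsFace P E) (hF' : IsFace P F') (h₁ : F' ⊆ E) {w : Equiv.Perm N} {A : N ≃ₗ[ℝ] N}
    {σ : Equiv.Perm ι} {k : ι → ℤ} (hw : IsAffineAut P w A σ k)
    (hpos : ∀ i m, b.IsPos i → faceLevel P F' i = 2 * m → b.IsPos (σ.symm i)) :
    PositivelyFoldedAt P b (w '' E) (w '' F') (w '' F) := by
  have hA : IsAut P w := ⟨A, σ, k, hw⟩
  rw [positivelyFoldedAt_iff hE hF' h₁] at h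
  rw [positivelyFoldedAt_iff (hA.isFace_image hE) (hA.isFace_image hF') (Set.image_mono h₁)]
  obtain ⟨Ω, hΩ, hsub, hmin, hch⟩ := h
  refine ⟨w '' Ω, hA.isFace_image hΩ, Set.image_mono hsub, hmin.image hE hF' hΩ hA, ?_⟩
  clear hmin
  induction hch with
  | refl => exact .refl
  | @tail X Y hX hXY ih =>
    refine ih.tail ?_
    have hXf := isFace_of_reflTransGen hX hΩ
    obtain ⟨i, m, hi, hw', rfl, hl⟩ := (positiveReflection_iff hXf).1 hXY
    exact hw.positiveReflection_image hF' hXf (hpos i m hi (hF'.subset_wall_iff.1 hw')) hw' hl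

/-! ### The lifting property of positive foldings with respect to a simple reflection. -/

section lifting

variable [Finite ι] [P.IsReduced] {α : ι} {n : ℤ} {F' : Set N}

theorem positiveReflection_simple (hα : α ∈ b.support) (hw : F' ⊆ wall P α n) {X : Set N}
    (hX : IsFace P X) (h : faceLevel P X α < 2 * n) :
    PositiveReflection P b F' X (affRefl P α n '' X) :=
  (positiveReflection_iff hX).2 ⟨α, n, RootPairing.Base.isPos_of_mem_support hα, hw, rfl, h⟩

theorem reflTransGen_simple (hα : α ∈ b.support) (hw : F' ⊆ wall P α n) {X : Set N}
    (hX : IsFace P X) (h : faceLevel P X α ≤ 2 * n) :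
    Relation.ReflTransGen (PositiveReflection P b F') X (affRefl P α n '' X) := by
  rcases h.eq_or_lt with h | h
  · rw [affRefl_image_eq_self (hX.subset_wall_iff.2 h)]
  · exact .single (positiveReflection_simple hα hw hX h)

theorem reflTransGen_simple' (hα : α ∈ b.support) (hw : F' ⊆ wall P α n) {X : Set N}
    (hX : IsFace P X) (h : 2 * n ≤ faceLevel P X α) :
    Relation.ReflTransGen (PositiveReflection P b F') (affRefl P α n '' X) X := by
  have := reflTransGen_simple hα hw ((IsAut.affRefl α n).isFace_image hX)
    (by rw [faceLevel_affRefl_image_self hX]; omega)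
  rwa [affRefl_image_image] at this

/-- The simple reflection permutes the positive roots other than `α`, so conjugation by it keeps
every positive reflection positive except `s_{α,n}` itself. -/
theorem PositiveReflection.simple_image (hα : α ∈ b.support) (hF' : IsFace P F')
    (hw : F' ⊆ wall P α n) {X Y : Set N} (hX : IsFace P X) (h : PositiveReflection P b F' X Y) :
    (faceLevel P X α < 2 * n ∧ Y = affRefl P α n '' X) ∨
      PositiveReflection P b F' (affRefl P α n '' X) (affRefl P α n '' Y) := by
  obtain ⟨i, m, hi, hw', rfl, hl⟩ := (positiveReflection_iff hX).1 h
  by_cases hiα : i = α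
  · subst hiα
    obtain rfl : n = m := by
      have h1 := hF'.subset_wall_iff.1 hw
      have h2 := hF'.subset_wall_iff.1 hw'
      omega
    exact Or.inl ⟨hl, rfl⟩
  · right
    have := (IsAffineAut.affRefl α n).positiveReflection_image (b := b) hF' hX (i := i) (m := m)
      (by rw [P.reflectionPerm_symm]; exact hi.reflectionPerm hα hiα) hw' hl
    rwa [affRefl_image_eq_self hw] at this

variable (P α n) in
open Classical in
/-- The lower one of `X` and its mirror image at `H_{α,n}`. -/
def lowerImage (X : Set N) : Set N :=
  if faceLevel P X α ≤ 2 * n then X else affRefl P α n '' X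

variable (P α n) in
open Classical in
/-- The higher one of `X` and its mirror image at `H_{α,n}`. -/
def upperImage (X : Set N) : Set N :=
  if 2 * n ≤ faceLevel P X α then X else affRefl P α n '' X

/-- Analogue of the lifting property of the Bruhat order: if `X ≤ Y`, the lower members of the pairs
`{X, s X}` and `{Y, s Y}` are related in the same way. It suffices to check a single positive
reflection. -/
theorem reflTransGen_lowerImage (hα : α ∈ b.support) (hF' : IsFace P F') (hw : F' ⊆ wall P α n)
    {X Y : Set N} (hX : IsFace P X) (h : Relation.ReflTransGen (PositiveReflection P b F') X Y) :
    Relation.ReflTransGen (PositiveReflection P b F') (lowerImage P α n X)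
      (lowerImage P α n Y) := by
  induction h with
  | refl => exact .refl
  | @tail Y Z hY hYZ ih =>
    have hYf := isFace_of_reflTransGen hY hX
    refine ih.trans ?_
    rcases hYZ.simple_image hα hF' hw hYf with ⟨hlt, rfl⟩ | hs
    · rw [lowerImage, if_pos hlt.le, lowerImage, faceLevel_affRefl_image_self hYf,
        if_neg (by omega), affRefl_image_image]
    · unfold lowerImage
      split_ifs with h1 h2 h2
      · exact .single hYZ
      · exact (reflTransGen_simple hα hw hYf h1).tail hs
      · exact (reflTransGen_simple' hα hw hYf (by omega)).tail hYZ
      · exact .single hs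

theorem reflTransGen_upperImage (hα : α ∈ b.support) (hF' : IsFace P F') (hw : F' ⊆ wall P α n)
    {X Y : Set N} (hX : IsFace P X) (h : Relation.ReflTransGen (PositiveReflection P b F') X Y) :
    Relation.ReflTransGen (PositiveReflection P b F') (upperImage P α n X)
      (upperImage P α n Y) := by
  induction h with
  | refl => exact .refl
  | @tail Y Z hY hYZ ih =>
    have hYf := isFace_of_reflTransGen hY hX
    have hZf := hYZ.isFace hYf
    refine ih.trans ?_
    rcases hYZ.simple_image hα hF' hw hYf with ⟨hlt, rfl⟩ | hs
    · rw [upperImage, if_neg (by omega), upperImage, faceLevel_affRefl_image_self hYf,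
        if_pos (by omega)]
    · unfold upperImage
      split_ifs with h1 h2 h2
      · exact .single hYZ
      · exact (Relation.ReflTransGen.single hYZ).trans (reflTransGen_simple hα hw hZf (by omega))
      · exact (Relation.ReflTransGen.single hs).trans (reflTransGen_simple' hα hw hZf h2)
      · exact .single hs

variable {E F : Set N}

theorem PositivelyFoldedAt.reflect_up (h : PositivelyFoldedAt P b E F' F) (hα : α ∈ b.support)
    (hw : F' ⊆ wall P α n) (hF : faceLevel P F α < 2 * n) :
    PositivelyFoldedAt P b E F' (affRefl P α n '' F) := by
  obtain ⟨Ω, hΩ, hsub, hmin, hch⟩ := h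
  exact ⟨Ω, hΩ, hsub, hmin, hch.tail
    (positiveReflection_simple hα hw (isFace_of_reflTransGen hch hΩ) hF)⟩

/-- The chain from `Ω` to `F` is pushed below `H_{α,n}`. If `Ω` was above, minimality forces `E`
into this wall, and then the reflected `Ω` still continues `E` minimally. -/
theorem PositivelyFoldedAt.reflect_down (h : PositivelyFoldedAt P b E F' F) (hE : IsFace P E)
    (hF' : IsFace P F') (h₁ : F' ⊆ E) (hα : α ∈ b.support) (hw : F' ⊆ wall P α n)
    (hF : 2 * n < faceLevel P F α) (hEα : 2 * n ≤ faceLevel P E α) :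
    PositivelyFoldedAt P b E F' (affRefl P α n '' F) := by
  rw [positivelyFoldedAt_iff hE hF' h₁] at h ⊢
  obtain ⟨Ω, hΩ, hsub, hmin, hch⟩ := h
  have hch' := reflTransGen_lowerImage hα hF' hw hΩ hch
  rw [lowerImage, lowerImage, if_neg (not_le.2 hF)] at hch'
  split_ifs at hch' with hle
  · exact ⟨Ω, hΩ, hsub, hmin, hch'⟩
  · have hE' : affRefl P α n '' E = E := by
      refine affRefl_image_eq_self (hE.subset_wall_iff.2 (le_antisymm ?_ hEα))
      exact hmin α n (hF'.subset_wall_iff.1 hw) (by omega)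
    refine ⟨affRefl P α n '' Ω, (IsAut.affRefl α n).isFace_image hΩ, ?_, ?_, hch'⟩
    · rw [← affRefl_image_eq_self hw]; exact Set.image_mono hsub
    · have := hmin.image hE hF' hΩ (IsAut.affRefl α n)
      rwa [hE', affRefl_image_eq_self hw] at this

/-- As `E` is strictly above the wall, `Ω` is not. Hence `s Ω`, which continues `s E` minimally, is
the higher representative, and the lifted chain leads from it to `F`. -/
theorem PositivelyFoldedAt.reflect_left_down (h : PositivelyFoldedAt P b E F' F) (hE : IsFace P E)
    (hF' : IsFace P F') (h₁ : F' ⊆ E) (hα : α ∈ b.support) (hw : F' ⊆ wall P α n)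
    (hEα : 2 * n < faceLevel P E α) (hF : 2 * n ≤ faceLevel P F α) :
    PositivelyFoldedAt P b (affRefl P α n '' E) F' F := by
  rw [positivelyFoldedAt_iff hE hF' h₁] at h
  have hs := affRefl_image_eq_self hw
  rw [positivelyFoldedAt_iff ((IsAut.affRefl α n).isFace_image hE) hF'
    (by rw [← hs]; exact Set.image_mono h₁)]
  obtain ⟨Ω, hΩ, hsub, hmin, hch⟩ := h
  have hch' := reflTransGen_upperImage hα hF' hw hΩ hch
  rw [upperImage, upperImage, if_pos hF] at hch'
  refine ⟨affRefl P α n '' Ω, (IsAut.affRefl α n).isFace_image hΩ, ?_, ?_, ?_⟩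
  · rw [← hs]; exact Set.image_mono hsub
  · have := hmin.image hE hF' hΩ (IsAut.affRefl α n)
    rwa [hs] at this
  · split_ifs at hch' with hle
    · have : faceLevel P Ω α = 2 * n := by
        by_contra hne
        have := hmin α n (hF'.subset_wall_iff.1 hw) (by omega)
        omega
      rwa [affRefl_image_eq_self (hΩ.subset_wall_iff.2 this)]
    · exact hch'

/-- As `E` is strictly below the wall, `Ω` is not, so the chain from `Ω` can be preceded by the
positive reflection taking `s Ω` to `Ω`. -/
theorem PositivelyFoldedAt.reflect_left_up (h : PositivelyFoldedAt P b E F' F) (hE : IsFace P E)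
    (hF' : IsFace P F') (h₁ : F' ⊆ E) (hα : α ∈ b.support) (hw : F' ⊆ wall P α n)
    (hEα : faceLevel P E α < 2 * n) :
    PositivelyFoldedAt P b (affRefl P α n '' E) F' F := by
  rw [positivelyFoldedAt_iff hE hF' h₁] at h
  have hs := affRefl_image_eq_self hw
  rw [positivelyFoldedAt_iff ((IsAut.affRefl α n).isFace_image hE) hF'
    (by rw [← hs]; exact Set.image_mono h₁)]
  obtain ⟨Ω, hΩ, hsub, hmin, hch⟩ := h
  refine ⟨affRefl P α n '' Ω, (IsAut.affRefl α n).isFace_image hΩ, ?_, ?_, ?_⟩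
  · rw [← hs]; exact Set.image_mono hsub
  · have := hmin.image hE hF' hΩ (IsAut.affRefl α n)
    rwa [hs] at this
  · refine (reflTransGen_simple' hα hw hΩ ?_).trans hch
    by_contra hlt
    have h1 := hF'.subset_wall_iff.1 hw
    have := hmin (opp P α) (-n) (by rw [faceLevel_opp]; omega) (by rw [faceLevel_opp]; omega)
    rw [faceLevel_opp] at this
    omega

end lifting

end

noncomputable section

variable {ι M N : Type*} [AddCommGroup M] [Module ℝ M] [AddCommGroup N] [Module ℝ N]
variable {P : RootPairing ι ℝ M N} {b : P.Base} {p : ℕ}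

/-! ### Galleries indexed by natural numbers -/

/-- The small faces, indexed by natural numbers. -/
def Gallery.sm (γ : Gallery N p) (l : ℕ) : Set N := γ.small (Fin.ofNat (p + 2) l)

/-- The large faces, indexed by natural numbers. -/
def Gallery.lg (γ : Gallery N p) (l : ℕ) : Set N := γ.large (Fin.ofNat (p + 1) l)

theorem Gallery.small_eq_sm (γ : Gallery N p) (k : Fin (p + 2)) : γ.small k = γ.sm k :=
  congrArg γ.small (Fin.ext (Nat.mod_eq_of_lt k.2).symm)

theorem Gallery.large_eq_lg (γ : Gallery N p) (k : Fin (p + 1)) : γ.large k = γ.lg k :=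
  congrArg γ.large (Fin.ext (Nat.mod_eq_of_lt k.2).symm)

theorem Gallery.small_zero_eq (γ : Gallery N p) : γ.small 0 = γ.sm 0 := γ.small_eq_sm 0

theorem Gallery.small_last_eq (γ : Gallery N p) :
    γ.small (Fin.last (p + 1)) = γ.sm (p + 1) := γ.small_eq_sm _

theorem Gallery.eq_of_sm_lg {γ δ : Gallery N p} (h₁ : ∀ l ≤ p + 1, γ.sm l = δ.sm l)
    (h₂ : ∀ l ≤ p, γ.lg l = δ.lg l) : γ = δ := by
  refine Gallery.ext (funext fun k => ?_) (funext fun k => ?_)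
  · rw [γ.small_eq_sm, δ.small_eq_sm, h₁ _ (by omega)]
  · rw [γ.large_eq_lg, δ.large_eq_lg, h₂ _ (by omega)]

theorem Gallery.sm_mapAt (γ : Gallery N p) (φ : ℕ → N → N) {l : ℕ} (hl : l ≤ p + 1) :
    (γ.mapAt φ).sm l = φ l '' γ.sm l := by
  show φ (l % (p + 2)) '' _ = _
  rw [Nat.mod_eq_of_lt (by omega)]
  rfl

theorem Gallery.lg_mapAt (γ : Gallery N p) (φ : ℕ → N → N) {l : ℕ} (hl : l ≤ p) :
    (γ.mapAt φ).lg l = φ l '' γ.lg l := by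
  show φ (l % (p + 1)) '' _ = _
  rw [Nat.mod_eq_of_lt (by omega)]
  rfl

theorem isGallery_iff {γ : Gallery N p} : IsGallery P γ ↔
    (∀ l ≤ p + 1, IsFace P (γ.sm l)) ∧ (∀ l ≤ p, IsFace P (γ.lg l)) ∧
    (∀ l ≤ p, γ.sm l ⊆ γ.lg l) ∧ (∀ l ≤ p, γ.sm (l + 1) ⊆ γ.lg l) ∧ faceDim (γ.sm 0) = 0 ∧
    faceDim (γ.sm (p + 1)) = 0 ∧ (∀ j ≤ p, ∀ k ≤ p, faceDim (γ.lg j) = faceDim (γ.lg k)) ∧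
    ∀ l < p, faceDim (γ.sm (l + 1)) + 1 = faceDim (γ.lg (l + 1)) := by
  constructor
  · rintro ⟨h1, h2, h3, h4, h5, h6, h7, h8⟩
    refine ⟨fun l _ => h1 _, fun l _ => h2 _, fun l hl => ?_, fun l hl => ?_, ?_, ?_,
      fun j _ k _ => h7 _ _, fun l hl => ?_⟩
    · have := h3 ⟨l, by omega⟩
      rwa [γ.small_eq_sm, γ.large_eq_lg] at this
    · have := h4 ⟨l, by omega⟩
      rwa [γ.small_eq_sm, γ.large_eq_lg] at this
    · rwa [γ.small_eq_sm] at h5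
    · rwa [γ.small_eq_sm] at h6
    · have := h8 ⟨l, hl⟩
      rwa [γ.small_eq_sm, γ.large_eq_lg] at this
  · rintro ⟨h1, h2, h3, h4, h5, h6, h7, h8⟩
    refine ⟨fun l => ?_, fun l => ?_, fun l => ?_, fun l => ?_, ?_, ?_, fun j k => ?_, fun l => ?_⟩ <;>
      simp only [γ.small_eq_sm, γ.large_eq_lg]
    exacts [h1 _ (Nat.le_of_lt_succ l.2), h2 _ (Nat.le_of_lt_succ l.2),
      h3 _ (Nat.le_of_lt_succ l.2), h4 _ (Nat.le_of_lt_succ l.2), h5, h6,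
      h7 _ (Nat.le_of_lt_succ j.2) _ (Nat.le_of_lt_succ k.2), h8 _ l.2]

theorem IsGallery.sm_isFace {γ : Gallery N p} (h : IsGallery P γ) (l : ℕ) : IsFace P (γ.sm l) :=
  h.small_isFace _

theorem IsGallery.lg_isFace {γ : Gallery N p} (h : IsGallery P γ) (l : ℕ) : IsFace P (γ.lg l) :=
  h.large_isFace _

theorem IsGallery.sm_subset {γ : Gallery N p} (h : IsGallery P γ) {l : ℕ} (hl : l ≤ p) :
    γ.sm l ⊆ γ.lg l := (isGallery_iff.1 h).2.2.1 l hl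

theorem IsGallery.sm_succ_subset {γ : Gallery N p} (h : IsGallery P γ) {l : ℕ} (hl : l ≤ p) :
    γ.sm (l + 1) ⊆ γ.lg l := (isGallery_iff.1 h).2.2.2.1 l hl

/-- The level of the `l`-th small face. -/
def slev (P : RootPairing ι ℝ M N) (γ : Gallery N p) (i : ι) (l : ℕ) : ℤ := faceLevel P (γ.sm l) i

/-- The level of the `l`-th large face. -/
def llev (P : RootPairing ι ℝ M N) (γ : Gallery N p) (i : ι) (l : ℕ) : ℤ := faceLevel P (γ.lg l) i

theorem IsGallery.incidentSeq {γ : Gallery N p} (h : IsGallery P γ) (i : ι) :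
    IncidentSeq p (slev P γ i) (llev P γ i) := fun l hl =>
  ⟨(h.sm_isFace l).incident (h.lg_isFace l) (h.sm_subset hl) i,
    (h.sm_isFace (l + 1)).incident (h.lg_isFace l) (h.sm_succ_subset hl) i⟩

/-- The condition `hc` says that consecutive maps agree on the small face shared by two large faces,
so that the pieces still fit together. -/
theorem IsGallery.mapAt {γ : Gallery N p} (h : IsGallery P γ) {ψ : ℕ → Equiv.Perm N}
    (hψ : ∀ l, IsAut P (ψ l)) (hc : ∀ l ≤ p, ψ l '' γ.sm (l + 1) = ψ (l + 1) '' γ.sm (l + 1)) :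
    IsGallery P (γ.mapAt fun l => ψ l) := by
  obtain ⟨h1, h2, h3, h4, h5, h6, h7, h8⟩ := isGallery_iff.1 h
  refine isGallery_iff.2 ⟨fun l hl => ?_, fun l hl => ?_, fun l hl => ?_, fun l hl => ?_, ?_, ?_,
    fun j hj k hk => ?_, fun l hl => ?_⟩
  · rw [γ.sm_mapAt _ hl]; exact (hψ l).isFace_image (h1 l hl)
  · rw [γ.lg_mapAt _ hl]; exact (hψ l).isFace_image (h2 l hl)
  · rw [γ.sm_mapAt _ (by omega), γ.lg_mapAt _ hl]; exact Set.image_mono (h3 l hl)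
  · rw [γ.sm_mapAt _ (by omega), γ.lg_mapAt _ hl, ← hc l hl]; exact Set.image_mono (h4 l hl)
  · rw [γ.sm_mapAt _ (by omega), (hψ _).faceDim_image, h5]
  · rw [γ.sm_mapAt _ (by omega), (hψ _).faceDim_image, h6]
  · rw [γ.lg_mapAt _ hj, γ.lg_mapAt _ hk, (hψ _).faceDim_image, (hψ _).faceDim_image, h7 j hj k hk]
  · rw [γ.sm_mapAt _ (by omega), γ.lg_mapAt _ (by omega), (hψ _).faceDim_image,
      (hψ _).faceDim_image, h8 l hl]

theorem SameType.image {E F : Set N} (h : SameType P E F) {w : Equiv.Perm N}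
    (hw : w ∈ affineWeylGroup P) : SameType P E (w '' F) := by
  obtain ⟨u, hu, rfl⟩ := h
  exact ⟨w * u, mul_mem hw hu, by rw [← Set.image_comp, Equiv.Perm.coe_mul]⟩

theorem forall_positivelyFolded_iff {γ : Gallery N p} :
    (∀ j : Fin p, PositivelyFoldedAt P b (γ.large j.castSucc) (γ.small j.succ.castSucc)
      (γ.large j.succ)) ↔ ∀ l < p, PositivelyFoldedAt P b (γ.lg l) (γ.sm (l + 1)) (γ.lg (l + 1)) := by
  constructor
  · intro h l hl
    have := h ⟨l, hl⟩
    rwa [γ.small_eq_sm, γ.large_eq_lg, γ.large_eq_lg] at this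
  · intro h j
    rw [γ.small_eq_sm, γ.large_eq_lg, γ.large_eq_lg]
    exact h j j.2

/-! ### The dimension of a gallery -/

/-- The roots of the load-bearing walls at `F' ⊂ F`. -/
def loadBearing (b : P.Base) (F' F : Set N) : Set ι :=
  {i | b.IsPos i ∧ faceLevel P F' i % 2 = 0 ∧ faceLevel P F' i < faceLevel P F i}

/-- A face lies in at most one wall of each direction. At a given position the wall can thus be
replaced by its root, and `m` is recovered as half the level of the small face. -/
theorem galleryDim_eq_sum [Finite ι] [P.IsRootSystem] {γ : Gallery N p} (h : IsGallery P γ) :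
    galleryDim P b γ = ∑ l ∈ Finset.range (p + 1), (loadBearing b (γ.sm l) (γ.lg l)).ncard := by
  rw [Finset.sum_range (fun l => (loadBearing b (γ.sm l) (γ.lg l)).ncard), galleryDim]
  have key : ∀ q : (ι × ℤ) × Fin (p + 1), (q.1 ∈ wallsAt P b γ q.2 ∧
      SeparatesFromNegInfty P b q.1.1 q.1.2 (γ.large q.2)) ↔
      (q.1.1 ∈ loadBearing b (γ.sm q.2) (γ.lg q.2) ∧ slev P γ q.1.1 q.2 = 2 * q.1.2) := by
    rintro ⟨⟨i, m⟩, j⟩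
    dsimp only
    unfold wallsAt loadBearing slev
    rw [Set.mem_ofPred_eq, Set.mem_ofPred_eq]
    dsimp only
    rw [γ.small_eq_sm, γ.large_eq_lg, (h.sm_isFace _).subset_wall_iff,
      (h.lg_isFace _).subset_wall_iff, Fin.val_castSucc]
    constructor
    · rintro ⟨⟨hi, h1, h2⟩, h3⟩
      rw [separatesFromNegInfty_iff hi (h.lg_isFace _)] at h3
      exact ⟨⟨hi, by omega, by omega⟩, h1⟩
    · rintro ⟨⟨hi, h1, h2⟩, h3⟩
      rw [separatesFromNegInfty_iff hi (h.lg_isFace _)]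
      exact ⟨⟨hi, h3, by omega⟩, by omega⟩
  simp only [key]
  rw [← Nat.card_coe_set_eq]
  simp only [← Nat.card_coe_set_eq]
  rw [← Nat.card_sigma]
  refine Nat.card_congr
    { toFun := fun q => ⟨q.1.2, q.1.1.1, q.2.1⟩
      invFun := fun q => ⟨((q.2.1, slev P γ q.2.1 q.1 / 2), q.1), q.2.2, ?_⟩
      left_inv := ?_
      right_inv := fun q => rfl }
  · have := q.2.2.2.1
    change slev P γ q.2.1 q.1 % 2 = 0 at this
    dsimp only
    omega
  · rintro ⟨⟨⟨i, m⟩, j⟩, h1, h2⟩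
    dsimp only at h2
    simp only [Subtype.mk.injEq, Prod.mk.injEq, true_and, and_true]
    omega

section simple

variable [Finite ι] [P.IsCrystallographic] [P.IsReduced] {α : ι}

open Classical in
theorem ncard_setOf_isPos_eq (hα : α ∈ b.support) (Q : ι → Prop) :
    {i | b.IsPos i ∧ Q i}.ncard = {i | (b.IsPos i ∧ i ≠ α) ∧ Q i}.ncard + if Q α then 1 else 0 := by
  have hpos : b.IsPos α := RootPairing.Base.isPos_of_mem_support hα
  split_ifs with h
  · rw [← Set.ncard_insert_of_notMem (a := α) (by simp) (Set.toFinite _)]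
    congr 1
    ext i
    simp only [Set.mem_ofPred_eq, Set.mem_insert_iff]
    by_cases hi : i = α
    · subst hi; simp [hpos, h]
    · simp [hi]
  · rw [add_zero]
    congr 1
    ext i
    simp only [Set.mem_ofPred_eq]
    by_cases hi : i = α
    · subst hi; simp [h]
    · simp [hi]

theorem reflectionPerm_isPos_and_ne (hα : α ∈ b.support) {i : ι} (h : b.IsPos i ∧ i ≠ α) :
    b.IsPos (P.reflectionPerm α i) ∧ P.reflectionPerm α i ≠ α := by
  refine ⟨h.1.reflectionPerm hα h.2, fun hi => ?_⟩
  have : i = opp P α := by rw [← P.reflectionPerm_self α i, hi, opp]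
  rw [this, isPos_opp] at h
  exact h.1 (RootPairing.Base.isPos_of_mem_support hα)

open Classical in
/-- A simple reflection permutes the positive roots other than the simple one. -/
theorem ncard_setOf_isPos_reflectionPerm (hα : α ∈ b.support) (Q : ι → Prop) :
    {i | b.IsPos i ∧ Q (P.reflectionPerm α i)}.ncard + (if Q α then 1 else 0) =
      {i | b.IsPos i ∧ Q i}.ncard + if Q (opp P α) then 1 else 0 := by
  rw [ncard_setOf_isPos_eq hα Q, ncard_setOf_isPos_eq hα fun i => Q (P.reflectionPerm α i)]
  have : {i | (b.IsPos i ∧ i ≠ α) ∧ Q (P.reflectionPerm α i)}.ncard =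
      {i | (b.IsPos i ∧ i ≠ α) ∧ Q i}.ncard := by
    refine Set.ncard_congr (fun i _ => P.reflectionPerm α i) ?_ ?_ ?_
    · rintro i ⟨h1, h2⟩
      exact ⟨reflectionPerm_isPos_and_ne hα h1, h2⟩
    · intro i j _ _ h
      exact (P.reflectionPerm α).injective h
    · rintro i ⟨h1, h2⟩
      refine ⟨P.reflectionPerm α i, ⟨reflectionPerm_isPos_and_ne hα h1, ?_⟩, P.reflectionPerm_self α i⟩
      rwa [P.reflectionPerm_self]
  rw [this, opp]
  omega

open Classical in
-- The positive roots other than `α` are permuted, so the two counts differ only by what `α`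
-- contributes before and after the reflection.
theorem ncard_loadBearing_affRefl (hα : α ∈ b.support) {F' F : Set N} (hF' : IsFace P F')
    (hF : IsFace P F) (n : ℤ) :
    (loadBearing b (affRefl P α n '' F') (affRefl P α n '' F)).ncard +
        (if faceLevel P F' α % 2 = 0 ∧ faceLevel P F' α < faceLevel P F α then 1 else 0) =
      (loadBearing b F' F).ncard +
        if faceLevel P F' α % 2 = 0 ∧ faceLevel P F α < faceLevel P F' α then 1 else 0 := by
  have := ncard_setOf_isPos_reflectionPerm (b := b) hα
    fun i => faceLevel P F' i % 2 = 0 ∧ faceLevel P F' i < faceLevel P F i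
  have e : (faceLevel P F' (opp P α) % 2 = 0 ∧ faceLevel P F' (opp P α) < faceLevel P F (opp P α)) ↔
      (faceLevel P F' α % 2 = 0 ∧ faceLevel P F α < faceLevel P F' α) := by
    rw [faceLevel_opp, faceLevel_opp]; omega
  simp only [e] at this
  rw [show loadBearing b F' F = {i | b.IsPos i ∧ faceLevel P F' i % 2 = 0 ∧
    faceLevel P F' i < faceLevel P F i} from rfl, ← this]
  congr 2
  ext i
  simp only [loadBearing, Set.mem_ofPred_eq]
  rw [faceLevel_affRefl_image hF', faceLevel_affRefl_image hF]
  refine and_congr_right fun _ => ?_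
  omega

end simple

theorem loadBearing_image {w : Equiv.Perm N} {A : N ≃ₗ[ℝ] N} {k : ι → ℤ}
    (h : IsAffineAut P w A 1 k) {F' F : Set N} (hF' : IsFace P F') (hF : IsFace P F) :
    loadBearing b (w '' F') (w '' F) = loadBearing b F' F := by
  ext i
  simp only [loadBearing, Set.mem_ofPred_eq]
  rw [h.faceLevel_image hF', h.faceLevel_image hF, Equiv.Perm.one_apply]
  refine and_congr_right fun _ => ?_
  omega

/-! ### Folding a gallery between two positions -/

/-- The identity at positions `< j`, the reflection `s_{β,n}` at positions `j, …, k - 1`, and the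
translation by `(n - n') β^∨` at positions `≥ k`. -/
def foldMap (P : RootPairing ι ℝ M N) (i : ι) (n n' : ℤ) (j k l : ℕ) : Equiv.Perm N :=
  if l < j then 1 else if l < k then affRefl P i n else Equiv.addRight ((n - n') • P.coroot i)

/-- The gallery obtained by applying `foldMap`. -/
def Gallery.fold (P : RootPairing ι ℝ M N) (γ : Gallery N p) (i : ι) (n n' : ℤ) (j k : ℕ) :
    Gallery N p :=
  γ.mapAt fun l => foldMap P i n n' j k l

theorem foldMap_of_lt {i : ι} {n n' : ℤ} {j k l : ℕ} (h : l < j) :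
    foldMap P i n n' j k l = 1 := if_pos h

theorem foldMap_of_mem {i : ι} {n n' : ℤ} {j k l : ℕ} (h : j ≤ l) (h' : l < k) :
    foldMap P i n n' j k l = affRefl P i n := by
  rw [foldMap, if_neg (by omega), if_pos h']

theorem foldMap_of_ge {i : ι} {n n' : ℤ} {j k l : ℕ} (h : j ≤ l) (h' : k ≤ l) :
    foldMap P i n n' j k l = Equiv.addRight ((n - n') • P.coroot i) := by
  rw [foldMap, if_neg (by omega), if_neg (by omega)]

theorem affRefl_mul_affRefl (i : ι) (n n' : ℤ) :
    affRefl P i n * affRefl P i n' = Equiv.addRight ((n - n') • P.coroot i) := by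
  ext x
  rw [Equiv.Perm.mul_apply, affRefl_apply, root'_affRefl_self, affRefl_apply, Equiv.coe_addRight,
    ← Int.cast_smul_eq_zsmul ℝ]
  push_cast
  module

theorem foldMap_mem (i : ι) (n n' : ℤ) (j k l : ℕ) :
    foldMap P i n n' j k l ∈ affineWeylGroup P := by
  unfold foldMap
  split_ifs
  · exact one_mem _
  · exact affRefl_mem _ _
  · rw [← affRefl_mul_affRefl]; exact mul_mem (affRefl_mem _ _) (affRefl_mem _ _)

theorem isAffineAut_addRight_coroot [P.IsCrystallographic] (i : ι) (n : ℤ) :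
    IsAffineAut P (Equiv.addRight (n • P.coroot i)) (LinearEquiv.refl ℝ N) 1
      (fun r => n * P.pairingIn ℤ r i) :=
  IsAffineAut.addRight _ _ fun r => by
    rw [map_zsmul, P.root'_coroot_eq_pairing, zsmul_eq_mul]
    push_cast
    rw [pairingIn_cast]

theorem affRefl_image_affRefl_image (F : Set N) (i : ι) (n n' : ℤ) :
    affRefl P i n '' (affRefl P i n' '' F) = Equiv.addRight ((n - n') • P.coroot i) '' F := by
  rw [← affRefl_mul_affRefl, Equiv.Perm.coe_mul, Set.image_comp]

/-- The translation is the product of the reflections at level `n` and level `n'`, and the latter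
fixes `F`. This makes the reflected and translated parts of a folded gallery fit at position `k`. -/
theorem image_addRight_eq {F : Set N} {i : ι} {n' : ℤ} (h : F ⊆ wall P i n') (n : ℤ) :
    Equiv.addRight ((n - n') • P.coroot i) '' F = affRefl P i n '' F := by
  rw [← affRefl_image_affRefl_image, affRefl_image_eq_self h]

/-- The data of a folding: the small faces at the positions `j < k` lie on `H_{β,n}` and `H_{β,n'}`,
and those in between on no hyperplane parallel to these. -/
structure IsFoldData (P : RootPairing ι ℝ M N) (γ : Gallery N p) (i : ι) (n n' : ℤ) (j k : ℕ) :
    Prop where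
  lt : j < k
  le : k ≤ p + 1
  left : slev P γ i j = 2 * n
  right : slev P γ i k = 2 * n'
  mid : ∀ l, j < l → l < k → slev P γ i l % 2 = 1

section fold

variable [P.IsCrystallographic] {γ : Gallery N p} {i : ι} {n n' : ℤ} {j k : ℕ}

theorem IsFoldData.left_subset (hγ : IsGallery P γ) (h : IsFoldData P γ i n n' j k) :
    γ.sm j ⊆ wall P i n := (hγ.sm_isFace j).subset_wall_iff.2 h.left

theorem IsFoldData.right_subset (hγ : IsGallery P γ) (h : IsFoldData P γ i n n' j k) :
    γ.sm k ⊆ wall P i n' := (hγ.sm_isFace k).subset_wall_iff.2 h.right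

theorem IsGallery.fold (hγ : IsGallery P γ) (h : IsFoldData P γ i n n' j k) :
    IsGallery P (γ.fold P i n n' j k) := by
  refine hγ.mapAt (fun l => IsAut.of_mem_affineWeylGroup (foldMap_mem _ _ _ _ _ _)) fun l hl => ?_
  have := h.lt
  rcases lt_trichotomy (l + 1) j with h1 | h1 | h1
  · rw [foldMap_of_lt h1, foldMap_of_lt (by omega)]
  · rw [foldMap_of_lt (by omega), foldMap_of_mem (by omega) (by omega), h1,
      affRefl_image_eq_self (h.left_subset hγ), Equiv.Perm.coe_one, Set.image_id]
  · rcases lt_trichotomy (l + 1) k with h2 | h2 | h2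
    · rw [foldMap_of_mem (by omega) h2, foldMap_of_mem (by omega) (by omega)]
    · rw [foldMap_of_mem (by omega) (by omega), foldMap_of_ge (by omega) (by omega), h2,
        image_addRight_eq (h.right_subset hγ)]
    · rw [foldMap_of_ge (by omega) (by omega), foldMap_of_ge (by omega) (by omega)]

theorem fold_mem_galleriesOfType {γ₀ : Gallery N p} (hγ : γ ∈ galleriesOfType P γ₀)
    (h : IsFoldData P γ i n n' j k) : γ.fold P i n n' j k ∈ galleriesOfType P γ₀ := by
  obtain ⟨h1, h2, h3, h4⟩ := hγ
  refine ⟨h1.fold h, ?_, fun l => (h3 l).image (foldMap_mem _ _ _ _ _ _),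
    fun l => (h4 l).image (foldMap_mem _ _ _ _ _ _)⟩
  have := h.lt
  rw [Gallery.small_zero_eq] at h2 ⊢
  rw [Gallery.fold, γ.sm_mapAt _ (by omega)]
  rcases Nat.eq_zero_or_pos j with rfl | hj
  · rw [foldMap_of_mem (by omega) (by omega), affRefl_image_eq_self (h.left_subset h1), h2]
  · rw [foldMap_of_lt hj, Equiv.Perm.coe_one, Set.image_id, h2]

theorem fold_target {ν : N} (hν : γ.small (Fin.last (p + 1)) = {ν})
    (h : IsFoldData P γ i n n' j k) :
    (γ.fold P i n n' j k).small (Fin.last (p + 1)) = {ν + (n - n') • P.coroot i} := by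
  have h1 := h.lt
  have h2 := h.le
  rw [Gallery.small_last_eq] at hν ⊢
  rw [Gallery.fold, γ.sm_mapAt _ le_rfl, foldMap_of_ge (by omega) h2, hν, Set.image_singleton]
  rfl

theorem slev_fold_of_lt {l : ℕ} (hl : l < j) (hl' : l ≤ p + 1) (r : ι) :
    slev P (γ.fold P i n n' j k) r l = slev P γ r l := by
  rw [slev, Gallery.fold, γ.sm_mapAt _ hl', foldMap_of_lt hl, Equiv.Perm.coe_one, Set.image_id, slev]

theorem slev_fold_of_mem (hγ : IsGallery P γ) {l : ℕ} (hl : j ≤ l) (hlk : l < k) (hl' : l ≤ p + 1) :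
    slev P (γ.fold P i n n' j k) i l = 4 * n - slev P γ i l := by
  rw [slev, Gallery.fold, γ.sm_mapAt _ hl', foldMap_of_mem hl hlk,
    faceLevel_affRefl_image_self (hγ.sm_isFace l), slev]

theorem slev_fold_of_ge (hγ : IsGallery P γ) {l : ℕ} (hl : j ≤ l) (hlk : k ≤ l) (hl' : l ≤ p + 1) :
    slev P (γ.fold P i n n' j k) i l = slev P γ i l + 4 * (n - n') := by
  rw [slev, Gallery.fold, γ.sm_mapAt _ hl', foldMap_of_ge hl hlk,
    (isAffineAut_addRight_coroot i (n - n')).faceLevel_image (hγ.sm_isFace l), slev,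
    P.pairingIn_same, Equiv.Perm.one_apply]
  ring

/-- Folding twice. -/
theorem fold_fold : (γ.fold P i n n' j k).fold P i n (2 * n - n') j k = γ := by
  refine Gallery.eq_of_sm_lg (fun l hl => ?_) fun l hl => ?_
  · rw [Gallery.fold, Gallery.sm_mapAt _ _ hl, Gallery.fold, Gallery.sm_mapAt _ _ hl,
      ← Set.image_comp, ← Equiv.Perm.coe_mul]
    convert Set.image_id _
    unfold foldMap
    split_ifs
    · rfl
    · rw [affRefl_mul_self, Equiv.Perm.coe_one]
    · ext x
      simp only [Equiv.Perm.mul_apply, Equiv.coe_addRight, id]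
      module
  · rw [Gallery.fold, Gallery.lg_mapAt _ _ hl, Gallery.fold, Gallery.lg_mapAt _ _ hl,
      ← Set.image_comp, ← Equiv.Perm.coe_mul]
    convert Set.image_id _
    unfold foldMap
    split_ifs
    · rfl
    · rw [affRefl_mul_self, Equiv.Perm.coe_one]
    · ext x
      simp only [Equiv.Perm.mul_apply, Equiv.coe_addRight, id]
      module

variable [Finite ι] [P.IsReduced] [P.IsRootSystem]

open Classical in
-- Strictly between `j` and `k` the small faces lie on no wall of direction `i`, so the simple
-- reflection preserves the count there. From `k` on a translation acts. Only position `j`, where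
-- such a wall is present, contributes a change.
theorem galleryDim_fold (hγ : IsGallery P γ) (h : IsFoldData P γ i n n' j k) (hi : i ∈ b.support) :
    galleryDim P b (γ.fold P i n n' j k) + (if 2 * n < llev P γ i j then 1 else 0) =
      galleryDim P b γ + if llev P γ i j < 2 * n then 1 else 0 := by
  have hlt := h.lt
  have hle := h.le
  rw [galleryDim_eq_sum hγ, galleryDim_eq_sum (hγ.fold h)]
  have hmem : j ∈ Finset.range (p + 1) := Finset.mem_range.2 (by omega)
  have e : ∀ (c : ℕ), c = ∑ l ∈ Finset.range (p + 1), if j = l then c else 0 := fun c => by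
    rw [Finset.sum_ite_eq, if_pos hmem]
  rw [e (if 2 * n < llev P γ i j then 1 else 0), e (if llev P γ i j < 2 * n then 1 else 0),
    ← Finset.sum_add_distrib, ← Finset.sum_add_distrib]
  refine Finset.sum_congr rfl fun l hl => ?_
  have hl' := Finset.mem_range.1 hl
  rw [Gallery.fold, γ.sm_mapAt _ (by omega), γ.lg_mapAt _ (by omega)]
  rcases lt_trichotomy j l with h1 | rfl | h1
  · rw [if_neg (by omega), if_neg (by omega), add_zero, add_zero]
    by_cases h2 : l < k
    · rw [foldMap_of_mem h1.le h2]
      have := ncard_loadBearing_affRefl hi (hγ.sm_isFace l) (hγ.lg_isFace l) n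
      have hodd := h.mid l h1 h2
      rw [slev] at hodd
      rwa [if_neg (by omega), if_neg (by omega), add_zero, add_zero] at this
    · rw [foldMap_of_ge h1.le (by omega), loadBearing_image (isAffineAut_addRight_coroot i _)
        (hγ.sm_isFace l) (hγ.lg_isFace l)]
  · rw [if_pos rfl, if_pos rfl, foldMap_of_mem le_rfl hlt]
    have := ncard_loadBearing_affRefl hi (hγ.sm_isFace j) (hγ.lg_isFace j) n
    have hleft := h.left
    rw [slev] at hleft
    rw [hleft] at this
    have e0 : 2 * n % 2 = 0 := by omega
    simp only [e0, true_and] at this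
    convert this using 2 <;> exact if_congr Iff.rfl rfl rfl
  · rw [if_neg (by omega), if_neg (by omega), foldMap_of_lt h1, Equiv.Perm.coe_one, Set.image_id,
      Set.image_id]

/-- At positions strictly between `j` and `k` the walls through the small face have roots other than
`i`, whose positivity the simple reflection preserves. Hypotheses are needed only at the two joints.
-/
theorem positivelyFolded_fold {γ₀ : Gallery N p} (hγ : γ ∈ positivelyFolded P b γ₀)
    (h : IsFoldData P γ i n n' j k) (hi : i ∈ b.support)
    (hj : ∀ l, l + 1 = j → PositivelyFoldedAt P b (γ.lg l) (γ.sm (l + 1))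
      (affRefl P i n '' γ.lg (l + 1)))
    (hk : ∀ l, l + 1 = k → l < p → PositivelyFoldedAt P b (affRefl P i n' '' γ.lg l) (γ.sm (l + 1))
      (γ.lg (l + 1))) :
    γ.fold P i n n' j k ∈ positivelyFolded P b γ₀ := by
  have hg := hγ.1.1
  have hlt := h.lt
  refine ⟨fold_mem_galleriesOfType hγ.1 h, forall_positivelyFolded_iff.2 fun l hl => ?_⟩
  have hpf := forall_positivelyFolded_iff.1 hγ.2 l hl
  rw [Gallery.fold, γ.sm_mapAt _ (by omega), γ.lg_mapAt _ (by omega), γ.lg_mapAt _ (by omega)]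
  rcases lt_trichotomy (l + 1) j with h1 | h1 | h1
  · rw [foldMap_of_lt h1, foldMap_of_lt (by omega)]
    simpa using hpf
  · rw [foldMap_of_lt (show l < j by omega), foldMap_of_mem (by omega) (by omega),
      affRefl_image_eq_self (F := γ.sm (l + 1)) (by rw [h1]; exact h.left_subset hg),
      Equiv.Perm.coe_one, Set.image_id]
    exact hj l h1
  · rcases lt_trichotomy (l + 1) k with h2 | h2 | h2
    · rw [foldMap_of_mem (by omega) h2, foldMap_of_mem (by omega) (by omega)]
      refine hpf.image (hg.lg_isFace l) (hg.sm_isFace _) (hg.sm_succ_subset hl.le)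
        (IsAffineAut.affRefl i n) fun r m hr hlev => ?_
      rw [P.reflectionPerm_symm]
      refine hr.reflectionPerm hi ?_
      rintro rfl
      have := h.mid _ h1 h2
      rw [slev] at this
      omega
    · rw [foldMap_of_mem (show j ≤ l by omega) (by omega), foldMap_of_ge (by omega) (by omega)]
      have hsub := h.right_subset hg
      rw [← h2] at hsub
      -- The reflection at level `n` is the translation after the reflection at level `n'`. So the
      -- triple at the joint `k` is the translate of the one in `hk`.
      have := (hk l h2 hl).image ((IsAut.affRefl i n').isFace_image (hg.lg_isFace l))
        (hg.sm_isFace _) (by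
          rw [← affRefl_image_eq_self hsub]; exact Set.image_mono (hg.sm_succ_subset hl.le))
        (isAffineAut_addRight_coroot i (n - n')) fun r m hr _ => hr
      rwa [← affRefl_image_affRefl_image (affRefl P i n' '' γ.lg l), affRefl_image_image] at this
    · rw [foldMap_of_ge (by omega) (by omega), foldMap_of_ge (by omega) (by omega)]
      exact hpf.image (hg.lg_isFace l) (hg.sm_isFace _) (hg.sm_succ_subset hl.le)
        (isAffineAut_addRight_coroot i (n - n')) fun r m hr _ => hr

end fold

end

noncomputable section

variable {ι M N : Type*} [AddCommGroup M] [Module ℝ M] [AddCommGroup N] [Module ℝ N]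
variable {P : RootPairing ι ℝ M N} {b : P.Base} {p : ℕ}

/-! ### Galleries from the origin to an integral point -/

/-- The gallery starts at the origin, and all roots are integral at its target. -/
structure IsIntegralGallery (P : RootPairing ι ℝ M N) (γ : Gallery N p) : Prop where
  isGallery : IsGallery P γ
  source : γ.small 0 = {0}
  target : ∃ ν : N, γ.small (Fin.last (p + 1)) = {ν} ∧ ∀ i, ∃ n : ℤ, P.root' i ν = n

theorem faceLevel_singleton {x : N} (h : IsFace P {x}) (i : ι) :
    faceLevel P {x} i = lev (P.root' i x) := by
  obtain ⟨y, hy⟩ := h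
  obtain rfl : y = x := by
    have := mem_faceOf_self P y
    rwa [← hy] at this
  rw [hy, faceLevel_faceOf]

theorem IsGallery.slev_target {γ : Gallery N p} (h : IsGallery P γ) {ν : N}
    (hν : γ.small (Fin.last (p + 1)) = {ν}) (i : ι) :
    slev P γ i (p + 1) = lev (P.root' i ν) := by
  have := h.sm_isFace (p + 1)
  rw [Gallery.small_last_eq] at hν
  rw [hν] at this
  rw [slev, hν, faceLevel_singleton this]

theorem IsIntegralGallery.slev_zero {γ : Gallery N p} (h : IsIntegralGallery P γ) (i : ι) :
    slev P γ i 0 = 0 := by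
  have hf := h.isGallery.sm_isFace 0
  have hs := h.source
  rw [Gallery.small_zero_eq] at hs
  rw [hs] at hf
  rw [slev, hs, faceLevel_singleton hf, map_zero]
  simp [lev]

theorem IsIntegralGallery.slev_last {γ : Gallery N p} (h : IsIntegralGallery P γ) (i : ι) :
    ∃ n, slev P γ i (p + 1) = 2 * n := by
  obtain ⟨ν, hν, hi⟩ := h.target
  obtain ⟨n, hn⟩ := hi i
  exact ⟨n, by rw [h.isGallery.slev_target hν, lev_eq_two_mul, hn]⟩

theorem IsIntegralGallery.fold [P.IsCrystallographic] {γ : Gallery N p}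
    (h : IsIntegralGallery P γ) {i : ι} {n n' : ℤ} {j k : ℕ} (hf : IsFoldData P γ i n n' j k) :
    IsIntegralGallery P (γ.fold P i n n' j k) := by
  obtain ⟨ν, hν, hi⟩ := h.target
  refine ⟨h.isGallery.fold hf, (fold_mem_galleriesOfType (γ₀ := γ) ⟨h.isGallery, h.source,
    fun _ => ⟨1, one_mem _, by simp⟩, fun _ => ⟨1, one_mem _, by simp⟩⟩ hf).2.1,
    _, fold_target hν hf, fun r => ?_⟩
  obtain ⟨m, hm⟩ := hi r
  refine ⟨m + (n - n') * P.pairingIn ℤ r i, ?_⟩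
  rw [map_add, map_zsmul, P.root'_coroot_eq_pairing, hm, zsmul_eq_mul]
  push_cast
  rw [pairingIn_cast]

theorem exists_integral_image [P.IsCrystallographic] {x : N} (hx : ∀ i, ∃ n : ℤ, P.root' i x = n)
    {w : Equiv.Perm N} (hw : IsAut P w) (i : ι) : ∃ n : ℤ, P.root' i (w x) = n := by
  obtain ⟨A, σ, k, hw⟩ := hw
  obtain ⟨n, hn⟩ := hx (σ i)
  exact ⟨n + k i, by rw [hw.root_eq, hn]; push_cast; rfl⟩

theorem isIntegralGallery_of_mem [P.IsCrystallographic] {γ₀ γ : Gallery N p}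
    (h₀ : IsIntegralGallery P γ₀) (h : γ ∈ galleriesOfType P γ₀) : IsIntegralGallery P γ := by
  obtain ⟨h1, h2, h3, h4⟩ := h
  obtain ⟨ν, hν, hi⟩ := h₀.target
  obtain ⟨w, hw, hw'⟩ := h3 (Fin.last (p + 1))
  rw [hν, Set.image_singleton] at hw'
  exact ⟨h1, h2, _, hw', exists_integral_image hi (IsAut.of_mem_affineWeylGroup hw)⟩

/-! ### Root operators as foldings -/

/-- `m` is the minimal level. -/
def IsMinLev (P : RootPairing ι ℝ M N) (γ : Gallery N p) (i : ι) (m : ℤ) : Prop :=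
  (∃ k ≤ p + 1, slev P γ i k = 2 * m) ∧ ∀ k ≤ p + 1, ∀ n, slev P γ i k = 2 * n → m ≤ n

theorem small_subset_wall_iff {γ : Gallery N p} (h : IsGallery P γ) {i : ι} {m : ℤ}
    {k : Fin (p + 2)} : γ.small k ⊆ wall P i m ↔ slev P γ i k = 2 * m := by
  rw [γ.small_eq_sm, (h.sm_isFace _).subset_wall_iff, slev]

theorem isMinLevel_iff {γ : Gallery N p} (h : IsGallery P γ) {i : ι} {m : ℤ} :
    IsMinLevel P i γ m ↔ IsMinLev P γ i m := by
  unfold IsMinLevel IsMinLev IsLeast lowerBounds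
  simp only [Set.mem_ofPred_eq, small_subset_wall_iff h, forall_exists_index]
  refine and_congr ⟨?_, ?_⟩ ⟨?_, ?_⟩
  · rintro ⟨k, hk⟩; exact ⟨k, by omega, hk⟩
  · rintro ⟨k, hk, hk'⟩; exact ⟨⟨k, by omega⟩, hk'⟩
  · intro H k hk n hn; exact H ⟨k, by omega⟩ hn
  · intro H n k hk; exact H k (by omega) n hk

theorem IsIntegralGallery.exists_isMinLev {γ : Gallery N p} (h : IsIntegralGallery P γ) (i : ι) :
    ∃ m ≤ 0, IsMinLev P γ i m := by
  classical
  have hfin : {n : ℤ | ∃ k ≤ p + 1, slev P γ i k = 2 * n}.Finite := by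
    refine (Set.Finite.image (fun k => slev P γ i k / 2) (Set.finite_Iic (p + 1))).subset ?_
    rintro n ⟨k, hk, hn⟩
    exact ⟨k, hk, by dsimp only; omega⟩
  have h0 : (0 : ℤ) ∈ {n : ℤ | ∃ k ≤ p + 1, slev P γ i k = 2 * n} :=
    ⟨0, by omega, by rw [h.slev_zero]; rfl⟩
  obtain ⟨m, hm, hmin⟩ := Set.exists_min_image _ id hfin ⟨0, h0⟩
  exact ⟨m, hmin 0 h0, hm, fun k hk n hn => hmin n ⟨k, hk, hn⟩⟩

theorem IsIntegralGallery.min_le_zero {γ : Gallery N p} (h : IsIntegralGallery P γ) {i : ι} {m : ℤ}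
    (hm : IsMinLev P γ i m) : m ≤ 0 := hm.2 0 (by omega) 0 (by rw [h.slev_zero]; rfl)

/-- The positions in the definition of `e_α`. -/
structure IsPosE (P : RootPairing ι ℝ M N) (γ : Gallery N p) (i : ι) (m : ℤ) (j k : ℕ) : Prop where
  isMin : IsMinLev P γ i m
  neg : m ≤ -1
  lt : j < k
  le : k ≤ p + 1
  right : slev P γ i k = 2 * m
  first : ∀ l < k, slev P γ i l ≠ 2 * m
  left : slev P γ i j = 2 * (m + 1)
  last : ∀ l, j < l → l ≤ k → slev P γ i l ≠ 2 * (m + 1)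

/-- The positions in the definition of `f_α`. -/
structure IsPosF (P : RootPairing ι ℝ M N) (γ : Gallery N p) (i : ι) (m : ℤ) (j k : ℕ) : Prop where
  isMin : IsMinLev P γ i m
  target : 2 * (m + 1) ≤ slev P γ i (p + 1)
  lt : j < k
  le : k ≤ p + 1
  left : slev P γ i j = 2 * m
  last : ∀ l, j < l → l ≤ p + 1 → slev P γ i l ≠ 2 * m
  right : slev P γ i k = 2 * (m + 1)
  first : ∀ l, j ≤ l → l < k → slev P γ i l ≠ 2 * (m + 1)

theorem foldMap_e_eq (i : ι) (m : ℤ) (j k : ℕ) :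
    (fun (l : ℕ) (x : N) => if l < j then x else if l < k then affRefl P i (m + 1) x
      else x + P.coroot i) = fun l => ⇑(foldMap P i (m + 1) m j k l) := by
  funext l x
  unfold foldMap
  split_ifs <;> simp

theorem foldMap_f_eq (i : ι) (m : ℤ) (j k : ℕ) :
    (fun (l : ℕ) (x : N) => if l < j then x else if l < k then affRefl P i m x
      else x - P.coroot i) = fun l => ⇑(foldMap P i m (m + 1) j k l) := by
  funext l x
  unfold foldMap
  split_ifs
  · rfl
  · rfl
  · rw [Equiv.coe_addRight]; module

theorem rootE_iff {γ δ : Gallery N p} (h : IsGallery P γ) {i : ι} :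
    RootE P i γ δ ↔ ∃ m j k, IsPosE P γ i m j k ∧ δ = γ.fold P i (m + 1) m j k := by
  constructor
  · rintro ⟨m, j, k, hm, hneg, hk, hj, hδ⟩
    rw [foldMap_e_eq] at hδ
    rw [isMinLevel_iff h] at hm
    obtain ⟨hk1, hk2⟩ := hk
    obtain ⟨⟨hj0, hj1⟩, hj2⟩ := hj
    simp only [Set.mem_ofPred_eq, small_subset_wall_iff h] at hk1 hj1
    refine ⟨m, j, k, ⟨hm, hneg, ?_, by omega, hk1, fun l hl hl' => ?_, hj1, fun l hl hlk hl' => ?_⟩,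
      hδ⟩
    · refine lt_of_le_of_ne hj0 fun e => ?_
      rw [e] at hj1
      omega
    · have := hk2 (a := ⟨l, by omega⟩) ((small_subset_wall_iff h).2 hl')
      exact absurd (Fin.le_def.1 this) (not_le.2 hl)
    · have := hj2 (a := ⟨l, by omega⟩) ⟨hlk, (small_subset_wall_iff h).2 hl'⟩
      exact absurd (Fin.le_def.1 this) (not_le.2 hl)
  · rintro ⟨m, j, k, hp, hδ⟩
    have := hp.lt
    have := hp.le
    refine ⟨m, ⟨j, by omega⟩, ⟨k, by omega⟩, (isMinLevel_iff h).2 hp.isMin, hp.neg,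
      ⟨(small_subset_wall_iff h).2 hp.right, fun l hl => ?_⟩,
      ⟨⟨hp.lt.le, (small_subset_wall_iff h).2 hp.left⟩, fun l hl => ?_⟩, ?_⟩
    · exact not_lt.1 fun hlt => hp.first l hlt ((small_subset_wall_iff h).1 hl)
    · exact not_lt.1 fun hlt => hp.last l hlt hl.1 ((small_subset_wall_iff h).1 hl.2)
    · rw [foldMap_e_eq]; exact hδ

theorem rootF_iff {γ δ : Gallery N p} (h : IsGallery P γ) {ν : N}
    (hν : γ.small (Fin.last (p + 1)) = {ν}) {i : ι} :
    RootF P i γ δ ↔ ∃ m j k, IsPosF P γ i m j k ∧ δ = γ.fold P i m (m + 1) j k := by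
  have ht : ∀ m : ℤ, (1 ≤ P.root' i ν - m ↔ 2 * (m + 1) ≤ slev P γ i (p + 1)) := fun m => by
    rw [h.slev_target hν, two_mul_le_lev]
    push_cast
    constructor <;> intro _ <;> linarith
  constructor
  · rintro ⟨m, j, k, hm, ⟨ν', hν', hge⟩, hj, hk, hδ⟩
    obtain rfl : ν' = ν := Set.singleton_injective (hν'.symm.trans hν)
    rw [foldMap_f_eq] at hδ
    rw [isMinLevel_iff h] at hm
    obtain ⟨hj1, hj2⟩ := hj
    obtain ⟨⟨hk0, hk1⟩, hk2⟩ := hk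
    simp only [Set.mem_ofPred_eq, small_subset_wall_iff h] at hk1 hj1
    refine ⟨m, j, k, ⟨hm, (ht m).1 hge, ?_, by omega, hj1, fun l hl hlp hl' => ?_, hk1,
      fun l hl hlk hl' => ?_⟩, hδ⟩
    · refine lt_of_le_of_ne hk0 fun e => ?_
      rw [e] at hj1
      omega
    · have := hj2 (a := ⟨l, by omega⟩) ((small_subset_wall_iff h).2 hl')
      exact absurd (Fin.le_def.1 this) (not_le.2 hl)
    · have := hk2 (a := ⟨l, by omega⟩) ⟨hl, (small_subset_wall_iff h).2 hl'⟩
      exact absurd (Fin.le_def.1 this) (not_le.2 hlk)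
  · rintro ⟨m, j, k, hp, hδ⟩
    have := hp.lt
    have := hp.le
    refine ⟨m, ⟨j, by omega⟩, ⟨k, by omega⟩, (isMinLevel_iff h).2 hp.isMin,
      ⟨ν, hν, (ht m).2 hp.target⟩, ⟨(small_subset_wall_iff h).2 hp.left, fun l hl => ?_⟩,
      ⟨⟨hp.lt.le, (small_subset_wall_iff h).2 hp.right⟩, fun l hl => ?_⟩, ?_⟩
    · exact not_lt.1 fun hlt => hp.last l hlt (by omega) ((small_subset_wall_iff h).1 hl)
    · exact not_lt.1 fun hlt => hp.first l hl.1 hlt ((small_subset_wall_iff h).1 hl.2)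
    · rw [foldMap_f_eq]; exact hδ

/-! ### Levels near the positions used by the root operators. -/

section positions

variable {γ : Gallery N p} {i : ι} {m : ℤ} {j k : ℕ}

/-- The stretch leaves its last face at level `2 (m + 1)` downwards and arrives from above at its
first face at level `2 m`; any other behaviour would, by the intermediate value lemmas, contradict
the choice of `j` or of `k`. -/
theorem IsPosE.crossing (hγ : IsIntegralGallery P γ) (h : IsPosE P γ i m j k) :
    (∀ s, j < s → s < k → slev P γ i s < 2 * (m + 1)) ∧ llev P γ i j < 2 * (m + 1) ∧
      ∀ l, l + 1 = k → 2 * m < llev P γ i l := by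
  have hseq := hγ.isGallery.incidentSeq i
  have h0 := hγ.slev_zero i
  have hneg := h.neg
  have hlt := h.lt
  have hle := h.le
  obtain ⟨l, rfl⟩ : ∃ l, k = l + 1 := ⟨k - 1, by omega⟩
  have hr : 2 * m < llev P γ i l := by
    by_contra! hcon
    rcases hcon.eq_or_lt with hcon | hcon
    · have h1 := (hseq l (by omega)).1
      have h2 := h.first l (by omega)
      unfold Incident at h1
      omega
    · obtain ⟨t, ht1, ht2, ht3, -⟩ := hseq.exists_last_ge (n := m) (Nat.zero_le l) (by omega)
        (by omega) hcon
      exact h.first t (by omega) ht3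
  have hl : llev P γ i l < 2 * (m + 1) := by
    have h1 := (hseq l (by omega)).2
    have h2 := h.right
    unfold Incident at h1
    omega
  obtain ⟨t, ht1, ht2, ht3, ht4, ht5⟩ := hseq.exists_last_ge (n := m + 1) (Nat.zero_le l) (by omega)
    (by omega) hl
  obtain rfl : t = j := by
    rcases lt_trichotomy t j with h1 | h1 | h1
    · have := ht4 j h1 (by omega)
      have := h.left
      omega
    · exact h1
    · exact absurd ht3 (h.last t h1 (by omega))
  exact ⟨fun s h1 h2 => ht4 s h1 (by omega), ht5 t le_rfl ht2, fun l' hl' => by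
    obtain rfl : l' = l := by omega
    exact hr⟩

/-- An even level strictly inside would be below `2 (m + 1)` and at least `2 m`, hence `2 m`,
against the choice of `k`. -/
theorem IsPosE.isFoldData (hγ : IsIntegralGallery P γ) (h : IsPosE P γ i m j k) :
    IsFoldData P γ i (m + 1) m j k := by
  refine ⟨h.lt, h.le, h.left, h.right, fun l hl hlk => ?_⟩
  have h1 := (h.crossing hγ).1 l hl hlk
  have h2 := h.first l hlk
  have h3 := h.isMin.2 l (by have := h.le; omega) (slev P γ i l / 2)
  omega

theorem IsPosF.crossing (hγ : IsIntegralGallery P γ) (h : IsPosF P γ i m j k) :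
    (∀ s, j < s → s < k → slev P γ i s < 2 * (m + 1)) ∧ 2 * m < llev P γ i j ∧
      ∀ l, l + 1 = k → llev P γ i l < 2 * (m + 1) := by
  have hseq := hγ.isGallery.incidentSeq i
  have ht := h.target
  have hlt := h.lt
  have hle := h.le
  have hleft := h.left
  have hj : 2 * m < llev P γ i j := by
    by_contra! hcon
    rcases hcon.eq_or_lt with hcon | hcon
    · have h1 := (hseq j (by omega)).2
      have h2 := h.last (j + 1) (by omega) (by omega)
      unfold Incident at h1
      omega
    · obtain ⟨t, ht1, ht2, ht3, -⟩ := hseq.exists_first_ge (n := m) (l := j) (k := p + 1) (by omega)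
        le_rfl hcon (by omega)
      exact h.last t (by omega) ht2 ht3
  have hl : llev P γ i j < 2 * (m + 1) := by
    have h1 := (hseq j (by omega)).1
    unfold Incident at h1
    omega
  obtain ⟨t, ht1, ht2, ht3, ht4, ht5⟩ := hseq.exists_first_ge (n := m + 1) (l := j) (k := k)
    hlt hle hl h.right.ge
  obtain rfl : t = k := by
    rcases ht2.eq_or_lt with h1 | h1
    · exact h1
    · exact absurd ht3 (h.first t ht1.le h1)
  exact ⟨ht4, hj, fun l' hl' => ht5 l' (by omega) (by omega)⟩

theorem IsPosF.isFoldData (hγ : IsIntegralGallery P γ) (h : IsPosF P γ i m j k) :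
    IsFoldData P γ i m (m + 1) j k := by
  refine ⟨h.lt, h.le, h.left, h.right, fun l hl hlk => ?_⟩
  have hle := h.le
  have h1 := (h.crossing hγ).1 l hl hlk
  have h2 := h.last l hl (by omega)
  have h3 := h.isMin.2 l (by omega) (slev P γ i l / 2)
  omega

/-- After `e_α` the minimum is `m + 1`, last attained at `j`: even levels from `k` on have risen to
at least `2 (m + 2)`, and those strictly inside the stretch stay odd. Hence `f_α` uses the same two
positions. -/
theorem IsPosE.fold [P.IsCrystallographic] (hγ : IsIntegralGallery P γ) (h : IsPosE P γ i m j k) :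
    IsPosF P (γ.fold P i (m + 1) m j k) i (m + 1) j k := by
  have hf := h.isFoldData hγ
  have hg := hγ.isGallery
  have hlt := h.lt
  have hle := h.le
  have hleft := h.left
  have hright := h.right
  have e1 : ∀ l < j, slev P (γ.fold P i (m + 1) m j k) i l = slev P γ i l := fun l hl =>
    slev_fold_of_lt hl (by omega) i
  have e2 : ∀ l, j ≤ l → l < k → slev P (γ.fold P i (m + 1) m j k) i l =
    4 * (m + 1) - slev P γ i l := fun l hl hlk => slev_fold_of_mem hg hl hlk (by omega)
  have e3 : ∀ l, k ≤ l → l ≤ p + 1 → slev P (γ.fold P i (m + 1) m j k) i l =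
    slev P γ i l + 4 := fun l hl hlp => by rw [slev_fold_of_ge hg (by omega) hl hlp]; ring
  have hlast := hγ.slev_last i
  have hmin := h.isMin.2
  refine ⟨⟨⟨j, by omega, ?_⟩, fun l hl n hn => ?_⟩, ?_, hlt, hle, ?_, fun l hl hlp => ?_, ?_,
    fun l hl hlk => ?_⟩
  · rw [e2 j le_rfl hlt]; omega
  · rcases lt_or_ge l j with h1 | h1
    · rw [e1 l h1] at hn
      have := hmin l hl n hn
      have := h.first l (by omega)
      rcases eq_or_ne n m with rfl | hne
      · exact absurd hn this
      · omega
    · rcases lt_or_ge l k with h2 | h2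
      · rw [e2 l h1 h2] at hn
        rcases h1.eq_or_lt with rfl | h1
        · omega
        · have := hf.mid l h1 h2
          omega
      · rw [e3 l h2 hl] at hn
        have := hmin l hl (n - 2) (by omega)
        omega
  · obtain ⟨n, hn⟩ := hlast
    have := hmin _ le_rfl n hn
    rw [e3 _ hle le_rfl]
    omega
  · rw [e2 j le_rfl hlt]; omega
  · rcases lt_or_ge l k with h2 | h2
    · rw [e2 l hl.le h2]
      have := hf.mid l hl h2
      omega
    · rw [e3 l h2 hlp]
      intro hn
      have := hmin l hlp (m - 1) (by omega)
      omega
  · rw [e3 k le_rfl hle]; omega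
  · rw [e2 l hl hlk]
    rcases hl.eq_or_lt with rfl | hl
    · omega
    · have := hf.mid l hl hlk
      omega

/-- After `f_α` the minimum is `m - 1`, first attained at `k`. It is negative because the source at
level `0` forces `m ≤ 0`. -/
theorem IsPosF.fold [P.IsCrystallographic] (hγ : IsIntegralGallery P γ) (h : IsPosF P γ i m j k) :
    IsPosE P (γ.fold P i m (m + 1) j k) i (m - 1) j k := by
  have hf := h.isFoldData hγ
  have hg := hγ.isGallery
  have hlt := h.lt
  have hle := h.le
  have hleft := h.left
  have hright := h.right
  have e1 : ∀ l < j, slev P (γ.fold P i m (m + 1) j k) i l = slev P γ i l := fun l hl =>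
    slev_fold_of_lt hl (by omega) i
  have e2 : ∀ l, j ≤ l → l < k → slev P (γ.fold P i m (m + 1) j k) i l =
    4 * m - slev P γ i l := fun l hl hlk => slev_fold_of_mem hg hl hlk (by omega)
  have e3 : ∀ l, k ≤ l → l ≤ p + 1 → slev P (γ.fold P i m (m + 1) j k) i l =
    slev P γ i l - 4 := fun l hl hlp => by rw [slev_fold_of_ge hg (by omega) hl hlp]; ring
  have hmin := h.isMin.2
  have hm := hγ.min_le_zero h.isMin
  refine ⟨⟨⟨k, by omega, ?_⟩, fun l hl n hn => ?_⟩, by omega, hlt, hle, ?_, fun l hl => ?_, ?_,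
    fun l hl hlk => ?_⟩
  · rw [e3 k le_rfl hle]; omega
  · rcases lt_or_ge l j with h1 | h1
    · rw [e1 l h1] at hn
      have := hmin l hl n hn
      omega
    · rcases lt_or_ge l k with h2 | h2
      · rw [e2 l h1 h2] at hn
        rcases h1.eq_or_lt with rfl | h1
        · omega
        · have := hf.mid l h1 h2
          omega
      · rw [e3 l h2 hl] at hn
        have := hmin l hl (n + 2) (by omega)
        have := h.last l (by omega) hl
        omega
  · rw [e3 k le_rfl hle]; omega
  · rcases lt_or_ge l j with h1 | h1
    · rw [e1 l h1]
      intro hn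
      have := hmin l (by omega) (m - 1) hn
      omega
    · rw [e2 l h1 hl]
      rcases h1.eq_or_lt with rfl | h1
      · omega
      · have := hf.mid l h1 hl
        omega
  · rw [e2 j le_rfl hlt]; omega
  · rcases hlk.eq_or_lt with rfl | h2
    · rw [e3 l le_rfl hle]; omega
    · rw [e2 l hl.le h2]
      have := hf.mid l hl h2
      omega

/-- A part of the gallery that lies strictly below the minimal level can be folded up. -/
theorem IsMinLev.exists_fold_dip (hγ : IsIntegralGallery P γ) (h : IsMinLev P γ i m) {l : ℕ}
    (hl : l ≤ p) (hlow : llev P γ i l < 2 * m) :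
    ∃ j k, IsFoldData P γ i m m j k ∧ llev P γ i j < 2 * m ∧
      ∀ l', l' + 1 = k → llev P γ i l' < 2 * m := by
  have hseq := hγ.isGallery.incidentSeq i
  have hm := hγ.min_le_zero h
  obtain ⟨n, hn⟩ := hγ.slev_last i
  have hn' := h.2 _ le_rfl n hn
  -- Source and target have even levels, hence levels at least `2 m`, so the dip is enclosed by two
  -- small faces on `H_{α,m}`.
  obtain ⟨t, ht1, ht2, ht3, ht4, ht5⟩ := hseq.exists_last_ge (n := m) (Nat.zero_le l) hl
    (by rw [hγ.slev_zero]; omega) hlow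
  obtain ⟨k, hk1, hk2, hk3, hk4, hk5⟩ := hseq.exists_first_ge (n := m) (l := l) (k := p + 1)
    (by omega) le_rfl hlow (by omega)
  refine ⟨t, k, ⟨by omega, hk2, ht3, hk3, fun s hs1 hs2 => ?_⟩, ht5 t le_rfl ht2,
    fun l' hl' => hk5 l' (by omega) (by omega)⟩
  have hlt : slev P γ i s < 2 * m := by
    rcases le_or_gt s l with h1 | h1
    · exact ht4 s hs1 h1
    · exact hk4 s h1 hs2
  have := h.2 s (by omega) (slev P γ i s / 2)
  omega

end positions

/-! ### The root operators: mutual inverses, dimension and positive foldedness. -/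

section operators

variable [P.IsCrystallographic] {γ δ : Gallery N p} {i : ι}

theorem RootE.isIntegralGallery (hγ : IsIntegralGallery P γ) (h : RootE P i γ δ) :
    IsIntegralGallery P δ := by
  obtain ⟨m, j, k, hp, rfl⟩ := (rootE_iff hγ.isGallery).1 h
  exact hγ.fold (hp.isFoldData hγ)

theorem RootF.isIntegralGallery (hγ : IsIntegralGallery P γ) (h : RootF P i γ δ) :
    IsIntegralGallery P δ := by
  obtain ⟨ν, hν, -⟩ := hγ.target
  obtain ⟨m, j, k, hp, rfl⟩ := (rootF_iff hγ.isGallery hν).1 h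
  exact hγ.fold (hp.isFoldData hγ)

theorem RootE.rootF (hγ : IsIntegralGallery P γ) (h : RootE P i γ δ) : RootF P i δ γ := by
  have hδ := h.isIntegralGallery hγ
  obtain ⟨ν, hν, -⟩ := hδ.target
  obtain ⟨m, j, k, hp, rfl⟩ := (rootE_iff hγ.isGallery).1 h
  refine (rootF_iff hδ.isGallery hν).2 ⟨m + 1, j, k, hp.fold hγ, ?_⟩
  -- Folding back at level `m + 1` uses the mirror image `2 (m + 1) - m = m + 2` of the level `m`,
  -- which is the upper level for `f_α`.
  have := fold_fold (P := P) (γ := γ) (i := i) (n := m + 1) (n' := m) (j := j) (k := k)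
  rw [show 2 * (m + 1) - m = m + 1 + 1 by ring] at this
  exact this.symm

theorem RootF.rootE (hγ : IsIntegralGallery P γ) (h : RootF P i γ δ) : RootE P i δ γ := by
  have hδ := h.isIntegralGallery hγ
  obtain ⟨ν, hν, -⟩ := hγ.target
  obtain ⟨m, j, k, hp, rfl⟩ := (rootF_iff hγ.isGallery hν).1 h
  refine (rootE_iff hδ.isGallery).2 ⟨m - 1, j, k, hp.fold hγ, ?_⟩
  have := fold_fold (P := P) (γ := γ) (i := i) (n := m) (n' := m + 1) (j := j) (k := k)
  rw [show 2 * m - (m + 1) = m - 1 by ring] at this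
  rw [sub_add_cancel]
  exact this.symm

theorem RootESeq.isIntegralGallery {s : List ι} (hγ : IsIntegralGallery P γ)
    (h : RootESeq P s γ δ) : IsIntegralGallery P δ := by
  induction s generalizing δ with
  | nil => exact h ▸ hγ
  | cons i s ih =>
    obtain ⟨γ', h1, h2⟩ := h
    exact h2.isIntegralGallery (ih h1)

theorem RootESeq.rootFSeq {s : List ι} (hγ : IsIntegralGallery P γ) (h : RootESeq P s γ δ) :
    RootFSeq P s δ γ := by
  induction s generalizing δ with
  | nil => exact h.symm
  | cons i s ih =>
    obtain ⟨γ', h1, h2⟩ := h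
    exact ⟨γ', h2.rootF (h1.isIntegralGallery hγ), ih h1⟩

theorem RootFSeq.rootESeq {s : List ι} (hγ : IsIntegralGallery P γ) (h : RootFSeq P s γ δ) :
    RootESeq P s δ γ := by
  induction s generalizing γ with
  | nil => exact h.symm
  | cons i s ih =>
    obtain ⟨γ', h1, h2⟩ := h
    exact ⟨γ', ih (h1.isIntegralGallery hγ) h2, h1.rootE hγ⟩

variable [Finite ι] [P.IsReduced] [P.IsRootSystem] {γ₀ : Gallery N p} {m : ℤ} {j k : ℕ}

theorem IsPosE.galleryDim_fold (hγ : IsIntegralGallery P γ) (h : IsPosE P γ i m j k)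
    (hi : i ∈ b.support) :
    galleryDim P b (γ.fold P i (m + 1) m j k) = galleryDim P b γ + 1 := by
  have h1 := LSGallery.galleryDim_fold hγ.isGallery (h.isFoldData hγ) hi
  have h2 := (h.crossing hγ).2.1
  rwa [if_neg (by omega), if_pos h2, add_zero] at h1

theorem IsPosF.galleryDim_fold (hγ : IsIntegralGallery P γ) (h : IsPosF P γ i m j k)
    (hi : i ∈ b.support) :
    galleryDim P b (γ.fold P i m (m + 1) j k) + 1 = galleryDim P b γ := by
  have h1 := LSGallery.galleryDim_fold hγ.isGallery (h.isFoldData hγ) hi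
  have h2 := (h.crossing hγ).2.1
  rwa [if_pos h2, if_neg (by omega), add_zero] at h1

/-- The absence of dips is used at the joint `k`: the large face following it must not lie below
`H_{α,m}`. -/
theorem IsPosE.positivelyFolded_fold (hγ : IsIntegralGallery P γ) (h : IsPosE P γ i m j k)
    (hi : i ∈ b.support) (hpf : γ ∈ positivelyFolded P b γ₀)
    (hdip : ∀ l ≤ p, 2 * m ≤ llev P γ i l) :
    γ.fold P i (m + 1) m j k ∈ positivelyFolded P b γ₀ := by
  have hf := h.isFoldData hγ
  have hg := hγ.isGallery
  obtain ⟨-, h1, h2⟩ := h.crossing hγ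
  have hpf' := forall_positivelyFolded_iff.1 hpf.2
  have hlt := h.lt
  have hle := h.le
  refine LSGallery.positivelyFolded_fold hpf hf hi (fun l hl => ?_) fun l hl hlp => ?_
  · subst hl
    exact (hpf' l (by omega)).reflect_up hi (hf.left_subset hg) h1
  · subst hl
    exact (hpf' l hlp).reflect_left_down (hg.lg_isFace _) (hg.sm_isFace _)
      (hg.sm_succ_subset hlp.le) hi (hf.right_subset hg) (h2 l rfl) (hdip _ (by omega))

/-- Here the absence of dips is used at the joint `j`, for the large face preceding it. -/
theorem IsPosF.positivelyFolded_fold (hγ : IsIntegralGallery P γ) (h : IsPosF P γ i m j k)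
    (hi : i ∈ b.support) (hpf : γ ∈ positivelyFolded P b γ₀)
    (hdip : ∀ l ≤ p, 2 * m ≤ llev P γ i l) :
    γ.fold P i m (m + 1) j k ∈ positivelyFolded P b γ₀ := by
  have hf := h.isFoldData hγ
  have hg := hγ.isGallery
  obtain ⟨-, h1, h2⟩ := h.crossing hγ
  have hpf' := forall_positivelyFolded_iff.1 hpf.2
  have hlt := h.lt
  have hle := h.le
  refine LSGallery.positivelyFolded_fold hpf hf hi (fun l hl => ?_) fun l hl hlp => ?_
  · subst hl
    exact (hpf' l (by omega)).reflect_down (hg.lg_isFace _) (hg.sm_isFace _)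
      (hg.sm_succ_subset (by omega)) hi (hf.left_subset hg) h1 (hdip _ (by omega))
  · subst hl
    exact (hpf' l hlp).reflect_left_up (hg.lg_isFace _) (hg.sm_isFace _)
      (hg.sm_succ_subset hlp.le) hi (hf.right_subset hg) (h2 l rfl)

/-- Folding up a part below the minimal level increases the dimension, and keeps the target. -/
theorem exists_positivelyFolded_of_dip (hγ : IsIntegralGallery P γ) (hm : IsMinLev P γ i m)
    (hi : i ∈ b.support) (hpf : γ ∈ positivelyFolded P b γ₀) {l : ℕ} (hl : l ≤ p)
    (hlow : llev P γ i l < 2 * m) {ν : N} (hν : γ.small (Fin.last (p + 1)) = {ν}) :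
    ∃ δ ∈ positivelyFolded P b γ₀, δ.small (Fin.last (p + 1)) = {ν} ∧
      galleryDim P b δ = galleryDim P b γ + 1 := by
  obtain ⟨j, k, hf, h1, h2⟩ := hm.exists_fold_dip hγ hl hlow
  have hg := hγ.isGallery
  have hpf' := forall_positivelyFolded_iff.1 hpf.2
  have hlt := hf.lt
  have hle := hf.le
  refine ⟨γ.fold P i m m j k, LSGallery.positivelyFolded_fold hpf hf hi (fun l hl => ?_)
    fun l hl hlp => ?_, ?_, ?_⟩
  · subst hl
    exact (hpf' l (by omega)).reflect_up hi (hf.left_subset hg) h1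
  · subst hl
    exact (hpf' l hlp).reflect_left_up (hg.lg_isFace _) (hg.sm_isFace _)
      (hg.sm_succ_subset hlp.le) hi (hf.right_subset hg) (h2 l rfl)
  · rw [fold_target hν hf, sub_self, zero_smul, add_zero]
  · have := LSGallery.galleryDim_fold hg hf hi
    rwa [if_neg (by omega), if_pos h1, add_zero] at this

end operators

end

noncomputable section

variable {ι M N : Type*} [AddCommGroup M] [Module ℝ M] [AddCommGroup N] [Module ℝ N]
variable {P : RootPairing ι ℝ M N} {b : P.Base} {p : ℕ} {γ : Gallery N p} {lam : N}

/-! ### Minimal galleries -/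

/-- For `c` even, a large face of level `c` has all its faces at level `c`, so a gallery can leave
this level only when passing from a small to a large face. -/
theorem IncidentSeq.exists_leave {a b : ℕ → ℤ} (h : IncidentSeq p a b) {c : ℤ} {t : ℕ}
    (ht : t ≤ p + 1) (ha : a t = c) (hlast : a (p + 1) ≠ c) (hc : c % 2 = 0) :
    ∃ s, t ≤ s ∧ s ≤ p ∧ a s = c ∧ b s ≠ c := by
  by_contra! H
  have : ∀ s, t ≤ s → s ≤ p + 1 → a s = c := fun s hs => by
    induction s, hs using Nat.le_induction with
    | base => exact fun _ => ha
    | succ s hs ih =>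
      intro hs'
      have h1 := H s hs (by omega) (ih (by omega))
      have h2 := (h s (by omega)).2
      unfold Incident at h2
      omega
  exact hlast (this _ ht le_rfl)

/-- With respect to all positive roots, the levels increase along the gallery. -/
def IsMonotoneGallery (P : RootPairing ι ℝ M N) (b : P.Base) (γ : Gallery N p) : Prop :=
  ∀ i, b.IsPos i → ∀ l ≤ p, slev P γ i l ≤ llev P γ i l ∧ llev P γ i l ≤ slev P γ i (l + 1)

theorem IsMonotoneGallery.slev_mono (h : IsMonotoneGallery P b γ) {i : ι} (hi : b.IsPos i)
    {l l' : ℕ} (hl : l ≤ l') (hl' : l' ≤ p + 1) : slev P γ i l ≤ slev P γ i l' := by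
  induction l', hl using Nat.le_induction with
  | base => exact le_rfl
  | succ l' hl ih =>
    have := h i hi l' (by omega)
    exact (ih (by omega)).trans (this.1.trans this.2)

theorem mem_wallsAt_iff (h : IsGallery P γ) {i : ι} {m : ℤ} {j : Fin (p + 1)} :
    (i, m) ∈ wallsAt P b γ j ↔ b.IsPos i ∧ slev P γ i j = 2 * m ∧ llev P γ i j ≠ 2 * m := by
  unfold wallsAt
  rw [Set.mem_ofPred_eq, γ.small_eq_sm, γ.large_eq_lg, (h.sm_isFace _).subset_wall_iff,
    (h.lg_isFace _).subset_wall_iff]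
  rfl

theorem mem_separatingWalls_iff (h : IsGallery P γ) (ht : γ.small (Fin.last (p + 1)) = {lam})
    (hdom : lam ∈ dominantChamber P b) {i : ι} {m : ℤ} :
    (i, m) ∈ separatingWalls P b {0} {lam} ↔
      b.IsPos i ∧ 0 ≤ m ∧ 2 * m < slev P γ i (p + 1) := by
  have hf : IsFace P {lam} := by
    have := h.sm_isFace (p + 1)
    rwa [← Gallery.small_last_eq, ht] at this
  unfold separatingWalls
  rw [Set.mem_ofPred_eq]
  refine and_congr_right fun hi => ?_
  dsimp only
  have hpos : 0 ≤ slev P γ i (p + 1) := by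
    rw [h.slev_target ht]
    have := two_mul_le_lev (r := P.root' i lam) (m := 0)
    rw [mul_zero] at this
    exact this.2 (by exact_mod_cast hdom i hi)
  rw [hf.separates_iff, faceLevel_singleton hf, ← h.slev_target ht]
  simp only [Set.singleton_subset_iff, lower, upper, Set.mem_ofPred_eq, map_zero]
  rw [show ((0 : ℝ) ≤ m ↔ 0 ≤ m) from by norm_cast, show ((m : ℝ) ≤ 0 ↔ m ≤ 0) from by norm_cast]
  omega

theorem IsMinimalGallery.slev_zero (h : IsMinimalGallery P b lam γ) (i : ι) :
    slev P γ i 0 = 0 := by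
  have hf := h.isGallery.sm_isFace 0
  have hs := h.source
  rw [Gallery.small_zero_eq] at hs
  rw [hs] at hf
  rw [slev, hs, faceLevel_singleton hf, map_zero]
  simp [lev]

/-- A wall left at some position is left only once, and it must be one of those separating `0` from
`lam`. A descent would make the gallery leave some wall twice, or leave a wall that does not
separate. -/
theorem IsMinimalGallery.isMonotone (h : IsMinimalGallery P b lam γ)
    (hdom : lam ∈ dominantChamber P b) (hint : ∀ i, ∃ n : ℤ, P.root' i lam = n) :
    IsMonotoneGallery P b γ := by
  intro i hi
  have hseq := h.isGallery.incidentSeq i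
  have h0 := h.slev_zero i
  have hsep : ∀ l ≤ p, ∀ m : ℤ, slev P γ i l = 2 * m → llev P γ i l ≠ 2 * m →
      0 ≤ m ∧ 2 * m < slev P γ i (p + 1) := by
    intro l hl m h1 h2
    have hmem : (i, m) ∈ ⋃ j, wallsAt P b γ j :=
      Set.mem_iUnion.2 ⟨⟨l, by omega⟩, (mem_wallsAt_iff h.isGallery).2 ⟨hi, h1, h2⟩⟩
    rw [h.walls_union, mem_separatingWalls_iff h.isGallery h.target hdom] at hmem
    exact hmem.2
  have hdisj : ∀ l ≤ p, ∀ l' ≤ p, l ≠ l' → ∀ m : ℤ, slev P γ i l = 2 * m → llev P γ i l ≠ 2 * m →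
      slev P γ i l' = 2 * m → llev P γ i l' = 2 * m := by
    intro l hl l' hl' hne m h1 h2 h3
    by_contra h4
    exact Set.disjoint_left.1 (h.walls_disjoint (i := ⟨l, by omega⟩) (j := ⟨l', by omega⟩)
      (by simpa using hne)) ((mem_wallsAt_iff h.isGallery).2 ⟨hi, h1, h2⟩)
      ((mem_wallsAt_iff h.isGallery).2 ⟨hi, h3, h4⟩)
  obtain ⟨n, hn⟩ : ∃ n, slev P γ i (p + 1) = 2 * n := by
    obtain ⟨n, hn⟩ := hint i
    exact ⟨n, by rw [h.isGallery.slev_target h.target, lev_eq_two_mul, hn]⟩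
  have hn0 : 0 ≤ n := by
    have h1 := two_mul_le_lev (r := P.root' i lam) (m := 0)
    rw [← h.isGallery.slev_target h.target, hn] at h1
    have := h1.2 (by exact_mod_cast hdom i hi)
    omega
  intro l hl
  have hinc := hseq l hl
  constructor
  · by_contra! hlt
    obtain ⟨m, hm⟩ : ∃ m, slev P γ i l = 2 * m := by
      have := hinc.1
      unfold Incident at this
      exact ⟨slev P γ i l / 2, by omega⟩
    have h1 := hsep l hl m hm (by omega)
    -- The gallery went below `H_{i,m}` but ends above it, so it returns to this wall and leaves it
    -- a second time.
    obtain ⟨t, ht1, ht2, ht3, -⟩ := hseq.exists_first_ge (n := m) (l := l) (k := p + 1) (by omega)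
      le_rfl (by omega) (by omega)
    obtain ⟨s, hs1, hs2, hs3, hs4⟩ := hseq.exists_leave ht2 ht3 (by omega) (by omega)
    exact hs4 (hdisj l hl s hs2 (by omega) m hm (by omega) hs3)
  · by_contra! hlt
    obtain ⟨m, hm⟩ : ∃ m, slev P γ i (l + 1) = 2 * m := by
      have := hinc.2
      unfold Incident at this
      exact ⟨slev P γ i (l + 1) / 2, by omega⟩
    -- The descent back to `H_{i,m}` shows that this wall was left upwards before. If `m = n` the
    -- wall contains `lam` and does not separate; otherwise it is left again.
    by_cases hmn : m = n
    · obtain ⟨t, ht1, ht2, ht3, ht4, ht5⟩ := hseq.exists_last_le (n := m) (Nat.zero_le l) hl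
        (by omega) (by omega)
      have := ht5 t le_rfl ht2
      have := hsep t (by omega) m ht3 (by omega)
      omega
    · obtain ⟨s, hs1, hs2, hs3, hs4⟩ := hseq.exists_leave (t := l + 1) (by omega) hm (by omega)
        (by omega)
      have h0m := hsep s hs2 m hs3 hs4
      obtain ⟨t, ht1, ht2, ht3, ht4, ht5⟩ := hseq.exists_last_le (n := m) (Nat.zero_le l) hl
        (by omega) (by omega)
      have := ht5 t le_rfl ht2
      exact hs4 (hdisj t (by omega) s hs2 (by omega) m ht3 (by omega) hs3)

theorem IsMonotoneGallery.isMinimal (hmono : IsMonotoneGallery P b γ) (h : IsGallery P γ)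
    (hs : γ.small 0 = {0}) (ht : γ.small (Fin.last (p + 1)) = {lam})
    (hdim : ∀ j, faceDim (γ.large j) = Module.finrank ℝ (orthSubspace P lam))
    (hdom : lam ∈ dominantChamber P b) : IsMinimalGallery P b lam γ := by
  have hs0 : ∀ i, slev P γ i 0 = 0 := fun i => by
    have hf := h.sm_isFace 0
    rw [Gallery.small_zero_eq] at hs
    rw [hs] at hf
    rw [slev, hs, faceLevel_singleton hf, map_zero]
    simp [lev]
  have key : ∀ j k : Fin (p + 1), j < k → Disjoint (wallsAt P b γ j) (wallsAt P b γ k) := by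
    intro j k hjk
    rw [Set.disjoint_left]
    rintro ⟨i, m⟩ h1 h2
    rw [mem_wallsAt_iff h] at h1 h2
    have h3 := hmono i h1.1 j (by omega)
    have h4 := hmono.slev_mono h1.1 (l := j + 1) (l' := k) (Nat.succ_le_of_lt hjk) (by omega)
    omega
  refine ⟨h, hs, ht, hdim, fun j k hjk => ?_, ?_⟩
  · rcases lt_or_gt_of_ne hjk with h1 | h1
    · exact key j k h1
    · exact (key k j h1).symm
  · ext ⟨i, m⟩
    rw [mem_separatingWalls_iff h ht hdom, Set.mem_iUnion]
    constructor
    · rintro ⟨j, hj⟩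
      obtain ⟨hi, h1, h2⟩ := (mem_wallsAt_iff h).1 hj
      have h3 := hmono i hi j (by omega)
      have h4 := hmono.slev_mono hi (l := j + 1) (l' := p + 1) (by omega) le_rfl
      have h5 := hmono.slev_mono hi (l := 0) (l' := j) (by omega) (by omega)
      rw [hs0] at h5
      exact ⟨hi, by omega, by omega⟩
    · rintro ⟨hi, h1, h2⟩
      have hseq := h.incidentSeq i
      by_cases hp : 2 * m < llev P γ i p
      · obtain ⟨t, -, ht2, ht3, -, ht5⟩ := hseq.exists_last_le (n := m) (Nat.zero_le p) le_rfl
          (by rw [hs0]; omega) hp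
        have := ht5 t le_rfl ht2
        exact ⟨⟨t, by omega⟩, (mem_wallsAt_iff h).2 ⟨hi, ht3, by dsimp only; omega⟩⟩
      · have := (hseq p le_rfl).2
        unfold Incident at this
        omega

theorem IsMinimalGallery.isIntegral (h : IsMinimalGallery P b lam γ)
    (hint : ∀ i, ∃ n : ℤ, P.root' i lam = n) : IsIntegralGallery P γ :=
  ⟨h.isGallery, h.source, lam, h.target, hint⟩

/-! ### The half-sum of the positive roots -/

section rho

variable [Finite ι]

variable (b) in
/-- The finite set of indices of positive roots. -/
def posRoots : Finset ι := (Set.toFinite {i | b.IsPos i}).toFinset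

theorem mem_posRoots {i : ι} : i ∈ posRoots b ↔ b.IsPos i := by simp [posRoots]

theorem rho_apply (x : N) :
    P.toLinearMap (rho P b) x = 1 / 2 * ∑ i ∈ posRoots b, P.root' i x := by
  rw [rho, finsum_mem_eq_finite_toFinset_sum _ (Set.toFinite _), map_smul, map_sum,
    LinearMap.smul_apply, LinearMap.sum_apply, smul_eq_mul]
  rfl

theorem rho_coroot [P.IsCrystallographic] [P.IsReduced] {α : ι} (hα : α ∈ b.support) :
    P.toLinearMap (rho P b) (P.coroot α) = 1 := by
  classical
  have hmem : α ∈ posRoots b := mem_posRoots.2 (RootPairing.Base.isPos_of_mem_support hα)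
  have hneg : ∀ i, P.pairing (P.reflectionPerm α i) α = -P.pairing i α := fun i => by
    rw [← P.root'_coroot_eq_pairing, root'_reflectionPerm, P.root'_coroot_eq_pairing,
      P.root'_coroot_eq_pairing, P.pairing_same]
    ring
  have hzero : ∑ i ∈ (posRoots b).erase α, P.pairing i α = 0 := by
    -- The simple reflection permutes the remaining positive roots and negates their pairing with
    -- the coroot, so the terms cancel.
    refine Finset.sum_involution (fun i _ => P.reflectionPerm α i) (fun i _ => by rw [hneg]; ring)
      (fun i _ h1 h2 => h1 ?_) (fun i hi => ?_) fun i _ => P.reflectionPerm_self α i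
    · have := hneg i
      rw [h2] at this
      linarith
    · rw [Finset.mem_erase, mem_posRoots] at hi ⊢
      exact (reflectionPerm_isPos_and_ne hα hi.symm).symm
  rw [rho_apply]
  simp only [P.root'_coroot_eq_pairing]
  rw [← Finset.add_sum_erase _ _ hmem, hzero, P.pairing_same]
  norm_num

/-- For each positive root `i` the walls with `0 ≤ m < ⟨ν, i⟩` are each load-bearing exactly once,
so the dimension is the sum of the `⟨ν, i⟩`, which is `2 ⟨ν, ρ⟩`. -/
theorem IsMonotoneGallery.galleryDim_eq [P.IsRootSystem] (hmono : IsMonotoneGallery P b γ)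
    (hγ : IsIntegralGallery P γ) {ν : N} (hν : γ.small (Fin.last (p + 1)) = {ν}) :
    (galleryDim P b γ : ℝ) = P.toLinearMap (rho P b) (ν + ν) := by
  classical
  have hg := hγ.isGallery
  have h1 : galleryDim P b γ = ∑ i ∈ posRoots b, ((Finset.range (p + 1)).filter fun l =>
      slev P γ i l % 2 = 0 ∧ slev P γ i l < llev P γ i l).card := by
    rw [galleryDim_eq_sum hg]
    have : ∀ l, (loadBearing b (γ.sm l) (γ.lg l)).ncard =
        ((posRoots b).filter fun i => slev P γ i l % 2 = 0 ∧ slev P γ i l < llev P γ i l).card :=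
      fun l => by
        rw [← Set.ncard_coe_finset]
        congr 1
        ext i
        simp only [Finset.coe_filter, Set.mem_ofPred_eq, mem_posRoots, loadBearing]
        rfl
    simp only [this, Finset.card_filter]
    exact Finset.sum_comm
  -- The walls left before reaching the small face at `L` are counted by half its level, rounded up.
  have h2 : ∀ i ∈ posRoots b, ∀ L ≤ p + 1, ((((Finset.range L).filter fun l =>
      slev P γ i l % 2 = 0 ∧ slev P γ i l < llev P γ i l).card : ℕ) : ℤ) =
      (slev P γ i L + 1) / 2 := by
    intro i hi L
    induction L with
    | zero => intro _; rw [hγ.slev_zero]; simp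
    | succ L ih =>
      intro hL
      have ih := ih (by omega)
      have hm := hmono i (mem_posRoots.1 hi) L (by omega)
      have hinc := hg.incidentSeq i L (by omega)
      unfold Incident at hinc
      rw [Finset.range_add_one, Finset.filter_insert]
      split_ifs with hc
      · rw [Finset.card_insert_of_notMem (by simp)]
        push_cast
        omega
      · omega
  rw [h1, rho_apply]
  push_cast
  rw [Finset.mul_sum]
  refine Finset.sum_congr rfl fun i hi => ?_
  have h3 := h2 i hi (p + 1) le_rfl
  obtain ⟨n, hn⟩ := hγ.slev_last i
  have hn' : P.root' i ν = n := by
    rw [← lev_eq_two_mul, ← hg.slev_target hν, hn]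
  rw [map_add, hn']
  have : ((((Finset.range (p + 1)).filter fun l =>
      slev P γ i l % 2 = 0 ∧ slev P γ i l < llev P γ i l).card : ℕ) : ℤ) = n := by omega
  have : ((((Finset.range (p + 1)).filter fun l =>
      slev P γ i l % 2 = 0 ∧ slev P γ i l < llev P γ i l).card : ℕ) : ℝ) = n := by
    exact_mod_cast this
  rw [this]; ring

end rho

/-! ### Positively folded galleries in the dominant chamber -/

theorem SameType.refl (F : Set N) : SameType P F F := ⟨1, one_mem _, by simp⟩

theorem SameType.eq_of_not_separated [Finite ι] [P.IsRootSystem] [P.IsCrystallographic]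
    [P.IsReduced] (b : P.Base) {E F : Set N} (h : SameType P E F) (hE : IsFace P E)
    (hsep : ∀ i (m : ℤ), faceLevel P E i < 2 * m → ¬ 2 * m < faceLevel P F i) : F = E := by
  obtain ⟨w, hw, rfl⟩ := h
  obtain ⟨x, rfl⟩ := hE
  have haut : IsAut P w := IsAut.of_mem_affineWeylGroup hw
  rw [haut.image_faceOf] at hsep ⊢
  simp only [faceLevel_faceOf] at hsep
  rw [eq_of_forall_not_separated b hw fun i m h1 h2 => ?_]
  refine hsep i m ?_ ?_
  · rwa [← not_le, two_mul_le_lev, not_le]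
  · rwa [← not_le, lev_le_two_mul, not_le]

theorem levelMinimal_of_monotone {E F' F : Set N}
    (h : ∀ i, (faceLevel P E i ≤ faceLevel P F' i ∧ faceLevel P F' i ≤ faceLevel P F i) ∨
      (faceLevel P F' i ≤ faceLevel P E i ∧ faceLevel P F i ≤ faceLevel P F' i)) :
    LevelMinimal P E F' F := by
  intro i m h1 h2
  rcases h i with h | h <;> omega

theorem positivelyFolded_of_levelMinimal [P.IsRootSystem] (hγ : IsIntegralGallery P γ)
    {γ₀ : Gallery N p} (ht : γ ∈ galleriesOfType P γ₀)
    (h : ∀ l < p, LevelMinimal P (γ.lg l) (γ.sm (l + 1)) (γ.lg (l + 1))) :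
    γ ∈ positivelyFolded P b γ₀ := by
  have hg := hγ.isGallery
  refine ⟨ht, forall_positivelyFolded_iff.2 fun l hl => ?_⟩
  rw [positivelyFoldedAt_iff (hg.lg_isFace _) (hg.sm_isFace _) (hg.sm_succ_subset hl.le)]
  exact ⟨_, hg.lg_isFace _, hg.sm_subset (by omega), h l hl, .refl⟩

theorem slev_opp (i : ι) (l : ℕ) : slev P γ (opp P i) l = -slev P γ i l := faceLevel_opp _ _

theorem llev_opp (i : ι) (l : ℕ) : llev P γ (opp P i) l = -llev P γ i l := faceLevel_opp _ _

theorem IsIntegralGallery.mem_galleriesOfType_self (hγ : IsIntegralGallery P γ) :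
    γ ∈ galleriesOfType P γ :=
  ⟨hγ.isGallery, hγ.source, fun _ => SameType.refl _, fun _ => SameType.refl _⟩

theorem IsMonotoneGallery.mem_positivelyFolded [P.IsRootSystem] (hmono : IsMonotoneGallery P b γ)
    (hγ : IsIntegralGallery P γ) : γ ∈ positivelyFolded P b γ := by
  refine positivelyFolded_of_levelMinimal hγ hγ.mem_galleriesOfType_self fun l hl =>
    levelMinimal_of_monotone fun i => ?_
  change (llev P γ i l ≤ slev P γ i (l + 1) ∧ slev P γ i (l + 1) ≤ llev P γ i (l + 1)) ∨
    (slev P γ i (l + 1) ≤ llev P γ i l ∧ llev P γ i (l + 1) ≤ slev P γ i (l + 1))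
  by_cases hi : b.IsPos i
  · exact Or.inl ⟨(hmono i hi l hl.le).2, (hmono i hi (l + 1) hl).1⟩
  · have h1 := (hmono _ (isPos_opp.2 hi) l hl.le).2
    have h2 := (hmono _ (isPos_opp.2 hi) (l + 1) hl).1
    rw [slev_opp, llev_opp] at h1 h2
    omega

theorem IsMonotoneGallery.level_eq_zero (hmono : IsMonotoneGallery P b γ)
    (hγ : IsIntegralGallery P γ) (ht : γ.small (Fin.last (p + 1)) = {lam}) {i : ι}
    (hi : P.root' i lam = 0) :
    (∀ l ≤ p + 1, slev P γ i l = 0) ∧ ∀ l ≤ p, llev P γ i l = 0 := by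
  have main : ∀ i, b.IsPos i → P.root' i lam = 0 →
      (∀ l ≤ p + 1, slev P γ i l = 0) ∧ ∀ l ≤ p, llev P γ i l = 0 := by
    intro i hi h0
    have h1 : slev P γ i (p + 1) = 0 := by
      rw [hγ.isGallery.slev_target ht, h0]; simp [lev]
    have h2 : ∀ l ≤ p + 1, slev P γ i l = 0 := fun l hl => by
      have h3 := hmono.slev_mono hi (Nat.zero_le l) hl
      have h4 := hmono.slev_mono hi hl le_rfl
      rw [hγ.slev_zero] at h3
      omega
    refine ⟨h2, fun l hl => ?_⟩
    have h3 := hmono i hi l hl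
    have h4 := h2 l (by omega)
    have h5 := h2 (l + 1) (by omega)
    omega
  by_cases hp : b.IsPos i
  · exact main i hp hi
  · have := main _ (isPos_opp.2 hp) (by rw [root'_opp, hi, neg_zero])
    simpa only [slev_opp, llev_opp, neg_eq_zero] using this

/-- By the dimension condition the directions of a large face fill `orthSubspace P lam`, which
contains `lam`. A root constant on the face therefore vanishes on `lam`. -/
theorem IsMinimalGallery.root'_eq_zero_of_even [Finite ι] [P.IsRootSystem]
    (h : IsMinimalGallery P b lam γ) (hmono : IsMonotoneGallery P b γ)
    (hγ : IsIntegralGallery P γ) {l : ℕ} (hl : l ≤ p) {i : ι} {m : ℤ}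
    (hm : llev P γ i l = 2 * m) : P.root' i lam = 0 := by
  have hfd : FiniteDimensional ℝ N := Module.Finite.of_basis b.toCoweightBasis
  have hf := h.isGallery.lg_isFace l
  have hle : vectorSpan ℝ (γ.lg l) ≤ orthSubspace P lam := by
    refine Submodule.span_le.2 ?_
    rintro _ ⟨x, hx, y, hy, rfl⟩
    simp only [orthSubspace, SetLike.mem_coe, Submodule.mem_iInf, LinearMap.mem_ker]
    intro r hr
    have hw : γ.lg l ⊆ wall P r 0 :=
      hf.subset_wall_iff.2 (((hmono.level_eq_zero hγ h.target hr).2 l hl).trans (by simp))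
    have h1 : P.root' r x = _ := hw hx
    have h2 : P.root' r y = _ := hw hy
    rw [vsub_eq_sub, map_sub, h1, h2, sub_self]
  have heq : vectorSpan ℝ (γ.lg l) = orthSubspace P lam :=
    Submodule.eq_of_le_of_finrank_eq hle (h.large_dim _)
  have hker : vectorSpan ℝ (γ.lg l) ≤ LinearMap.ker (P.root' i) := by
    refine Submodule.span_le.2 ?_
    rintro _ ⟨x, hx, y, hy, rfl⟩
    have hw : γ.lg l ⊆ wall P i m := hf.subset_wall_iff.2 hm
    have h1 : P.root' i x = m := hw hx
    have h2 : P.root' i y = m := hw hy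
    show P.root' i (x - y) = 0
    rw [map_sub, h1, h2, sub_self]
  have hlam : lam ∈ orthSubspace P lam := by
    simp only [orthSubspace, Submodule.mem_iInf, LinearMap.mem_ker]
    exact fun r hr => hr
  rw [← heq] at hlam
  exact LinearMap.mem_ker.1 (hker hlam)

variable [Finite ι] [P.IsCrystallographic]

theorem faceLevel_nonneg_of_simple {F : Set N} (hF : IsFace P F)
    (h : ∀ i ∈ b.support, 0 ≤ faceLevel P F i) {i : ι} (hi : b.IsPos i) : 0 ≤ faceLevel P F i := by
  obtain ⟨x, rfl⟩ := hF
  have e : ∀ i, 0 ≤ faceLevel P (faceOf P x) i ↔ 0 ≤ P.root' i x := fun i => by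
    have := two_mul_le_lev (r := P.root' i x) (m := 0)
    rw [faceLevel_faceOf]
    simpa using this
  rw [e]
  exact root'_nonneg_of_simple (fun i hi => (e i).1 (h i hi)) hi

variable [P.IsReduced] [P.IsRootSystem]

/-- Positive reflections at `F'` preserve the dominance of a face with respect to the roots that are
positive on `lam`, provided the reflecting roots vanish on `lam`. -/
theorem level_ge_of_reflTransGen {F' Ω F : Set N} (hdom : lam ∈ dominantChamber P b)
    (hF' : IsFace P F') (hΩ : IsFace P Ω)
    (hΩge : ∀ i, b.IsPos i → 0 < P.root' i lam → ∀ m, faceLevel P F' i = 2 * m →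
      2 * m ≤ faceLevel P Ω i)
    (h : Relation.ReflTransGen (PositiveReflection P b F') Ω F) :
    ∀ i, b.IsPos i → 0 < P.root' i lam → ∀ m, faceLevel P F' i = 2 * m →
      2 * m ≤ faceLevel P F i := by
  induction h with
  | refl => exact hΩge
  | @tail X Y hX hXY ih =>
    have hXf := isFace_of_reflTransGen hX hΩ
    obtain ⟨β, m', hβ, hw, rfl, hlt⟩ := (positiveReflection_iff hXf).1 hXY
    intro i hi hpos m hm
    -- Otherwise the induction hypothesis puts `X` on or above the reflecting wall, and the
    -- reflection would not be positive.
    have hβ0 : P.root' β lam = 0 := by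
      refine le_antisymm (not_lt.1 fun hlt' => ?_) (hdom β hβ)
      have := ih β hβ hlt' m' (hF'.subset_wall_iff.1 hw)
      omega
    have hr : P.root' (P.reflectionPerm β i) lam = P.root' i lam := by
      rw [root'_reflectionPerm, hβ0, mul_zero, sub_zero]
    -- The reflected root still has a positive value on the dominant `lam`, so it cannot be
    -- negative.
    have hrpos : b.IsPos (P.reflectionPerm β i) := by
      by_contra hneg
      have := hdom _ (isPos_opp.2 hneg)
      rw [root'_opp, hr] at this
      linarith
    have e1 := faceLevel_affRefl_image hF' β i m'
    rw [affRefl_image_eq_self hw, hm] at e1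
    have e2 := ih _ hrpos (by rwa [hr]) (m - m' * P.pairingIn ℤ i β) (by omega)
    rw [faceLevel_affRefl_image hXf]
    omega

/-- A positively folded gallery that stays in the dominant chamber is the minimal one. -/
theorem IsMinimalGallery.eq_of_dominant (h : IsMinimalGallery P b lam γ)
    (hdom : lam ∈ dominantChamber P b) (hint : ∀ i, ∃ n : ℤ, P.root' i lam = n)
    {δ : Gallery N p} (hδ : δ ∈ positivelyFolded P b γ)
    (hδdom : ∀ i ∈ b.support, ∀ l ≤ p, 0 ≤ llev P δ i l) : δ = γ := by
  have hmono := h.isMonotone hdom hint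
  have hγ := h.isIntegral hint
  have hδi := isIntegralGallery_of_mem hγ hδ.1
  have hg := hγ.isGallery
  have hd := hδi.isGallery
  have hpf := forall_positivelyFolded_iff.1 hδ.2
  have tsm : ∀ l, SameType P (γ.sm l) (δ.sm l) := fun l => hδ.1.2.2.1 _
  have tlg : ∀ l, SameType P (γ.lg l) (δ.lg l) := fun l => hδ.1.2.2.2 _
  have dom : ∀ l ≤ p, ∀ i, b.IsPos i → 0 ≤ llev P δ i l := fun l hl i hi =>
    faceLevel_nonneg_of_simple (hd.lg_isFace l) (fun i hi => hδdom i hi l hl) hi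
  -- For both faces the level is `2 c` or `2 c + 1`, so no wall strictly separates them. Having the
  -- same type, they coincide.
  have sep_of_pos : ∀ l, (∀ i, b.IsPos i → ∃ c : ℤ, (llev P γ i l = 2 * c ∨ llev P γ i l = 2 * c + 1) ∧
      (llev P δ i l = 2 * c ∨ llev P δ i l = 2 * c + 1)) → δ.lg l = γ.lg l := by
    intro l H
    refine (tlg l).eq_of_not_separated b (hg.lg_isFace l) fun i m h1 h2 => ?_
    change llev P γ i l < _ at h1
    change _ < llev P δ i l at h2
    by_cases hi : b.IsPos i
    · obtain ⟨c, h3, h4⟩ := H i hi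
      omega
    · obtain ⟨c, h3, h4⟩ := H _ (isPos_opp.2 hi)
      rw [llev_opp] at h3 h4
      omega
  have hsm0 : δ.sm 0 = γ.sm 0 := by
    rw [← Gallery.small_zero_eq, ← Gallery.small_zero_eq, hγ.source, hδi.source]
  have hlg0 : δ.lg 0 = γ.lg 0 := by
    -- Both first large faces contain the origin and are dominant, so their levels for positive
    -- roots are `0` or `1`.
    refine sep_of_pos 0 fun i hi => ⟨0, ?_, ?_⟩
    · have h1 := (hg.incidentSeq i 0 (by omega)).1
      have h2 := (hmono i hi 0 (by omega)).1
      rw [hγ.slev_zero] at h1 h2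
      unfold Incident at h1
      omega
    · have h1 := (hd.incidentSeq i 0 (by omega)).1
      have h2 := dom 0 (by omega) i hi
      rw [hδi.slev_zero] at h1
      unfold Incident at h1
      omega
  have hsm_succ : ∀ l ≤ p, δ.lg l = γ.lg l → δ.sm (l + 1) = γ.sm (l + 1) := by
    intro l hl heq
    refine (tsm (l + 1)).eq_of_not_separated b (hg.sm_isFace _) fun i m h1 h2 => ?_
    have i1 := (hg.incidentSeq i l hl).2
    have i2 := (hd.incidentSeq i l hl).2
    change slev P γ i (l + 1) < _ at h1
    change _ < slev P δ i (l + 1) at h2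
    have e : llev P δ i l = llev P γ i l := by rw [llev, heq, llev]
    unfold Incident at i1 i2
    omega
  have hlg_succ : ∀ l < p, δ.lg l = γ.lg l → δ.sm (l + 1) = γ.sm (l + 1) →
      δ.lg (l + 1) = γ.lg (l + 1) := by
    intro l hl heq heq'
    have hpfl := hpf l hl
    rw [positivelyFoldedAt_iff (hd.lg_isFace _) (hd.sm_isFace _) (hd.sm_succ_subset hl.le), heq,
      heq'] at hpfl
    obtain ⟨Ω, hΩ, -, hmin, hch⟩ := hpfl
    -- If `Ω` went below a wall through the small face for a root positive on `lam`, minimality and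
    -- monotonicity would place the preceding large face inside that wall, against
    -- `root'_eq_zero_of_even`.
    have hge := level_ge_of_reflTransGen hdom (hg.sm_isFace (l + 1)) hΩ (fun i hi hpos m hm => by
      by_contra! hlt
      have h1 := hmin (opp P i) (-m) (by rw [faceLevel_opp]; omega) (by rw [faceLevel_opp]; omega)
      rw [faceLevel_opp] at h1
      have h2 := (hmono i hi l hl.le).2
      have h3 : llev P γ i l = 2 * m := by
        change slev P γ i (l + 1) = _ at hm
        change -llev P γ i l ≤ _ at h1
        omega
      exact hpos.ne' (h.root'_eq_zero_of_even hmono hγ hl.le h3)) hch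
    refine sep_of_pos (l + 1) fun i hi => ?_
    have i1 := (hg.incidentSeq i (l + 1) hl).1
    have i2 := (hd.incidentSeq i (l + 1) hl).1
    have e : slev P δ i (l + 1) = slev P γ i (l + 1) := by rw [slev, heq', slev]
    have hm1 := (hmono i hi (l + 1) hl).1
    -- Dominance settles the roots vanishing on `lam`, and `hge` the others. So the next face of
    -- `δ`, like that of `γ`, lies on the upper side of every positive wall through the common small
    -- face.
    have hδge : slev P γ i (l + 1) % 2 = 0 → slev P γ i (l + 1) ≤ llev P δ i (l + 1) := by
      intro hev
      rcases (hdom i hi).eq_or_lt with h0 | h0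
      · rw [(hmono.level_eq_zero hγ h.target h0.symm).1 _ (by omega)]
        exact dom _ hl i hi
      · have := hge i hi h0 (slev P γ i (l + 1) / 2) (by
          change slev P γ i (l + 1) = _
          omega)
        change _ ≤ llev P δ i (l + 1) at this
        omega
    unfold Incident at i1 i2
    refine ⟨slev P γ i (l + 1) / 2, ?_, ?_⟩ <;> omega
  have hlg : ∀ l ≤ p, δ.lg l = γ.lg l := by
    intro l
    induction l with
    | zero => exact fun _ => hlg0
    | succ l ih =>
      intro hl
      have := ih (by omega)
      exact hlg_succ l hl this (hsm_succ l (by omega) this)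
  refine Gallery.eq_of_sm_lg (fun l hl => ?_) hlg
  rcases l with _ | l
  · exact hsm0
  · exact hsm_succ l (by omega) (hlg l (by omega))

end

noncomputable section

variable {ι M N : Type*} [AddCommGroup M] [Module ℝ M] [AddCommGroup N] [Module ℝ N]
variable {P : RootPairing ι ℝ M N} {b : P.Base} {p : ℕ} {γ γ₀ δ δ' : Gallery N p} {lam ν : N} {i : ι}

/-! ### The dimension bound -/

theorem IsMinLev.exists_isPosE (hγ : IsIntegralGallery P γ) {m : ℤ} (hm : IsMinLev P γ i m)
    (hneg : m ≤ -1) : ∃ j k, IsPosE P γ i m j k := by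
  classical
  have hseq := hγ.isGallery.incidentSeq i
  have h0 := hγ.slev_zero i
  obtain ⟨hk1, hk2⟩ := Nat.find_spec hm.1
  have hk3 : ∀ l < Nat.find hm.1, slev P γ i l ≠ 2 * m := fun l hl h =>
    Nat.find_min hm.1 hl ⟨by omega, h⟩
  set k := Nat.find hm.1
  obtain ⟨l, hl⟩ : ∃ l, k = l + 1 := ⟨k - 1, by
    have : k ≠ 0 := fun h => by rw [h, h0] at hk2; omega
    omega⟩
  have hlev : llev P γ i l < 2 * (m + 1) := by
    have h1 := (hseq l (by omega)).2
    rw [← hl] at h1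
    unfold Incident at h1
    omega
  obtain ⟨t, ht1, ht2, ht3, ht4, ht5⟩ := hseq.exists_last_ge (n := m + 1) (Nat.zero_le l) (by omega)
    (by omega) hlev
  refine ⟨t, k, hm, hneg, by omega, hk1, hk2, hk3, ht3, fun s hs1 hs2 => ?_⟩
  rcases hs2.eq_or_lt with rfl | hs2
  · omega
  · exact (ht4 s hs1 (by omega)).ne

theorem RootESeq.append_singleton {s : List ι} (h : RootE P i γ δ) (h' : RootESeq P s δ δ') :
    RootESeq P (s ++ [i]) γ δ' := by
  induction s generalizing δ' with
  | nil => exact ⟨γ, rfl, h'.subst h⟩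
  | cons r s ih =>
    obtain ⟨γ', h1, h2⟩ := h'
    exact ⟨γ', ih h1, h2⟩

variable [Finite ι] [P.IsRootSystem]

/-- A crude bound, needed only to make the descending induction on the dimension stop. -/
theorem galleryDim_le (h : IsGallery P γ) : galleryDim P b γ ≤ (p + 1) * Nat.card ι := by
  rw [galleryDim_eq_sum h]
  refine (Finset.sum_le_card_nsmul _ _ (Nat.card ι) fun l _ => ?_).trans (by simp)
  exact Set.ncard_le_card _

variable [P.IsCrystallographic] [P.IsReduced]

theorem IsPosE.rho_target {m : ℤ} {j k : ℕ} (hγ : IsIntegralGallery P γ)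
    (h : IsPosE P γ i m j k) (hi : i ∈ b.support) (hν : γ.small (Fin.last (p + 1)) = {ν}) :
    (γ.fold P i (m + 1) m j k).small (Fin.last (p + 1)) = {ν + P.coroot i} ∧
      P.toLinearMap (rho P b) (lam + (ν + P.coroot i)) = P.toLinearMap (rho P b) (lam + ν) + 1 := by
  constructor
  · rw [fold_target hν (h.isFoldData hγ)]
    congr 2
    simp
  · rw [← add_assoc, map_add _ (lam + ν), rho_coroot hi]

/-- Here `n` measures how far the dimension is from the crude bound. Each case either raises the
dimension by one or ends at `γ₀`. -/
theorem IsMinimalGallery.galleryDim_le_aux (h : IsMinimalGallery P b lam γ₀)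
    (hdom : lam ∈ dominantChamber P b) (hint : ∀ i, ∃ n : ℤ, P.root' i lam = n) (n : ℕ)
    (hδ : δ ∈ positivelyFolded P b γ₀) (hν : δ.small (Fin.last (p + 1)) = {ν})
    (hn : (p + 1) * Nat.card ι < galleryDim P b δ + n) :
    (galleryDim P b δ : ℝ) ≤ P.toLinearMap (rho P b) (lam + ν) ∧
      ((galleryDim P b δ : ℝ) = P.toLinearMap (rho P b) (lam + ν) →
        ∃ s : List ι, (∀ i ∈ s, i ∈ b.support) ∧ RootESeq P s δ γ₀) := by
  induction n generalizing δ ν with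
  | zero =>
    have := galleryDim_le (b := b) hδ.1.1
    omega
  | succ n ih =>
    have hγ := h.isIntegral hint
    have hδi := isIntegralGallery_of_mem hγ hδ.1
    -- A dip makes the inequality strict: the folded gallery has the same target and a larger
    -- dimension, and it obeys the bound too.
    by_cases hdip : ∃ i ∈ b.support, ∃ m, IsMinLev P δ i m ∧ ∃ l ≤ p, llev P δ i l < 2 * m
    · obtain ⟨i, hi, m, hm, l, hl, hlow⟩ := hdip
      obtain ⟨δ', h1, h2, h3⟩ := exists_positivelyFolded_of_dip hδi hm hi hδ hl hlow hν
      have := (ih h1 h2 (by omega)).1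
      rw [h3] at this
      push_cast at this
      exact ⟨by linarith, fun _ => by linarith⟩
    push Not at hdip
    by_cases hneg : ∃ i ∈ b.support, ∃ m ≤ -1, IsMinLev P δ i m
    · obtain ⟨i, hi, m, hle, hm⟩ := hneg
      obtain ⟨j, k, hpos⟩ := hm.exists_isPosE hδi hle
      have h1 := hpos.galleryDim_fold hδi hi
      have h2 := hpos.positivelyFolded_fold hδi hi hδ (hdip i hi m hm)
      obtain ⟨h3, h4⟩ := hpos.rho_target (lam := lam) hδi hi hν
      have h5 := ih h2 h3 (by omega)
      rw [h1, h4] at h5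
      push_cast at h5
      refine ⟨by linarith [h5.1], fun heq => ?_⟩
      obtain ⟨s, hs1, hs2⟩ := h5.2 (by rw [heq])
      refine ⟨s ++ [i], fun r hr => ?_, hs2.append_singleton
        ((rootE_iff hδi.isGallery).2 ⟨m, j, k, hpos, rfl⟩)⟩
      rcases List.mem_append.1 hr with hr | hr
      · exact hs1 r hr
      · rwa [List.mem_singleton.1 hr]
    · push Not at hneg
      have heq : δ = γ₀ := h.eq_of_dominant hdom hint hδ fun i hi l hl => by
        obtain ⟨m, hm0, hm⟩ := hδi.exists_isMinLev i
        have h1 := hdip i hi m hm l hl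
        have h2 : ¬ m ≤ -1 := fun h' => hneg i hi m h' hm
        omega
      subst heq
      obtain rfl : ν = lam := Set.singleton_injective (hν.symm.trans h.target)
      rw [(h.isMonotone hdom hint).galleryDim_eq hγ hν]
      exact ⟨le_rfl, fun _ => ⟨[], by simp, rfl⟩⟩

theorem IsMinimalGallery.galleryDim_le (h : IsMinimalGallery P b lam γ₀)
    (hdom : lam ∈ dominantChamber P b) (hint : ∀ i, ∃ n : ℤ, P.root' i lam = n)
    (hδ : δ ∈ positivelyFolded P b γ₀) (hν : δ.small (Fin.last (p + 1)) = {ν}) :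
    (galleryDim P b δ : ℝ) ≤ P.toLinearMap (rho P b) (lam + ν) :=
  (h.galleryDim_le_aux hdom hint ((p + 1) * Nat.card ι + 1) hδ hν (by omega)).1

theorem IsMinimalGallery.exists_rootESeq (h : IsMinimalGallery P b lam γ₀)
    (hdom : lam ∈ dominantChamber P b) (hint : ∀ i, ∃ n : ℤ, P.root' i lam = n)
    (hδ : IsLSGallery P b lam γ₀ δ) :
    ∃ s : List ι, (∀ i ∈ s, i ∈ b.support) ∧ RootESeq P s δ γ₀ := by
  obtain ⟨hδ, ν, hν, heq⟩ := hδ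
  exact (h.galleryDim_le_aux hdom hint ((p + 1) * Nat.card ι + 1) hδ hν (by omega)).2 heq

theorem IsMinimalGallery.isLSGallery (h : IsMinimalGallery P b lam γ₀)
    (hdom : lam ∈ dominantChamber P b) (hint : ∀ i, ∃ n : ℤ, P.root' i lam = n) :
    IsLSGallery P b lam γ₀ γ₀ :=
  ⟨(h.isMonotone hdom hint).mem_positivelyFolded (h.isIntegral hint), lam, h.target,
    (h.isMonotone hdom hint).galleryDim_eq (h.isIntegral hint) h.target⟩

/-! ### LS-galleries and root operators -/

theorem IsLSGallery.isIntegralGallery (hδ : IsLSGallery P b lam γ₀ δ)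
    (h : IsMinimalGallery P b lam γ₀) (hint : ∀ i, ∃ n : ℤ, P.root' i lam = n) :
    IsIntegralGallery P δ := isIntegralGallery_of_mem (h.isIntegral hint) hδ.1.1

/-- Folding up a dip would give a positively folded gallery with the same target and a dimension
beyond the bound. -/
theorem IsLSGallery.two_mul_le_llev (hδ : IsLSGallery P b lam γ₀ δ)
    (h : IsMinimalGallery P b lam γ₀) (hdom : lam ∈ dominantChamber P b)
    (hint : ∀ i, ∃ n : ℤ, P.root' i lam = n) (hi : i ∈ b.support) {m : ℤ} (hm : IsMinLev P δ i m) :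
    ∀ l ≤ p, 2 * m ≤ llev P δ i l := by
  by_contra! H
  obtain ⟨l, hl, hlow⟩ := H
  have hδi := hδ.isIntegralGallery h hint
  obtain ⟨hδ, ν, hν, heq⟩ := hδ
  obtain ⟨δ', h1, h2, h3⟩ := exists_positivelyFolded_of_dip hδi hm hi hδ hl hlow hν
  have := h.galleryDim_le hdom hint h1 h2
  rw [h3] at this
  push_cast at this
  linarith

theorem IsLSGallery.rootE (hδ : IsLSGallery P b lam γ₀ δ) (h : IsMinimalGallery P b lam γ₀)
    (hdom : lam ∈ dominantChamber P b) (hint : ∀ i, ∃ n : ℤ, P.root' i lam = n)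
    (hi : i ∈ b.support) (hE : RootE P i δ δ') : IsLSGallery P b lam γ₀ δ' := by
  have hδi := hδ.isIntegralGallery h hint
  obtain ⟨m, j, k, hpos, rfl⟩ := (rootE_iff hδi.isGallery).1 hE
  have hdip := hδ.two_mul_le_llev h hdom hint hi hpos.isMin
  obtain ⟨hδ, ν, hν, heq⟩ := hδ
  obtain ⟨h3, h4⟩ := hpos.rho_target (lam := lam) hδi hi hν
  refine ⟨hpos.positivelyFolded_fold hδi hi hδ hdip, _, h3, ?_⟩
  rw [h4, hpos.galleryDim_fold hδi hi, ← heq]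
  push_cast
  rfl

theorem IsLSGallery.rootF (hδ : IsLSGallery P b lam γ₀ δ) (h : IsMinimalGallery P b lam γ₀)
    (hdom : lam ∈ dominantChamber P b) (hint : ∀ i, ∃ n : ℤ, P.root' i lam = n)
    (hi : i ∈ b.support) (hF : RootF P i δ δ') : IsLSGallery P b lam γ₀ δ' := by
  have hδi := hδ.isIntegralGallery h hint
  obtain ⟨ν, hν, -⟩ := hδi.target
  obtain ⟨m, j, k, hpos, rfl⟩ := (rootF_iff hδi.isGallery hν).1 hF
  have hdip := hδ.two_mul_le_llev h hdom hint hi hpos.isMin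
  obtain ⟨hδ, ν', hν', heq⟩ := hδ
  obtain rfl : ν' = ν := Set.singleton_injective (hν'.symm.trans hν)
  refine ⟨hpos.positivelyFolded_fold hδi hi hδ hdip, _, fold_target hν (hpos.isFoldData hδi), ?_⟩
  have hdim := hpos.galleryDim_fold hδi hi
  rw [← hdim] at heq
  push_cast at heq
  have e : lam + (ν' + (m - (m + 1)) • P.coroot i) = lam + ν' - P.coroot i := by
    rw [sub_add_cancel_left, neg_one_zsmul]; abel
  rw [e, map_sub, rho_coroot hi]
  linarith

theorem IsLSGallery.rootFSeq (hδ : IsLSGallery P b lam γ₀ δ) (h : IsMinimalGallery P b lam γ₀)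
    (hdom : lam ∈ dominantChamber P b) (hint : ∀ i, ∃ n : ℤ, P.root' i lam = n)
    {s : List ι} (hs : ∀ i ∈ s, i ∈ b.support) (hF : RootFSeq P s δ δ') :
    IsLSGallery P b lam γ₀ δ' := by
  induction s generalizing δ with
  | nil => exact hF ▸ hδ
  | cons i s ih =>
    obtain ⟨γ', h1, h2⟩ := hF
    exact ih (hδ.rootF h hdom hint (hs i (by simp)) h1) (fun r hr => hs r (by simp [hr])) h2

end

noncomputable section

variable {ι M N : Type*} [AddCommGroup M] [Module ℝ M] [AddCommGroup N] [Module ℝ N]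
variable {P : RootPairing ι ℝ M N} {b : P.Base} {p : ℕ} {γ γ₀ δ δ' : Gallery N p} {lam ν ν' : N}
  {i : ι}

/-! ### The dual gallery -/

theorem Gallery.sm_dual (γ : Gallery N p) (ν : N) {l : ℕ} (hl : l ≤ p + 1) :
    (γ.dual ν).sm l = Equiv.addRight (-ν) '' γ.sm (p + 1 - l) := by
  have h1 : (γ.dual ν).sm l = (fun x => x - ν) '' γ.small (Fin.ofNat (p + 2) l).rev := rfl
  rw [h1, γ.small_eq_sm, Fin.val_rev, Fin.val_ofNat, Nat.mod_eq_of_lt (by omega),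
    show p + 2 - (l + 1) = p + 1 - l by omega]
  simp only [Equiv.coe_addRight, sub_eq_add_neg]

theorem Gallery.lg_dual (γ : Gallery N p) (ν : N) {l : ℕ} (hl : l ≤ p) :
    (γ.dual ν).lg l = Equiv.addRight (-ν) '' γ.lg (p - l) := by
  have h1 : (γ.dual ν).lg l = (fun x => x - ν) '' γ.large (Fin.ofNat (p + 1) l).rev := rfl
  rw [h1, γ.large_eq_lg, Fin.val_rev, Fin.val_ofNat, Nat.mod_eq_of_lt (by omega),
    show p + 1 - (l + 1) = p - l by omega]
  simp only [Equiv.coe_addRight, sub_eq_add_neg]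

theorem Gallery.dual_dual (γ : Gallery N p) (ν : N) : (γ.dual ν).dual (-ν) = γ := by
  have key : ∀ F : Set N, (fun x => x - -ν) '' ((fun x => x - ν) '' F) = F := fun F => by
    simp only [Set.image_image, sub_neg_eq_add, sub_add_cancel, Set.image_id']
  refine Gallery.ext (funext fun k => (key _).trans ?_) (funext fun k => (key _).trans ?_)
  · exact congrArg γ.small k.rev_rev
  · exact congrArg γ.large k.rev_rev

theorem Gallery.dual_small_last (hs : γ.small 0 = {0}) :
    (γ.dual ν).small (Fin.last (p + 1)) = {-ν} := by
  simp [Gallery.dual, Gallery.reverse, Gallery.map, hs]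

theorem Gallery.dual_small_zero (hν : γ.small (Fin.last (p + 1)) = {ν}) :
    (γ.dual ν).small 0 = {0} := by
  simp [Gallery.dual, Gallery.reverse, Gallery.map, hν]

theorem IsIntegralGallery.exists_root'_target (h : IsIntegralGallery P γ)
    (hν : γ.small (Fin.last (p + 1)) = {ν}) (i : ι) :
    ∃ n : ℤ, P.root' i ν = n ∧ slev P γ i (p + 1) = 2 * n := by
  obtain ⟨n, hn⟩ := h.slev_last i
  exact ⟨n, by rw [← lev_eq_two_mul, ← h.isGallery.slev_target hν, hn], hn⟩

theorem IsIntegralGallery.exists_isAffineAut (h : IsIntegralGallery P γ)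
    (hν : γ.small (Fin.last (p + 1)) = {ν}) :
    ∃ k : ι → ℤ, IsAffineAut P (Equiv.addRight (-ν)) (LinearEquiv.refl ℝ N) 1 k ∧
      ∀ i, slev P γ i (p + 1) = -(2 * k i) := by
  choose n hn hn' using h.exists_root'_target hν
  refine ⟨fun i => -n i, IsAffineAut.addRight _ _ fun i => ?_, fun i => ?_⟩
  · rw [map_neg, hn]; push_cast; rfl
  · rw [hn']; ring

/-- Integrality at the target makes the translation an automorphism of the complex, so it only
shifts levels. -/
theorem IsIntegralGallery.slev_dual (h : IsIntegralGallery P γ)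
    (hν : γ.small (Fin.last (p + 1)) = {ν}) (i : ι) {l : ℕ} (hl : l ≤ p + 1) :
    slev P (γ.dual ν) i l = slev P γ i (p + 1 - l) - slev P γ i (p + 1) := by
  obtain ⟨k, hk, hk'⟩ := h.exists_isAffineAut hν
  rw [hk', slev, γ.sm_dual ν hl, hk.faceLevel_image (h.isGallery.sm_isFace _)]
  rw [slev, Equiv.Perm.one_apply]; ring

theorem IsIntegralGallery.llev_dual (h : IsIntegralGallery P γ)
    (hν : γ.small (Fin.last (p + 1)) = {ν}) (i : ι) {l : ℕ} (hl : l ≤ p) :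
    llev P (γ.dual ν) i l = llev P γ i (p - l) - slev P γ i (p + 1) := by
  obtain ⟨k, hk, hk'⟩ := h.exists_isAffineAut hν
  rw [hk', llev, γ.lg_dual ν hl, hk.faceLevel_image (h.isGallery.lg_isFace _)]
  rw [llev, Equiv.Perm.one_apply]; ring

theorem IsIntegralGallery.dual (h : IsIntegralGallery P γ)
    (hν : γ.small (Fin.last (p + 1)) = {ν}) : IsIntegralGallery P (γ.dual ν) := by
  obtain ⟨k, hk, -⟩ := h.exists_isAffineAut hν
  have haut : IsAut P (Equiv.addRight (-ν)) := ⟨_, _, _, hk⟩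
  obtain ⟨h1, h2, h3, h4, h5, h6, h7, h8⟩ := isGallery_iff.1 h.isGallery
  refine ⟨isGallery_iff.2 ⟨fun l hl => ?_, fun l hl => ?_, fun l hl => ?_, fun l hl => ?_, ?_, ?_,
    fun j hj k hk => ?_, fun l hl => ?_⟩, Gallery.dual_small_zero hν, -ν,
    Gallery.dual_small_last h.source, fun i => ?_⟩
  · rw [γ.sm_dual ν hl]; exact haut.isFace_image (h1 _ (by omega))
  · rw [γ.lg_dual ν hl]; exact haut.isFace_image (h2 _ (by omega))
  · rw [γ.sm_dual ν (by omega), γ.lg_dual ν hl, show p + 1 - l = p - l + 1 by omega]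
    exact Set.image_mono (h4 _ (by omega))
  · rw [γ.sm_dual ν (by omega), γ.lg_dual ν hl, show p + 1 - (l + 1) = p - l by omega]
    exact Set.image_mono (h3 _ (by omega))
  · rw [γ.sm_dual ν (by omega), haut.faceDim_image, Nat.sub_zero, h6]
  · rw [γ.sm_dual ν le_rfl, haut.faceDim_image, Nat.sub_self, h5]
  · rw [γ.lg_dual ν hj, γ.lg_dual ν hk, haut.faceDim_image, haut.faceDim_image]
    exact h7 _ (by omega) _ (by omega)
  · rw [γ.sm_dual ν (by omega), γ.lg_dual ν (by omega), haut.faceDim_image, haut.faceDim_image,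
      show p + 1 - (l + 1) = p - (l + 1) + 1 by omega, h8 _ (by omega)]
    exact h7 _ (by omega) _ (by omega)
  · obtain ⟨n, hn, -⟩ := h.exists_root'_target hν i
    exact ⟨-n, by rw [map_neg, hn]; push_cast; rfl⟩

/-! ### Duality exchanges the two kinds of root operators. -/

section operators

variable [P.IsCrystallographic] {m : ℤ} {j k : ℕ}

/-- Reversal turns the first face at the minimal level into the last one; the shift by `n` comes
from moving the target to the origin. -/
theorem IsPosE.dual (hγ : IsIntegralGallery P γ) (h : IsPosE P γ i m j k) {n : ℤ}
    (hν : γ.small (Fin.last (p + 1)) = {ν}) (hn : slev P γ i (p + 1) = 2 * n) :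
    IsPosF P (γ.dual ν) i (m - n) (p + 1 - k) (p + 1 - j) := by
  have hlt := h.lt
  have hle := h.le
  have hleft := h.left
  have hright := h.right
  have h0 := hγ.slev_zero i
  have hneg := h.neg
  have e : ∀ l ≤ p + 1, slev P (γ.dual ν) i l = slev P γ i (p + 1 - l) - 2 * n := fun l hl => by
    rw [hγ.slev_dual hν i hl, hn]
  refine ⟨⟨⟨p + 1 - k, by omega, ?_⟩, fun l hl n' hn' => ?_⟩, ?_, by omega, by omega, ?_,
    fun l hl hlp => ?_, ?_, fun l hl hlj => ?_⟩
  · rw [e _ (by omega), show p + 1 - (p + 1 - k) = k by omega]; omega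
  · rw [e _ hl] at hn'
    have := h.isMin.2 (p + 1 - l) (by omega) (n' + n) (by omega)
    omega
  · rw [e _ le_rfl, Nat.sub_self]; omega
  · rw [e _ (by omega), show p + 1 - (p + 1 - k) = k by omega]; omega
  · rw [e _ hlp]
    have := h.first (p + 1 - l) (by omega)
    omega
  · rw [e _ (by omega), show p + 1 - (p + 1 - j) = j by omega]; omega
  · rw [e _ (by omega)]
    have := h.last (p + 1 - l) (by omega) (by omega)
    omega

theorem affRefl_addRight (i : ι) (m : ℤ) {n : ℤ} (hn : P.root' i ν = n) (x : N) :
    affRefl P i (m - n) (x + -ν) = affRefl P i m x + -ν := by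
  simp only [affRefl_apply, map_add, map_neg, hn, Int.cast_sub]
  module

/-- Relative to its own target, the translated end of the folded gallery is unchanged and its kept
beginning is shifted by `-α^∨`. Reversal thus interchanges the kept and the translated parts, while
the middle remains a reflection. -/
theorem dual_fold (hγ : IsIntegralGallery P γ) (h : IsFoldData P γ i (m + 1) m j k) {n : ℤ}
    (hn : P.root' i ν = n) :
    (γ.fold P i (m + 1) m j k).dual (ν + P.coroot i) =
      (γ.dual ν).fold P i (m - n) (m - n + 1) (p + 1 - k) (p + 1 - j) := by
  have hlt := h.lt
  have hle := h.le
  have refl_succ : ∀ x, affRefl P i (m + 1) x = affRefl P i m x + P.coroot i := fun x => by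
    simp only [affRefl_apply]; push_cast; module
  -- Here `a` is the position in `γ` and `c` the one in the dual. They add up to `p + 1` for small
  -- faces and to `p` for large ones, so at `a = j` and `a = k` the maps match only for small faces,
  -- which lie on the walls.
  have main : ∀ (F : Set N) (a c : ℕ),
      ((a < j ∨ a = j ∧ F ⊆ wall P i (m + 1)) ∧ p + 1 - j ≤ c ∨
        (j ≤ a ∧ a < k ∨ a = k ∧ F ⊆ wall P i m) ∧ p + 1 - k ≤ c ∧ c < p + 1 - j ∨
        k ≤ a ∧ c < p + 1 - k) →
      Equiv.addRight (-(ν + P.coroot i)) '' (foldMap P i (m + 1) m j k a '' F) =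
        foldMap P i (m - n) (m - n + 1) (p + 1 - k) (p + 1 - j) c ''
          (Equiv.addRight (-ν) '' F) := by
    intro F a c hac
    rw [Set.image_image, Set.image_image]
    refine Set.image_congr fun x hx => ?_
    rcases hac with ⟨h1, h2⟩ | ⟨h1, h2, h3⟩ | ⟨h1, h2⟩
    · rw [foldMap_of_ge (l := c) (by omega) h2]
      rcases h1 with h1 | ⟨rfl, hF⟩
      · rw [foldMap_of_lt h1]
        simp only [Equiv.coe_addRight, Equiv.Perm.one_apply]
        module
      · rw [foldMap_of_mem le_rfl hlt, affRefl_eq_self (hF hx)]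
        simp only [Equiv.coe_addRight]
        module
    · rw [foldMap_of_mem h2 h3]
      simp only [Equiv.coe_addRight]
      rw [affRefl_addRight i m hn]
      rcases h1 with ⟨h1, h1'⟩ | ⟨rfl, hF⟩
      · rw [foldMap_of_mem h1 h1', refl_succ]
        abel
      · rw [foldMap_of_ge hlt.le le_rfl, affRefl_eq_self (hF hx)]
        simp only [Equiv.coe_addRight]
        module
    · rw [foldMap_of_lt h2, foldMap_of_ge (by omega) h1]
      simp only [Equiv.coe_addRight, Equiv.Perm.one_apply]
      module
  refine Gallery.eq_of_sm_lg (fun l hl => ?_) fun l hl => ?_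
  · rw [Gallery.sm_dual _ _ hl, Gallery.fold, Gallery.fold, Gallery.sm_mapAt _ _ (by omega),
      Gallery.sm_mapAt _ _ hl, Gallery.sm_dual _ _ hl]
    refine main _ _ _ ?_
    rcases lt_trichotomy (p + 1 - l) j with h1 | h1 | h1
    · exact Or.inl ⟨Or.inl h1, by omega⟩
    · exact Or.inl ⟨Or.inr ⟨h1, h1 ▸ h.left_subset hγ.isGallery⟩, by omega⟩
    · rcases lt_trichotomy (p + 1 - l) k with h2 | h2 | h2
      · exact Or.inr (Or.inl ⟨Or.inl ⟨h1.le, h2⟩, by omega⟩)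
      · exact Or.inr (Or.inl ⟨Or.inr ⟨h2, h2 ▸ h.right_subset hγ.isGallery⟩, by omega⟩)
      · exact Or.inr (Or.inr ⟨h2.le, by omega⟩)
  · rw [Gallery.lg_dual _ _ hl, Gallery.fold, Gallery.fold, Gallery.lg_mapAt _ _ (by omega),
      Gallery.lg_mapAt _ _ hl, Gallery.lg_dual _ _ hl]
    exact main _ _ _ (by omega)

theorem RootE.dual (hγ : IsIntegralGallery P γ) (hν : γ.small (Fin.last (p + 1)) = {ν})
    (hν' : δ.small (Fin.last (p + 1)) = {ν'}) (h : RootE P i γ δ) :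
    RootF P i (γ.dual ν) (δ.dual ν') := by
  obtain ⟨n, hn, hn'⟩ := hγ.exists_root'_target hν i
  obtain ⟨m, j, k, hpos, rfl⟩ := (rootE_iff hγ.isGallery).1 h
  have hf := hpos.isFoldData hγ
  obtain rfl : ν' = ν + P.coroot i := by
    have := fold_target hν hf
    rw [add_sub_cancel_left, one_smul, hν'] at this
    exact Set.singleton_injective this
  exact (rootF_iff (hγ.dual hν).isGallery (Gallery.dual_small_last hγ.source)).2
    ⟨m - n, _, _, hpos.dual hγ hν hn', dual_fold hγ hf hn⟩

/-- Follows from the statement for `e_α`, since the operators are mutually inverse before and after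
dualizing. -/
theorem RootF.dual (hγ : IsIntegralGallery P γ) (hν : γ.small (Fin.last (p + 1)) = {ν})
    (hν' : δ.small (Fin.last (p + 1)) = {ν'}) (h : RootF P i γ δ) :
    RootE P i (γ.dual ν) (δ.dual ν') := by
  have hδ := h.isIntegralGallery hγ
  exact ((h.rootE hγ).dual hδ hν' hν).rootE (hδ.dual hν')

variable [Finite ι] [P.IsRootSystem] [P.IsReduced]

/-- Each `f_α` on a gallery acts as `e_α` on its dual, and `e_α` preserves LS-galleries. -/
theorem IsLSGallery.dual_of_rootFSeq (h : IsMinimalGallery P b lam γ₀)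
    (hdom : lam ∈ dominantChamber P b) (hint : ∀ i, ∃ n : ℤ, P.root' i lam = n)
    (hγ : IsIntegralGallery P γ) (hν : γ.small (Fin.last (p + 1)) = {ν})
    (hν' : δ.small (Fin.last (p + 1)) = {ν'}) (hLS : IsLSGallery P b lam γ₀ (γ.dual ν))
    {s : List ι} (hs : ∀ i ∈ s, i ∈ b.support) (hF : RootFSeq P s γ δ) :
    IsLSGallery P b lam γ₀ (δ.dual ν') := by
  induction s generalizing γ ν with
  | nil =>
    obtain rfl : γ = δ := hF
    obtain rfl : ν = ν' := Set.singleton_injective (hν.symm.trans hν')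
    exact hLS
  | cons i s ih =>
    obtain ⟨γ', h1, h2⟩ := hF
    have hγ' := h1.isIntegralGallery hγ
    obtain ⟨μ, hμ, -⟩ := hγ'.target
    exact ih hγ' hμ (hLS.rootE h hdom hint (hs i (by simp)) (h1.dual hγ hν hμ))
      (fun r hr => hs r (by simp [hr])) h2

theorem IsLSGallery.dual_of_rootESeq (h : IsMinimalGallery P b lam γ₀)
    (hdom : lam ∈ dominantChamber P b) (hint : ∀ i, ∃ n : ℤ, P.root' i lam = n)
    (hγ : IsIntegralGallery P γ) (hν : γ.small (Fin.last (p + 1)) = {ν})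
    (hν' : δ.small (Fin.last (p + 1)) = {ν'}) (hLS : IsLSGallery P b lam γ₀ (γ.dual ν))
    {s : List ι} (hs : ∀ i ∈ s, i ∈ b.support) (hE : RootESeq P s γ δ) :
    IsLSGallery P b lam γ₀ (δ.dual ν') := by
  induction s generalizing δ ν' with
  | nil =>
    obtain rfl : γ = δ := hE
    obtain rfl : ν = ν' := Set.singleton_injective (hν.symm.trans hν')
    exact hLS
  | cons i s ih =>
    obtain ⟨γ', h1, h2⟩ := hE
    have hγ' := h1.isIntegralGallery hγ
    obtain ⟨μ, hμ, -⟩ := hγ'.target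
    exact (ih hμ (fun r hr => hs r (by simp [hr])) h1).rootF h hdom hint (hs i (by simp))
      (h2.dual hγ' hμ hν')

end operators

/-! ### The longest element -/

section longest

variable [P.IsCrystallographic] {w : Equiv.Perm N}

theorem finiteWeylGroup_le : finiteWeylGroup P ≤ affineWeylGroup P :=
  (Subgroup.closure_le _).2 (by rintro _ ⟨i, rfl⟩; exact affRefl_mem i 0)

/-- Elements generated by reflections through the origin are linear, so they pull roots back to
roots without a constant. -/
theorem exists_isAffineAut_of_mem_finiteWeylGroup (hw : w ∈ finiteWeylGroup P) :
    ∃ A σ, IsAffineAut P w A σ 0 ∧ ∀ x, w x = A x := by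
  have h0 : w 0 = 0 ∧ ∃ A σ, IsAffineAut P w A σ 0 := by
    induction hw using Subgroup.closure_induction with
    | mem x hx =>
      obtain ⟨i, rfl⟩ := hx
      refine ⟨by simp [affRefl_apply], P.coreflection i, P.reflectionPerm i, ?_⟩
      convert IsAffineAut.affRefl (P := P) i 0 using 1
      funext j; simp
    | one => exact ⟨rfl, _, _, IsAffineAut.one⟩
    | mul x y _ _ hx hy =>
      obtain ⟨hx0, A, σ, hx⟩ := hx
      obtain ⟨hy0, A', σ', hy⟩ := hy
      refine ⟨by rw [Equiv.Perm.mul_apply, hy0, hx0], A'.trans A, σ' * σ, ?_⟩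
      convert hx.mul hy using 1
      funext j; simp
    | inv x _ hx =>
      obtain ⟨hx0, A, σ, hx⟩ := hx
      refine ⟨by rw [Equiv.Perm.inv_eq_iff_eq, hx0], A.symm, σ⁻¹, ?_⟩
      convert hx.inv using 1
      funext j; simp
  obtain ⟨h0, A, σ, h⟩ := h0
  exact ⟨A, σ, h, fun x => by rw [h.map_eq, h0, add_zero]⟩

theorem finrank_orthSubspace_neg {A : N ≃ₗ[ℝ] N} {σ : Equiv.Perm ι}
    (hA : ∀ i x, P.root' i (A x) = P.root' (σ i) x) (lam : N) :
    Module.finrank ℝ (orthSubspace P (-(A lam))) = Module.finrank ℝ (orthSubspace P lam) := by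
  have : orthSubspace P (-(A lam)) = (orthSubspace P lam).map (A : N →ₗ[ℝ] N) := by
    ext x
    obtain ⟨y, rfl⟩ := A.surjective x
    have hmem : A y ∈ (orthSubspace P lam).map (A : N →ₗ[ℝ] N) ↔ y ∈ orthSubspace P lam := by
      simp
    rw [hmem]
    simp only [orthSubspace, Submodule.mem_iInf, LinearMap.mem_ker, map_neg, neg_eq_zero, hA]
    exact ⟨fun H i => by simpa using H (σ.symm i), fun H i => H (σ i)⟩
  rw [this]
  exact LinearEquiv.finrank_map_eq A _

variable [P.IsRootSystem]

theorem IsLongestElement.isPos_iff (hw : IsLongestElement P b w) {A : N ≃ₗ[ℝ] N}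
    {σ : Equiv.Perm ι} (h : IsAffineAut P w A σ 0) {i : ι} : b.IsPos (σ i) ↔ ¬ b.IsPos i := by
  -- A strictly dominant vector: the sign of `σ i` can be read off from its value at `d`.
  obtain ⟨d, hd⟩ := exists_root'_eq_height b
  have hdom : d ∈ dominantChamber P b := fun r hr => by
    rw [hd]; exact_mod_cast hr.le
  have hneg : ∀ i, b.IsPos i → ¬ b.IsPos (σ i) := fun i hi hσ => by
    have h1 : -(w d) ∈ dominantChamber P b := by
      have : w d ∈ w '' dominantChamber P b := ⟨d, hdom, rfl⟩
      rw [hw.2] at this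
      exact this
    have h2 := h1 i hi
    rw [map_neg, h.root_eq, hd] at h2
    have h3 : 0 < b.height (σ i) := hσ
    have h4 : (0 : ℝ) < b.height (σ i) := by exact_mod_cast h3
    simp only [Pi.zero_apply, Int.cast_zero, add_zero] at h2
    linarith
  refine ⟨fun h1 h2 => hneg i h2 h1, fun hi => ?_⟩
  by_contra hσ
  have h1 : -(w d) ∈ dominantChamber P b := by
    have : w d ∈ w '' dominantChamber P b := ⟨d, hdom, rfl⟩
    rw [hw.2] at this
    exact this
  have h2 := h1 _ (isPos_opp.2 hi)
  rw [root'_opp, map_neg, neg_neg, h.root_eq, hd] at h2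
  have h3 : 0 < b.height (opp P (σ i)) := isPos_opp.2 hσ
  have h4 : (0 : ℝ) < P.root' (opp P (σ i)) d := by rw [hd]; exact_mod_cast h3
  rw [root'_opp, hd] at h4
  simp only [Pi.zero_apply, Int.cast_zero, add_zero] at h2
  linarith

theorem IsLongestElement.rho_apply_eq [Finite ι] (hw : IsLongestElement P b w) (x : N) :
    P.toLinearMap (rho P b) (w x) = -P.toLinearMap (rho P b) x := by
  obtain ⟨A, σ, h, -⟩ := exists_isAffineAut_of_mem_finiteWeylGroup hw.1
  rw [rho_apply, rho_apply, ← mul_neg, ← Finset.sum_neg_distrib]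
  congr 1
  refine Finset.sum_equiv (σ.trans (Function.Involutive.toPerm (opp P) opp_opp)) (fun i => ?_)
    fun i _ => ?_
  · rw [mem_posRoots, mem_posRoots]
    change _ ↔ b.IsPos (opp P (σ i))
    rw [isPos_opp, hw.isPos_iff h, not_not]
  · change _ = -P.root' (opp P (σ i)) x
    rw [root'_opp, h.root_eq]
    simp

theorem IsMonotoneGallery.of_not_isPos (h : IsMonotoneGallery P b γ) (hi : ¬ b.IsPos i) {l : ℕ}
    (hl : l ≤ p) : slev P γ i (l + 1) ≤ llev P γ i l ∧ llev P γ i l ≤ slev P γ i l := by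
  have := h _ (isPos_opp.2 hi) l hl
  rw [slev_opp, slev_opp, llev_opp] at this
  omega

theorem IsAffineAut.levels_map {A : N ≃ₗ[ℝ] N} {σ : Equiv.Perm ι} (h : IsAffineAut P w A σ 0)
    (hγ : IsGallery P γ) (i : ι) (l : ℕ) :
    slev P (γ.map w) i l = slev P γ (σ i) l ∧ llev P (γ.map w) i l = llev P γ (σ i) l := by
  constructor
  · have := h.faceLevel_image (hγ.sm_isFace l) i
    simp only [Pi.zero_apply, mul_zero, add_zero] at this
    exact this
  · have := h.faceLevel_image (hγ.lg_isFace l) i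
    simp only [Pi.zero_apply, mul_zero, add_zero] at this
    exact this

variable [Finite ι]

/-- The image of the dual of a minimal gallery under the longest element is minimal. -/
theorem IsMinimalGallery.map_dual (h : IsMinimalGallery P b lam γ)
    (hdom : lam ∈ dominantChamber P b) (hint : ∀ i, ∃ n : ℤ, P.root' i lam = n)
    (hw : IsLongestElement P b w) :
    IsMinimalGallery P b (-(w lam)) ((γ.dual lam).map w) ∧ -(w lam) ∈ dominantChamber P b ∧
      ∀ i, ∃ n : ℤ, P.root' i (-(w lam)) = n := by
  obtain ⟨A, σ, hA, hwA⟩ := exists_isAffineAut_of_mem_finiteWeylGroup hw.1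
  have hroot : ∀ i x, P.root' i (w x) = P.root' (σ i) x := fun i x => by
    rw [hA.root_eq]; simp
  have haut : IsAut P w := ⟨_, _, _, hA⟩
  have hγ := h.isIntegral hint
  have hmono := h.isMonotone hdom hint
  have hd := hγ.dual h.target
  have hdom' : -(w lam) ∈ dominantChamber P b := by
    have : w lam ∈ w '' dominantChamber P b := ⟨lam, hdom, rfl⟩
    rw [hw.2] at this
    exact this
  refine ⟨IsMonotoneGallery.isMinimal (fun i hi l hl => ?_)
    (hd.isGallery.mapAt (ψ := fun _ => w) (fun _ => haut) fun _ _ => rfl) ?_ ?_ (fun j => ?_) hdom',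
    hdom', fun i => ?_⟩
  · have hσ : ¬ b.IsPos (σ i) := by rw [hw.isPos_iff hA, not_not]; exact hi
    rw [(hA.levels_map hd.isGallery i l).1, (hA.levels_map hd.isGallery i l).2,
      (hA.levels_map hd.isGallery i (l + 1)).1, hγ.slev_dual h.target _ (by omega),
      hγ.slev_dual h.target _ (by omega), hγ.llev_dual h.target _ hl]
    have := hmono.of_not_isPos hσ (l := p - l) (by omega)
    rw [show p + 1 - l = p - l + 1 by omega, show p + 1 - (l + 1) = p - l by omega]
    omega
  · change w '' (γ.dual lam).small 0 = _
    rw [Gallery.dual_small_zero h.target, Set.image_singleton, hwA, map_zero]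
  · change w '' (γ.dual lam).small (Fin.last (p + 1)) = _
    rw [Gallery.dual_small_last h.source, Set.image_singleton, hwA, hwA, map_neg]
  · rw [hwA, finrank_orthSubspace_neg (σ := σ) fun i x => by rw [← hwA, hroot]]
    change faceDim (w '' (γ.dual lam).large j) = _
    rw [haut.faceDim_image, Gallery.large_eq_lg, Gallery.lg_dual _ _ (Nat.le_of_lt_succ j.2)]
    obtain ⟨k, hk, -⟩ := hγ.exists_isAffineAut h.target
    rw [IsAut.faceDim_image ⟨_, _, _, hk⟩]
    exact h.large_dim _
  · obtain ⟨n, hn⟩ := hint (σ i)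
    exact ⟨-n, by rw [map_neg, hroot, hn]; push_cast; rfl⟩

/-- The dual of a minimal gallery is an LS-gallery. -/
theorem IsMinimalGallery.isLSGallery_dual [P.IsReduced] (h : IsMinimalGallery P b lam γ)
    (hdom : lam ∈ dominantChamber P b) (hint : ∀ i, ∃ n : ℤ, P.root' i lam = n)
    (hw : IsLongestElement P b w) :
    IsLSGallery P b (-(w lam)) ((γ.dual lam).map w) (γ.dual lam) := by
  have hγ := h.isIntegral hint
  have hmono := h.isMonotone hdom hint
  have hd := hγ.dual h.target
  have htype : ∀ F : Set N, SameType P (w '' F) F := fun F =>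
    ⟨w⁻¹, inv_mem (finiteWeylGroup_le hw.1), by
      rw [← Set.image_comp, ← Equiv.Perm.coe_mul, inv_mul_cancel, Equiv.Perm.coe_one, Set.image_id]⟩
  refine ⟨positivelyFolded_of_levelMinimal hd ⟨hd.isGallery, hd.source, fun _ => htype _,
    fun _ => htype _⟩ fun l hl => levelMinimal_of_monotone fun i => ?_, -lam,
    Gallery.dual_small_last h.source, ?_⟩
  · change (llev P (γ.dual lam) i l ≤ slev P (γ.dual lam) i (l + 1) ∧
        slev P (γ.dual lam) i (l + 1) ≤ llev P (γ.dual lam) i (l + 1)) ∨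
      (slev P (γ.dual lam) i (l + 1) ≤ llev P (γ.dual lam) i l ∧
        llev P (γ.dual lam) i (l + 1) ≤ slev P (γ.dual lam) i (l + 1))
    rw [hγ.slev_dual h.target _ (by omega), hγ.llev_dual h.target _ (by omega),
      hγ.llev_dual h.target _ (by omega), show p + 1 - (l + 1) = p - l by omega]
    have e : p - (l + 1) + 1 = p - l := by omega
    by_cases hi : b.IsPos i
    · have h1 := hmono i hi (p - l) (by omega)
      have h2 := hmono i hi (p - (l + 1)) (by omega)
      rw [e] at h2
      omega
    · have h1 := hmono.of_not_isPos hi (l := p - l) (by omega)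
      have h2 := hmono.of_not_isPos hi (l := p - (l + 1)) (by omega)
      rw [e] at h2
      omega
  · have hdim : galleryDim P b (γ.dual lam) = 0 := by
      rw [galleryDim_eq_sum hd.isGallery]
      refine Finset.sum_eq_zero fun l hl => ?_
      rw [Set.ncard_eq_zero]
      refine Set.eq_empty_of_forall_notMem fun i hi => ?_
      have hl' : l ≤ p := by simpa [Nat.lt_succ_iff] using hl
      obtain ⟨h1, -, h2⟩ := hi
      change slev P (γ.dual lam) i l < llev P (γ.dual lam) i l at h2
      rw [hγ.slev_dual h.target _ (by omega), hγ.llev_dual h.target _ hl',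
        show p + 1 - l = p - l + 1 by omega] at h2
      have := hmono i h1 (p - l) (by omega)
      omega
    -- The longest element negates the pairing with `ρ`, so `λ^* - λ` pairs to zero.
    rw [hdim, map_add, map_neg, map_neg, hw.rho_apply_eq]
    simp

end longest

end

end LSGallery

/-! ### Assembly of the characterization of LS-galleries and of their duality. -/

theorem mainTheorem4 {ι M N : Type*} [Finite ι] [AddCommGroup M] [Module ℝ M]
    [AddCommGroup N] [Module ℝ N] (P : RootPairing ι ℝ M N) [P.IsRootSystem]
    [P.IsCrystallographic] [P.IsReduced] (b : P.Base)
    (L : AddSubgroup N) (hL : IsCocharacterGroup P L)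
    (lam : N) (hlam : lam ∈ L) (hdom : lam ∈ dominantChamber P b)
    {p : ℕ} (γlam : Gallery N p) (hγ : IsMinimalGallery P b lam γlam) :
    -- (i) maximal dimension, in terms of the operators `e` and, equivalently, `f`
    (∀ δ ∈ positivelyFolded P b γlam, ∀ ν : N, δ.small (Fin.last (p + 1)) = {ν} →
      (((galleryDim P b δ : ℝ) = P.toLinearMap (rho P b) (lam + ν)) ↔
        ∃ s : List ι, (∀ i ∈ s, i ∈ b.support) ∧ RootESeq P s δ γlam) ∧
      (∀ s : List ι, (∀ i ∈ s, i ∈ b.support) →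
        (RootESeq P s δ γlam ↔ RootFSeq P s γlam δ))) ∧
    -- the LS-galleries are the galleries generated from `γlam` by the operators `f`
    {δ | IsLSGallery P b lam γlam δ} =
      {δ | ∃ s : List ι, (∀ i ∈ s, i ∈ b.support) ∧ RootFSeq P s γlam δ} ∧
    -- (ii) duality, the type of the dual galleries being that of `w₀(γlam*)`
    (∀ w₀ : Equiv.Perm N, IsLongestElement P b w₀ →
      ∀ δ ∈ galleriesOfType P γlam, ∀ ν : N, δ.small (Fin.last (p + 1)) = {ν} →
        (IsLSGallery P b lam γlam δ ↔
          IsLSGallery P b (-(w₀ lam)) ((γlam.dual lam).map w₀) (δ.dual ν))) := by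

  have hint := hL.integral lam hlam
  have hγi := hγ.isIntegral hint
  have hback : ∀ {δ : Gallery N p} {s : List ι}, (∀ i ∈ s, i ∈ b.support) →
      RootFSeq P s γlam δ → IsLSGallery P b lam γlam δ := fun hs hF =>
    (hγ.isLSGallery hdom hint).rootFSeq hγ hdom hint hs hF
  refine ⟨fun δ hδ ν hν => ?_, ?_, fun w₀ hw δ hδ ν hν => ?_⟩
  · have hδi := isIntegralGallery_of_mem hγi hδ.1
    have hiff : ∀ s : List ι, RootESeq P s δ γlam ↔ RootFSeq P s γlam δ := fun s =>
      ⟨fun h => h.rootFSeq hδi, fun h => h.rootESeq hγi⟩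
    refine ⟨⟨fun h => hγ.exists_rootESeq hdom hint ⟨hδ, ν, hν, h⟩, ?_⟩, fun s _ => hiff s⟩
    rintro ⟨s, hs, hE⟩
    obtain ⟨-, ν', hν', heq⟩ := hback hs ((hiff s).1 hE)
    obtain rfl : ν' = ν := Set.singleton_injective (hν'.symm.trans hν)
    exact heq
  · ext δ
    refine ⟨fun h => ?_, fun ⟨s, hs, hF⟩ => hback hs hF⟩
    obtain ⟨s, hs, hE⟩ := hγ.exists_rootESeq hdom hint h
    exact ⟨s, hs, hE.rootFSeq (h.isIntegralGallery hγ hint)⟩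
  · obtain ⟨hγ', hdom', hint'⟩ := hγ.map_dual hdom hint hw
    have hLS := hγ.isLSGallery_dual hdom hint hw
    have hγ'i := hγ'.isIntegral hint'
    have hδi := isIntegralGallery_of_mem hγi hδ
    have hdual := hγi.dual hγ.target
    have hdual' := hδi.dual hν
    constructor
    · intro h
      obtain ⟨s, hs, hE⟩ := hγ.exists_rootESeq hdom hint h
      -- The chain of operators `f` from `γ_λ` to `δ` dualizes to a chain of operators `e` starting
      -- at the LS-gallery `γ_λ^*`.
      exact hLS.dual_of_rootFSeq hγ' hdom' hint' hγi hγ.target hν hs (hE.rootFSeq hδi)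
    · intro h
      obtain ⟨s, hs, hE⟩ := hγ'.exists_rootESeq hdom' hint' h
      -- The duals of `δ` and of `γ_λ` are both connected with the minimal gallery of type `λ^*`.
      -- Dualizing back, the LS property passes from `γ_λ` to the dual of that minimal gallery and
      -- from there to `δ`.
      obtain ⟨s', hs', hE'⟩ := hγ'.exists_rootESeq hdom' hint' hLS
      have h1 : IsLSGallery P b lam γlam ((γlam.dual lam).dual (-lam)) := by
        rw [Gallery.dual_dual]
        exact hγ.isLSGallery hdom hint
      have h2 := h1.dual_of_rootESeq hγ hdom hint hdual (Gallery.dual_small_last hγ.source)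
        hγ'.target hs' hE'
      have h3 := h2.dual_of_rootFSeq hγ hdom hint hγ'i hγ'.target
        (Gallery.dual_small_last hδ.2.1) hs (hE.rootFSeq hdual')
      rwa [Gallery.dual_dual] at h3
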